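/- All graphs are finite and simple. A graph $\Sigma$ on which a group $G$ acts by automorphisms is $G$-symmetric if $G$ is transitive on vertices and on arcs (ordered pairs of adjacent vertices), and $(G,2)$-arc transitive if $G$ is transitive on vertices and on 2-arcs (triples $(x,y,z)$ with $x\sim y\sim z$, $x\neq z$). A 3-arc is a quadruple $(x,y,z,w)$ with $x\sim y\sim z\sim w$, $x\ne z$, $y\ne w$; a set of 3-arcs is self-paired if it is closed under reversal. Let $\Gamma$ be a $G$-symmetric graph with $G\le\mathrm{Aut}(\Gamma)$, and let $\mathcal B$ be a $G$-invariant partition of $V(\Gamma)$ with $1<|B|<|V(\Gamma)|$ for $B\in\mathcal B$. Let $\Gamma_{\mathcal B}$ be the quotient graph on $\mathcal B$ (distinct blocks are adjacent if some edge of $\Gamma$ joins them), $\Gamma_{\mathcal B}(B)$ the neighbourhood of $B$ in it, $\Gamma(C)$ the set of vertices with a neighbour in $C$, and for adjacent blocks $B,C$ let $\Gamma[B,C]$ be the subgraph of $\Gamma$ induced by $(B\cap\Gamma(C))\cup(C\cap\Gamma(B))$. Put $v=|B|$, $k=|B\cap\Gamma(C)|$ for adjacent $B,C$, $r$ = the number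 of blocks containing a neighbour of a given vertex, $b$ = the valency of $\Gamma_{\mathcal B}$; and write $\lambda=l$ to mean $|\Gamma(C)\cap\Gamma(D)\cap B|=l$ for all $B$ and all distinct $C,D\in\Gamma_{\mathcal B}(B)$. Let $G_B^B$ and $G_B^{\Gamma_{\mathcal B}(B)}$ be the permutation groups induced by the setwise stabilizer $G_B$ on $B$ and on $\Gamma_{\mathcal B}(B)$, and $G_{(\mathcal B)}$ the kernel of $G$ on $\mathcal B$. Let $n\cdot\Sigma$ denote $n$ disjoint copies of $\Sigma$. Suppose $k=v-3\ge1$ and $\Gamma_{\mathcal B}$ is connected of valency $b\ge2$. Then $\Gamma_{\mathcal B}$ is $(G,2)$-arc transitive if and only if one of the following holds: (a) $(v,b,r,\lambda)=(4,4,1,0)$ and $G_B^B\cong A_4$ or $S_4$; (b) $(v,b,r,\lambda)=(6,2,1,0)$ and $\Gamma_{\mathcal B}\cong C_n$, where $n=|V(\Gamma)|/6$; (c) $(v,b,r,\lambda)=(7,7,4,2)$ and $G_B^B\cong \mathrm{PSL}(3,2)$; (d) $(v,b,r,\lambda)=(3a,a,a-1,3a-6)$ for some integer $a\ge3$; (e)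 $(v,b,r,\lambda)=(6,4,2,1)$ and $G_B^{\Gamma_{\mathcal B}(B)}\cong A_4$ or $S_4$. Moreover: In (a), $G_B^{\Gamma_{\mathcal B}(B)}\cong A_4$ or $S_4$ and $\Gamma\cong(|V(\Gamma)|/2)\cdot K_2$. Every connected 4-valent graph $\Sigma$ that is $(G,2)$-arc transitive for some $G\le\mathrm{Aut}(\Sigma)$ occurs, for this $G$, as $\Gamma_{\mathcal B}$ in (a) (up to a $G$-equivariant isomorphism). In (b), $\Gamma\cong 3n\cdot K_2$, $n\cdot C_6$ or $n\cdot K_{3,3}$, and $G/G_{(\mathcal B)}\cong D_{2n}$, the dihedral group of order $2n$. In (c), the incidence structure with points the vertices of $B$ and blocks the elements of $\Gamma_{\mathcal B}(B)$, where $\alpha$ and $C$ are incident iff $\alpha\notin\Gamma(C)$, is isomorphic to the Fano plane $\mathrm{PG}(2,2)$; $G_B^{\Gamma_{\mathcal B}(B)}\cong\mathrm{PSL}(3,2)$; $G$ is faithful on $\mathcal B$; and for adjacent $B,C$, $\Gamma[B,C]\cong4\cdot K_2$, $K_{4,4}-4\cdot K_2$ ($K_{4,4}$ minus a perfect matching)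 or $K_{4,4}$. In the first case $\Gamma$ is $(G,2)$-arc transitive; in the last two cases $\Gamma$ is connected of valency 12 and 16, respectively. In (d), there is a $G$-invariant partition $\mathcal P$ of $V(\Gamma)$ with block size 3, refining $\mathcal B$, and a self-paired $G$-orbit $\Delta$ on the 3-arcs of $\Gamma_{\mathcal B}$ such that $\Gamma_{\mathcal P}\cong\Xi(\Gamma_{\mathcal B},\Delta)$. Here $\Xi(\Sigma,\Delta)$ has the arcs of $\Sigma$ as vertices, $(\sigma,\tau)$ and $(\sigma',\tau')$ being adjacent iff $(\tau,\sigma,\sigma',\tau')\in\Delta$. Moreover, if $\hat B$ is the set of blocks of $\mathcal P$ contained in $B$, then $\hat{\mathcal B}=\{\hat B:B\in\mathcal B\}$ is a $G$-invariant partition of $\mathcal P$, $(\Gamma_{\mathcal P})_{\hat{\mathcal B}}\cong\Gamma_{\mathcal B}$, and the parameters of $(\Gamma_{\mathcal P},\hat{\mathcal B})$ are $v_{\hat{\mathcal B}}=b_{\hat{\mathcal B}}=a$ and $k_{\hat{\mathcal B}}=r_{\hat{\mathcal B}}=a-1$. In (e), $\Gamma\cong\Gamma_2(\Gamma_{\mathcal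 B},\Delta)$ for a self-paired $G$-orbit $\Delta$ on the 3-arcs of $\Gamma_{\mathcal B}$. Here $\Gamma_2(\Sigma,\Delta)$ has as vertices the paths of length 2 of $\Sigma$ (a path and its reverse being the same), two of them being adjacent iff they can be written $\tau\sigma\varepsilon$ and $\sigma\varepsilon\eta$ with $(\tau,\sigma,\varepsilon,\eta)\in\Delta$. Every connected 4-valent graph $\Sigma$ that is $(G,2)$-arc transitive with $G\le\mathrm{Aut}(\Sigma)$ occurs, for this $G$, as $\Gamma_{\mathcal B}$ in (e) (up to a $G$-equivariant isomorphism). -/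

import Mathlib

/- Quotients of symmetric graphs with respect to invariant partitions.
A group `G` acts on the vertex set `V` of a simple graph; when this action is faithful and
preserves adjacency, `G` is a subgroup of the automorphism group of the graph. -/

universe u w

namespace SymQuot

/-- `G` acts on the graph `Γ` as a group of automorphisms. -/
class ActsByAut (G : Type*) {V : Type*} [Group G] [MulAction G V] (Γ : SimpleGraph V) : Prop where
  smul_adj : ∀ (g : G) {x y : V}, Γ.Adj x y → Γ.Adj (g • x) (g • y)

/-- `Γ` is `G`-symmetric: `G` acts by automorphisms, transitively on vertices and on arcs. -/
structure IsSymmetric (G : Type*) {V : Type*} [Group G] [MulAction G V]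
    (Γ : SimpleGraph V) : Prop where
  acts : ActsByAut G Γ
  vertex_trans : MulAction.IsPretransitive G V
  arc_trans : ∀ {x y x' y' : V}, Γ.Adj x y → Γ.Adj x' y' → ∃ g : G, g • x = x' ∧ g • y = y'

/-- `(x, y, z)` is a 2-arc of `Γ`. -/
def IsTwoArc {V : Type*} (Γ : SimpleGraph V) (x y z : V) : Prop :=
  Γ.Adj x y ∧ Γ.Adj y z ∧ x ≠ z

/-- `Γ` is `(G, 2)`-arc transitive: `G` acts by automorphisms, transitively on vertices and on
2-arcs. -/
structure IsTwoArcTransitive (G : Type*) {V : Type*} [Group G] [MulAction G V]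
    (Γ : SimpleGraph V) : Prop where
  acts : ActsByAut G Γ
  vertex_trans : MulAction.IsPretransitive G V
  two_arc_trans : ∀ {x y z x' y' z' : V}, IsTwoArc Γ x y z → IsTwoArc Γ x' y' z' →
    ∃ g : G, g • x = x' ∧ g • y = y' ∧ g • z = z'

/-- A `G`-invariant partition of `V`, given by the equivalence relation of lying in the same
block. -/
structure InvPartition (G V : Type*) [Group G] [MulAction G V] extends Setoid V where
  smul_rel : ∀ (g : G) {x y : V}, toSetoid x y → toSetoid (g • x) (g • y)

namespace InvPartition

variable {G V : Type*} [Group G] [MulAction G V]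

/-- The set of blocks of the partition. -/
def Block (P : InvPartition G V) : Type _ := Quotient P.toSetoid

/-- The block containing a given vertex. -/
def blockOf (P : InvPartition G V) (x : V) : P.Block := Quotient.mk P.toSetoid x

/-- A block as a set of vertices. -/
def carrier (P : InvPartition G V) (B : P.Block) : Set V := {x | P.blockOf x = B}

/-- The induced action of `G` on the set of blocks. -/
instance (P : InvPartition G V) : MulAction G P.Block where
  smul g := Quotient.map (fun x => g • x) (fun _ _ h => P.smul_rel g h)
  one_smul B := by
    induction B using Quotient.inductionOn with
    | h x => exact congrArg (Quotient.mk P.toSetoid) (one_smul G x)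
  mul_smul g h B := by
    induction B using Quotient.inductionOn with
    | h x => exact congrArg (Quotient.mk P.toSetoid) (mul_smul g h x)

theorem smul_blockOf (P : InvPartition G V) (g : G) (x : V) :
    g • P.blockOf x = P.blockOf (g • x) := rfl

/-- The action of the stabilizer `G_B` of a block `B` on the vertices of `B`. -/
instance (P : InvPartition G V) (B : P.Block) :
    MulAction (MulAction.stabilizer G B) (P.carrier B) where
  smul g x := ⟨(g : G) • (x : V), by
    have hx : P.blockOf (x : V) = B := x.2
    have hg : (g : G) • B = B := g.2
    change P.blockOf ((g : G) • (x : V)) = B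
    rw [← smul_blockOf, hx, hg]⟩
  one_smul x := Subtype.ext (one_smul G (x : V))
  mul_smul g h x := Subtype.ext (mul_smul (g : G) (h : G) (x : V))

/-- The partition is nontrivial: `1 < |B| < |V|` for every block `B`. -/
def IsNontrivial (P : InvPartition G V) : Prop :=
  ∀ B : P.Block, 1 < (P.carrier B).ncard ∧ (P.carrier B).ncard < Nat.card V

/-- `P` is a refinement of `Q`. -/
def Refines (P Q : InvPartition G V) : Prop :=
  ∀ x y : V, P.blockOf x = P.blockOf y → Q.blockOf x = Q.blockOf y

/-- When `P` refines `Q`: the block of `Q` that contains a given block of `P`. -/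
def above (P Q : InvPartition G V) (h : P.Refines Q) : P.Block → Q.Block :=
  Quotient.lift Q.blockOf (fun x y hxy => h x y (Quotient.sound hxy))

/-- When `P` refines `Q`: the partition of the set of blocks of `P` whose blocks are
the sets of blocks of `P` contained in one fixed block of `Q`. -/
def hat (P Q : InvPartition G V) (h : P.Refines Q) : InvPartition G P.Block where
  toSetoid := Setoid.ker (P.above Q h)
  smul_rel g := by
    intro x y
    induction x using Quotient.inductionOn with
    | h x =>
      induction y using Quotient.inductionOn with
      | h y =>
        intro hxy
        have h1 : Q.blockOf x = Q.blockOf y := hxy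
        change Q.blockOf (g • x) = Q.blockOf (g • y)
        rw [← smul_blockOf, ← smul_blockOf, h1]

end InvPartition

section

variable {G V : Type*} [Group G] [MulAction G V]

/-- The quotient graph `Γ_𝓑`: distinct blocks are adjacent when some edge of `Γ` joins them. -/
def quotientGraph (Γ : SimpleGraph V) (P : InvPartition G V) : SimpleGraph P.Block where
  Adj B C := B ≠ C ∧ ∃ x ∈ P.carrier B, ∃ y ∈ P.carrier C, Γ.Adj x y
  symm := ⟨fun _ _ ⟨hne, x, hx, y, hy, h⟩ => ⟨hne.symm, y, hy, x, hx, h.symm⟩⟩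
  loopless := ⟨fun _ h => h.1 rfl⟩

instance (Γ : SimpleGraph V) [ActsByAut G Γ] (P : InvPartition G V) :
    ActsByAut G (quotientGraph Γ P) where
  smul_adj g := by
    rintro B C ⟨hne, x, hx, y, hy, h⟩
    refine ⟨fun h' => hne (smul_left_cancel g h'), g • x, ?_, g • y, ?_,
      ActsByAut.smul_adj g h⟩
    · exact congrArg (fun D : P.Block => g • D) hx
    · exact congrArg (fun D : P.Block => g • D) hy

/-- The action of the stabilizer of a vertex `x` on the neighbourhood of `x`. Applied to the
quotient graph this is the action of `G_B` on `Γ_𝓑(B)`. -/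
instance (Γ : SimpleGraph V) [ActsByAut G Γ] (x : V) :
    MulAction (MulAction.stabilizer G x) (Γ.neighborSet x) where
  smul g y := ⟨(g : G) • (y : V), by
    have hg : (g : G) • x = x := g.2
    have h := ActsByAut.smul_adj (Γ := Γ) (g : G) y.2
    rwa [hg] at h⟩
  one_smul y := Subtype.ext (one_smul G (y : V))
  mul_smul g h y := Subtype.ext (mul_smul (g : G) (h : G) (y : V))

/-- The permutation group that the group `H` induces on `Ω`. -/
abbrev inducedPerm (H Ω : Type*) [Group H] [MulAction H Ω] : Subgroup (Equiv.Perm Ω) :=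
  (MulAction.toPermHom H Ω).range

/-- The group `G_B^B`. -/
abbrev permOnBlock (P : InvPartition G V) (B : P.Block) : Subgroup (Equiv.Perm (P.carrier B)) :=
  inducedPerm (MulAction.stabilizer G B) (P.carrier B)

/-- The group `G_B^{Γ_𝓑(B)}`. -/
abbrev permOnNbrs (Γ : SimpleGraph V) [ActsByAut G Γ] (P : InvPartition G V) (B : P.Block) :
    Subgroup (Equiv.Perm ((quotientGraph Γ P).neighborSet B)) :=
  inducedPerm (MulAction.stabilizer G B) ((quotientGraph Γ P).neighborSet B)

/-- `B ∩ Γ(C)`: the vertices of `B` that have a neighbour in `C`. -/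
def toward (Γ : SimpleGraph V) (P : InvPartition G V) (B C : P.Block) : Set V :=
  {x | x ∈ P.carrier B ∧ ∃ y ∈ P.carrier C, Γ.Adj x y}

/-- `Γ_𝓑(x)`: the blocks that contain a neighbour of the vertex `x`. -/
def blocksNear (Γ : SimpleGraph V) (P : InvPartition G V) (x : V) : Set P.Block :=
  {C | ∃ y ∈ P.carrier C, Γ.Adj x y}

/-- `Γ[B, C]`: the subgraph of `Γ` induced by `(B ∩ Γ(C)) ∪ (C ∩ Γ(B))`. -/
def between (Γ : SimpleGraph V) (P : InvPartition G V) (B C : P.Block) :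
    SimpleGraph ↥(toward Γ P B C ∪ toward Γ P C B) :=
  Γ.induce (toward Γ P B C ∪ toward Γ P C B)

/-- The parameters `v`, `k`, `r`, `b` of `(Γ, 𝓑)`. -/
structure HasParameters (Γ : SimpleGraph V) (P : InvPartition G V) (v k r b : ℕ) : Prop where
  block_size : ∀ B : P.Block, (P.carrier B).ncard = v
  toward_card : ∀ B C : P.Block, (quotientGraph Γ P).Adj B C → (toward Γ P B C).ncard = k
  blocksNear_card : ∀ x : V, (blocksNear Γ P x).ncard = r
  valency : ∀ B : P.Block, ((quotientGraph Γ P).neighborSet B).ncard = b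

/-- The parameter `λ = |Γ(C) ∩ Γ(D) ∩ B|` for distinct `C`, `D` adjacent to `B`. -/
def HasLambda (Γ : SimpleGraph V) (P : InvPartition G V) (lam : ℕ) : Prop :=
  ∀ B C D : P.Block, (quotientGraph Γ P).Adj B C → (quotientGraph Γ P).Adj B D → C ≠ D →
    (toward Γ P B C ∩ toward Γ P B D).ncard = lam

/-- The incidence structure with point set `B`, block set `Γ_𝓑(B)`, in which `x` and `C` are
incident when `x ∉ Γ(C)`, is isomorphic to the projective plane `PG(2, 2)` (points and lines are
the 1- and 2-dimensional subspaces of the 3-dimensional space over the field with 2 elements,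
incidence is inclusion). -/
def ComplementIsFano (Γ : SimpleGraph V) (P : InvPartition G V) (B : P.Block) : Prop :=
  ∃ (f : P.carrier B ≃ {L : Submodule (ZMod 2) (Fin 3 → ZMod 2) // Module.finrank (ZMod 2) L = 1})
    (h : (quotientGraph Γ P).neighborSet B ≃
      {L : Submodule (ZMod 2) (Fin 3 → ZMod 2) // Module.finrank (ZMod 2) L = 2}),
    ∀ (x : P.carrier B) (C : (quotientGraph Γ P).neighborSet B),
      (x : V) ∉ toward Γ P B (C : P.Block) ↔ (f x).1 ≤ (h C).1

end

section

variable {W : Type*}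

/-- `(a, b, c, d)` is a 3-arc of `Σ`. -/
def IsThreeArc (S : SimpleGraph W) (t : W × W × W × W) : Prop :=
  S.Adj t.1 t.2.1 ∧ S.Adj t.2.1 t.2.2.1 ∧ S.Adj t.2.2.1 t.2.2.2 ∧
    t.1 ≠ t.2.2.1 ∧ t.2.1 ≠ t.2.2.2

/-- A set of quadruples closed under reversal. -/
def SelfPaired (D : Set (W × W × W × W)) : Prop :=
  ∀ a b c d : W, (a, b, c, d) ∈ D → (d, c, b, a) ∈ D

/-- `D` is a self-paired `G`-orbit on the set of 3-arcs of `S`. -/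
structure IsSelfPairedOrbit (G : Type*) [Group G] [MulAction G W] (S : SimpleGraph W)
    (D : Set (W × W × W × W)) : Prop where
  three_arc : ∀ t ∈ D, IsThreeArc S t
  self_paired : SelfPaired D
  orbit : ∃ t : W × W × W × W, D = MulAction.orbit G t

/-- The 3-arc graph `Ξ(S, D)`: its vertices are the arcs of `S`, and `(σ, τ)`, `(σ', τ')` are
adjacent when `(τ, σ, σ', τ') ∈ D`. -/
def threeArcGraph (S : SimpleGraph W) (D : Set (W × W × W × W))
    (h3 : ∀ t ∈ D, IsThreeArc S t) (hs : SelfPaired D) : SimpleGraph S.Dart where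
  Adj p q := (p.snd, p.fst, q.fst, q.snd) ∈ D
  symm := ⟨fun _ _ h => hs _ _ _ _ h⟩
  loopless := ⟨fun p h => S.loopless.irrefl p.fst (h3 _ h).2.1⟩

/-- The 2-paths `τ σ τ'` of `S`: a middle vertex `σ` and an unordered pair of distinct
neighbours of `σ`. -/
def TwoPath (S : SimpleGraph W) : Type _ :=
  {p : W × Sym2 W // ¬ p.2.IsDiag ∧ ∀ x ∈ p.2, S.Adj p.1 x}

/-- The graph `Γ₂(S, D)` on the 2-paths of `S`: `τ σ ε` and `σ ε η` are adjacent when the 3-arc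
`(τ, σ, ε, η)` belongs to `D`. -/
def twoPathGraph (S : SimpleGraph W) (D : Set (W × W × W × W))
    (h3 : ∀ t ∈ D, IsThreeArc S t) (hs : SelfPaired D) : SimpleGraph (TwoPath S) where
  Adj p q := ∃ a d : W, p.1.2 = s(a, q.1.1) ∧ q.1.2 = s(p.1.1, d) ∧ (a, p.1.1, q.1.1, d) ∈ D
  symm := ⟨fun _ _ ⟨a, d, h1, h2, h⟩ =>
    ⟨d, a, h2.trans Sym2.eq_swap, h1.trans Sym2.eq_swap, hs _ _ _ _ h⟩⟩
  loopless := ⟨fun p ⟨_, _, _, _, h⟩ => S.loopless.irrefl p.1.1 (h3 _ h).2.1⟩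

/-- `n · S`: the disjoint union of `n` copies of `S`. -/
def copies (n : ℕ) (S : SimpleGraph W) : SimpleGraph (Fin n × W) where
  Adj p q := p.1 = q.1 ∧ S.Adj p.2 q.2
  symm := ⟨fun _ _ h => ⟨h.1.symm, h.2.symm⟩⟩
  loopless := ⟨fun p h => S.loopless.irrefl p.2 h.2⟩

/-- The perfect matching `n · K₂` of `K_{n,n}` that joins the `i`-th vertices of the two parts. -/
def matching (n : ℕ) : SimpleGraph (Fin n ⊕ Fin n) :=
  SimpleGraph.fromRel fun x y => ∃ i : Fin n, x = Sum.inl i ∧ y = Sum.inr i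

/-- `A₄` or `S₄`. -/
def IsoA4OrS4 (H : Type*) [Group H] : Prop :=
  Nonempty (H ≃* alternatingGroup (Fin 4)) ∨ Nonempty (H ≃* Equiv.Perm (Fin 4))

/-- `PSL(3, 2)`. -/
def IsoPSL32 (H : Type*) [Group H] : Prop :=
  Nonempty (H ≃* Matrix.ProjectiveSpecialLinearGroup (Fin 3) (ZMod 2))

end

section

variable {G V : Type*} [Group G] [MulAction G V]

/-- `Γ` is a `G`-symmetric graph with `G ≤ Aut(Γ)`, and `𝓑` is a nontrivial `G`-invariant
partition with parameters `v, k, r, b` such that `k = v - 3 ≥ 1` and the quotient graph is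
connected of valency `b ≥ 2`. -/
structure Setting (Γ : SimpleGraph V) (P : InvPartition G V) (v k r b : ℕ) : Prop where
  faithful : FaithfulSMul G V
  symmetric : IsSymmetric G Γ
  nontrivial : P.IsNontrivial
  params : HasParameters Γ P v k r b
  k_eq : v = k + 3
  k_pos : 1 ≤ k
  connected : (quotientGraph Γ P).Connected
  two_le_b : 2 ≤ b

/-- Case (a): `(v, b, r, λ) = (4, 4, 1, 0)` and `G_B^B` is `A₄` or `S₄`. -/
def CaseA (Γ : SimpleGraph V) (P : InvPartition G V) (v b r : ℕ) : Prop :=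
  (v, b, r) = (4, 4, 1) ∧ HasLambda Γ P 0 ∧ ∀ B : P.Block, IsoA4OrS4 (permOnBlock P B)

/-- Case (b): `(v, b, r, λ) = (6, 2, 1, 0)` and the quotient graph is a cycle of length
`|V| / 6`. -/
def CaseB (Γ : SimpleGraph V) (P : InvPartition G V) (v b r : ℕ) : Prop :=
  (v, b, r) = (6, 2, 1) ∧ HasLambda Γ P 0 ∧
    Nonempty (quotientGraph Γ P ≃g SimpleGraph.cycleGraph (Nat.card V / 6))

/-- Case (c): `(v, b, r, λ) = (7, 7, 4, 2)` and `G_B^B` is `PSL(3, 2)`. -/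
def CaseC (Γ : SimpleGraph V) (P : InvPartition G V) (v b r : ℕ) : Prop :=
  (v, b, r) = (7, 7, 4) ∧ HasLambda Γ P 2 ∧ ∀ B : P.Block, IsoPSL32 (permOnBlock P B)

/-- Case (d) for a given `a`: `a ≥ 3` and `(v, b, r, λ) = (3a, a, a - 1, 3a - 6)`. -/
def CaseD (Γ : SimpleGraph V) (P : InvPartition G V) (v b r a : ℕ) : Prop :=
  3 ≤ a ∧ (v, b, r) = (3 * a, a, a - 1) ∧ HasLambda Γ P (3 * a - 6)

/-- Case (e): `(v, b, r, λ) = (6, 4, 2, 1)` and `G_B^{Γ_𝓑(B)}` is `A₄` or `S₄`. -/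
def CaseE (Γ : SimpleGraph V) [ActsByAut G Γ] (P : InvPartition G V) (v b r : ℕ) : Prop :=
  (v, b, r) = (6, 4, 2) ∧ HasLambda Γ P 1 ∧ ∀ B : P.Block, IsoA4OrS4 (permOnNbrs Γ P B)

end

end SymQuot

open SymQuot

/-! ### Double counting and the possible systems of triples. -/

section Counting

/-! Fix a block B and read its adjacent blocks as lines on the points of B, a point lying on the
line C when it has no neighbour in C (`Misses`). As v - k = 3, every line has three points, and
every point lies on b - r lines. If the quotient graph is (G,2)-arc transitive, any two lines at a
block meet in the same number m = 6 + λ - v of points. Double counting (`triple_system_parameters`)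
leaves four configurations: b disjoint triples, the four triples in a 4-set, six points with four
lines meeting pairwise in one point, and a system with the parameters of the Fano plane. Disjoint
triples give (b) when b = 2 and (d) when b ≥ 3; the others give (a), (e) and (c).

The group condition is local: G_B has to be 2-transitive on the blocks adjacent to B
(`isTwoArcTransitive_iff`). For disjoint triples with b ≥ 3 it follows from arc-transitivity of Γ,
because a vertex determines the one block it misses and a neighbour of it lies in a different one.
For b = 2 it follows from arc-transitivity of the quotient. In degree four, 2-transitivity means
inducing A₄ or S₄ (`isoA4OrS4_inducedPerm_iff`); in (a) the points of B and the adjacent blocks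
carry the same action. In (c) the incidence structure gets coordinates over the field of two
elements (`exists_fanoCoords`), so that collineations become matrices in SL(3,2). A group
2-transitive on lines contains an involution, which is a transvection; its conjugates are all
transvections, and these generate SL(3,2) (`realizes_of_twoTransitive`).

The structure statements decode vertices from blocks. In (a) and (b) every vertex sees one block, so
Γ is a disjoint union of the graphs Γ[B,C]. In (d) the block of x together with its missed block is
an arc of the quotient, and in (e) the two blocks seen by x are the ends of a 2-path; edges of Γ
then become a single orbit of 3-arcs. In (c) the 2-transitivity of a line stabilizer off the line
excludes valency two for Γ[B,C].

For the occurrence statements, a given 4-valent graph is lifted to its arcs, each joined to its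
reverse (`exists_caseA`), or to its 2-paths (`exists_caseE`). The latter needs a self-paired orbit
of 3-arcs, supplied by the cube of an element reversing an arc (`exists_isSelfPairedOrbit`). -/

theorem ncard_setOf_subtype {A : Type*} (p q : A → Prop) :
    {a : {a // p a} | q a}.ncard = {a | p a ∧ q a}.ncard := by
  rw [← Set.ncard_image_of_injective _ Subtype.val_injective]
  congr 1
  ext a
  constructor
  · rintro ⟨⟨b, hb⟩, hq, rfl⟩
    exact ⟨hb, hq⟩
  · rintro ⟨hp, hq⟩
    exact ⟨⟨a, hp⟩, hq, rfl⟩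

theorem ncard_setOf_equiv {A B : Type*} (e : A ≃ B) (q : B → Prop) :
    {a | q (e a)}.ncard = {b | q b}.ncard := by
  rw [← Set.ncard_image_of_injective _ e.injective]
  congr 1
  ext b
  exact ⟨by rintro ⟨a, h, rfl⟩; exact h, fun h => ⟨e.symm b, by simpa using h, by simp⟩⟩

theorem ncard_and_ne {A : Type*} [Finite A] (q : A → Prop) (a : A) (ha : q a) :
    {x | x ≠ a ∧ q x}.ncard = {x | q x}.ncard - 1 := by
  rw [← Set.ncard_sdiff_singleton_of_mem (s := {x | q x}) ha]
  congr 1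
  ext x
  simp [and_comm]

theorem card_mul_eq_of_ncard {A B : Type*} [Finite A] [Finite B] (r : A → B → Prop) (p q : ℕ)
    (hp : ∀ a, {b | r a b}.ncard = p) (hq : ∀ b, {a | r a b}.ncard = q) :
    Nat.card A * p = Nat.card B * q := by
  classical
  have := Fintype.ofFinite A
  have := Fintype.ofFinite B
  rw [Nat.card_eq_fintype_card, Nat.card_eq_fintype_card]
  refine Finset.card_mul_eq_card_mul r (s := Finset.univ) (t := Finset.univ) ?_ ?_
  · intro a _
    rw [← hp a, Set.ncard_eq_toFinset_card']
    congr 1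
    ext b
    simp [Finset.mem_bipartiteAbove]
  · intro b _
    rw [← hq b, Set.ncard_eq_toFinset_card']
    congr 1
    ext b
    simp [Finset.mem_bipartiteBelow]

theorem card_le_of_ncard {A B : Type*} [Finite A] [Finite B] (r : A → B → Prop) (p : ℕ)
    (hp : ∀ a, {b | r a b}.ncard = p) (hq : ∀ b a a', r a b → r a' b → a = a') :
    Nat.card A * p ≤ Nat.card B := by
  classical
  have := Fintype.ofFinite A
  have := Fintype.ofFinite B
  rw [Nat.card_eq_fintype_card, Nat.card_eq_fintype_card, ← mul_one (Fintype.card B)]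
  refine Finset.card_mul_le_card_mul r (s := Finset.univ) (t := Finset.univ) ?_ ?_
  · intro a _
    rw [← hp a, Set.ncard_eq_toFinset_card']
    apply Finset.card_le_card
    intro b
    simp [Finset.mem_bipartiteAbove]
  · intro b _
    rw [Finset.card_le_one]
    intro a ha a' ha'
    exact hq b a a' (by simpa [Finset.mem_bipartiteBelow] using ha)
      (by simpa [Finset.mem_bipartiteBelow] using ha')

/-- The relation between the intersection number of two lines and the number of lines through
a point. -/
theorem line_count {X L : Type*} [Finite X] [Finite L] (I : X → L → Prop) (s m t : ℕ)
    (h3 : ∀ l, {x | I x l}.ncard = t) (hs : ∀ x, {l | I x l}.ncard = s)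
    (hm : ∀ l l', l ≠ l' → {x | I x l ∧ I x l'}.ncard = m) (l : L) :
    t * (s - 1) = (Nat.card L - 1) * m := by
  have h := card_mul_eq_of_ncard (A := {x // I x l}) (B := {l' // l' ≠ l})
    (fun x l' => I x l') (s - 1) m (fun x => by
      rw [ncard_setOf_subtype (fun l' => l' ≠ l) (fun l' => I x l'), ncard_and_ne _ _ x.2, hs])
    (fun l' => by
      rw [ncard_setOf_subtype (fun x => I x l) (fun x => I x l'), hm _ _ l'.2.symm])
  have h1 : Nat.card {x // I x l} = t := by
    rw [← h3 l]; rfl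
  have h2 : Nat.card {l' // l' ≠ l} = Nat.card L - 1 := by
    have := Set.ncard_sdiff_singleton_of_mem (s := (Set.univ : Set L)) (a := l) trivial
    rw [Set.ncard_univ] at this
    rw [← this]
    change Set.ncard {l' | l' ≠ l} = _
    congr 1
    ext x
    simp
  rw [← h1, ← h2, h]

/-- With v points and b lines, the two counts are vs = 3b and 3(s - 1) = (b - 1)m, with m ≤ 3. They
settle m = 0 and m = 2, and m = 3 would force v = 3. For m = 1 they give v = 9 - 6/s, and the bound
2s ≤ v - 1 leaves only s = 2 and s = 3. -/
theorem triple_system_parameters {X L : Type*} [Finite X] [Finite L] (I : X → L → Prop) (s m : ℕ)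
    (h3 : ∀ l, {x | I x l}.ncard = 3) (hs : ∀ x, {l | I x l}.ncard = s)
    (hm : ∀ l l', l ≠ l' → {x | I x l ∧ I x l'}.ncard = m)
    (hb : 2 ≤ Nat.card L) (hv : 4 ≤ Nat.card X) :
    (m = 0 ∧ s = 1 ∧ Nat.card X = 3 * Nat.card L) ∨
    (m = 1 ∧ s = 2 ∧ Nat.card X = 6 ∧ Nat.card L = 4) ∨
    (m = 1 ∧ s = 3 ∧ Nat.card X = 7 ∧ Nat.card L = 7) ∨
    (m = 2 ∧ s = 3 ∧ Nat.card X = 4 ∧ Nat.card L = 4) := by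
  obtain ⟨l, l', hll⟩ : ∃ l l' : L, l ≠ l' := by
    have := Finite.one_lt_card_iff_nontrivial.1 (by omega : 1 < Nat.card L)
    exact exists_pair_ne L
  have e1 := card_mul_eq_of_ncard I s 3 hs h3
  have e2 := line_count I s m 3 h3 hs hm l
  have hs0 : 1 ≤ s := by
    by_contra h
    have : s = 0 := by omega
    subst this
    omega
  have hm3 : m ≤ 3 := by
    rw [← hm l l' hll, ← h3 l]
    exact Set.ncard_le_ncard (fun x hx => hx.1)
  generalize hbb : Nat.card L = b at *
  generalize hvv : Nat.card X = v at *
  -- From here on `s` and `b` stand for one less than the original numbers, which removes truncated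
  -- subtraction.
  obtain ⟨s, rfl⟩ : ∃ t, s = t + 1 := ⟨s - 1, by omega⟩
  obtain ⟨b, rfl⟩ : ∃ t, b = t + 1 := ⟨b - 1, by omega⟩
  simp only [Nat.add_sub_cancel] at e2
  interval_cases m
  · left
    have : s = 0 := by omega
    subst this
    omega
  -- Lines through a point x share nothing else when m = 1, so their remaining pairs of points are
  -- disjoint subsets of the complement of x.
  · have hle : (s + 1) * 2 ≤ v - 1 := by
      have hpos : 0 < Nat.card X := by omega
      obtain ⟨x⟩ := (Nat.card_pos_iff.1 hpos).1
      have h := card_le_of_ncard (A := {l // I x l}) (B := {y // y ≠ x})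
        (fun l y => I y l) 2 (fun l => by
          rw [ncard_setOf_subtype (fun y => y ≠ x) (fun y => I y l), ncard_and_ne (fun y => I y l.1) x l.2, h3])
        (fun y l l' h h' => by
          by_contra hne
          have h1 := hm l l' (fun h => hne (Subtype.ext h))
          obtain ⟨z, hz⟩ := Set.ncard_eq_one.1 h1
          have hx : x ∈ ({z} : Set X) := hz ▸ ⟨l.2, l'.2⟩
          have hy : (y : X) ∈ ({z} : Set X) := hz ▸ ⟨h, h'⟩
          exact y.2 (hy.trans hx.symm))
      have h1 : Nat.card {l // I x l} = s + 1 := by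
        rw [← hs x]; rfl
      have h2 : Nat.card {y // y ≠ x} = v - 1 := by
        have := Set.ncard_sdiff_singleton_of_mem (s := (Set.univ : Set X)) (a := x) trivial
        rw [Set.ncard_univ, hvv] at this
        rw [← this]
        change Set.ncard {l' | l' ≠ x} = _
        congr 1
        ext x
        simp
      rwa [h1, h2] at h
    have hb3 : b = 3 * s := by omega
    subst hb3
    have hv9 : v ≤ 8 := by
      by_contra h
      have : 9 * (s + 1) ≤ v * (s + 1) := Nat.mul_le_mul_right _ (by omega)
      omega
    have hs8 : s ≤ 3 := by omega
    interval_cases s <;> omega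
  · right; right; right
    have : v ≤ 4 := by
      by_contra h
      have : 5 * (s + 1) ≤ v * (s + 1) := Nat.mul_le_mul_right _ (by omega)
      omega
    have : v = 4 := by omega
    subst this
    omega
  · have hbs : s = b := by omega
    subst hbs
    have : v = 3 := Nat.eq_of_mul_eq_mul_right (Nat.succ_pos s) (by rw [Nat.succ_eq_add_one, e1, mul_comm])
    omega

end Counting

/-! ### Two-transitive groups of degree four. -/

section DegreeFour

variable {H X : Type*} [Group H] [MulAction H X]

theorem inducedPerm_twoTransitive_iff :
    MulAction.IsMultiplyPretransitive (inducedPerm H X) X 2 ↔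
      MulAction.IsMultiplyPretransitive H X 2 := by
  rw [MulAction.is_two_pretransitive_iff, MulAction.is_two_pretransitive_iff]
  constructor
  · intro h a b c d hab hcd
    obtain ⟨⟨g, t, rfl⟩, h1, h2⟩ := h hab hcd
    exact ⟨t, h1, h2⟩
  · intro h a b c d hab hcd
    obtain ⟨t, h1, h2⟩ := h hab hcd
    exact ⟨⟨_, t, rfl⟩, h1, h2⟩

/-- The abstract isomorphism type fixes the order as 12 or 24, hence the index in the symmetric
group as at most 2, which means containing the alternating group. That group is 2-transitive on four
points, and conversely an (n - 2)-transitive group of degree n contains it. -/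
theorem isoA4OrS4_inducedPerm_iff (hX : Nat.card X = 4) :
    IsoA4OrS4 (inducedPerm H X) ↔ MulAction.IsMultiplyPretransitive H X 2 := by
  classical
  have : Finite X := Nat.finite_of_card_ne_zero (by omega)
  have := Fintype.ofFinite X
  have hX' : Fintype.card X = 4 := by rw [← Nat.card_eq_fintype_card, hX]
  have : Nontrivial X := Fintype.one_lt_card_iff_nontrivial.1 (by omega)
  let e : X ≃ Fin 4 := Fintype.equivFinOfCardEq hX'
  have hle : ∀ K : Subgroup (Equiv.Perm X), K.index ≤ 2 ↔ alternatingGroup X ≤ K := by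
    refine fun K => ⟨Equiv.Perm.alternatingGroup_le_of_index_le_two, fun h => ?_⟩
    rw [← alternatingGroup.index_eq_two (α := X)]
    exact Nat.le_of_dvd (by rw [alternatingGroup.index_eq_two]; omega) (Subgroup.index_dvd_of_le h)
  have hcard : ∀ K : Subgroup (Equiv.Perm X), Nat.card K * K.index = 24 := by
    intro K
    rw [K.card_mul_index, Nat.card_perm, hX]
    rfl
  rw [← inducedPerm_twoTransitive_iff]
  generalize inducedPerm H X = K
  have key : IsoA4OrS4 K ↔ alternatingGroup X ≤ K := by
    rw [← hle]
    have hK := hcard K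
    constructor
    · rintro (⟨⟨f⟩⟩ | ⟨⟨f⟩⟩)
      · rw [Nat.card_congr f.toEquiv, nat_card_alternatingGroup] at hK
        simp [Nat.factorial] at hK
        omega
      · rw [Nat.card_congr f.toEquiv, Nat.card_perm, Nat.card_fin,
          show Nat.factorial 4 = 24 from rfl] at hK
        omega
    · intro h
      have h0 : K.index ≠ 0 := by
        intro h0
        rw [h0] at hK
        omega
      rcases (by omega : K.index = 2 ∨ K.index = 1) with h | h
      · left
        rw [Equiv.Perm.eq_alternatingGroup_of_index_eq_two h]
        exact ⟨e.altCongrHom⟩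
      · right
        rw [Subgroup.index_eq_one.1 h]
        exact ⟨Subgroup.topEquiv.trans e.permCongrHom⟩
  rw [key]
  constructor
  · intro h
    have h2 := alternatingGroup.isMultiplyPretransitive X
    rw [hX, MulAction.is_two_pretransitive_iff] at h2
    rw [MulAction.is_two_pretransitive_iff]
    intro a b c d hab hcd
    obtain ⟨⟨g, hg⟩, h1⟩ := h2 hab hcd
    exact ⟨⟨g, h hg⟩, h1⟩
  · intro h
    exact IsMultiplyPretransitive.alternatingGroup_le (α := X) K (by rwa [hX])

end DegreeFour

/-! ### Disjoint unions of copies of a graph. -/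

section Copies

/-- A graph whose vertex set is fibred so that edges stay inside fibres and each fibre induces a
copy of `S` is a disjoint union of copies of `S`. -/
theorem nonempty_iso_copies {V E W : Type*} [Finite E] (Γ : SimpleGraph V) (S : SimpleGraph W)
    (f : V → E) (hf : ∀ x y, Γ.Adj x y → f x = f y) (n : ℕ) (hn : Nat.card E = n)
    (h : ∀ e : E, Nonempty (Γ.induce (f ⁻¹' {e}) ≃g S)) : Nonempty (Γ ≃g copies n S) := by
  classical
  have := Fintype.ofFinite E
  let ε : E ≃ Fin n := Fintype.equivFinOfCardEq (by rw [← Nat.card_eq_fintype_card, hn])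
  let φ : ∀ e : E, Γ.induce (f ⁻¹' {e}) ≃g S := fun e => (h e).some
  -- The chosen isomorphisms depend on the fibre; this moves along an equality of fibres without
  -- casts.
  have hφ : ∀ (e e' : E) (x : V) (hx : f x = e) (hx' : f x = e'),
      φ e ⟨x, hx⟩ = φ e' ⟨x, hx'⟩ := by
    rintro e e' x rfl rfl
    rfl
  refine ⟨{ toFun := fun x => (ε (f x), φ (f x) ⟨x, rfl⟩)
            invFun := fun p => ((φ (ε.symm p.1)).symm p.2 : _).1
            left_inv := ?_
            right_inv := ?_
            map_rel_iff' := ?_ }⟩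
  · intro x
    simp only
    have : ε.symm (ε (f x)) = f x := by simp
    rw [← hφ (ε.symm (ε (f x))) (f x) x (by simp) rfl]
    simp
  · rintro ⟨i, w⟩
    have h1 : f ((φ (ε.symm i)).symm w : _).1 = ε.symm i := ((φ (ε.symm i)).symm w).2
    simp only
    rw [← hφ (ε.symm i) _ _ h1 rfl, h1]
    simp only [Equiv.apply_symm_apply, Prod.mk.injEq, true_and]
    exact (φ (ε.symm i)).apply_symm_apply w
  · intro x y
    simp only [copies, Equiv.coe_fn_mk]
    constructor
    · rintro ⟨h1, h2⟩
      have h3 : f x = f y := by simpa using h1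
      rw [← hφ (f x) (f y) y h3.symm rfl] at h2
      exact (φ (f x)).map_rel_iff.1 h2
    · intro hxy
      have h3 := hf x y hxy
      refine ⟨by rw [h3], ?_⟩
      rw [← hφ (f x) (f y) y h3.symm rfl]
      exact (φ (f x)).map_rel_iff.2 hxy

theorem card_eq_of_iso_copies {V W : Type*} {Γ : SimpleGraph V} {S : SimpleGraph W} {n : ℕ}
    (h : Nonempty (Γ ≃g copies n S)) : Nat.card V = n * Nat.card W := by
  obtain ⟨f⟩ := h
  rw [Nat.card_congr f.toEquiv, Nat.card_prod, Nat.card_fin]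

/-- A graph of valency one is a perfect matching. -/
theorem nonempty_iso_copies_top {V : Type*} [Finite V] (Γ : SimpleGraph V)
    (h : ∀ x, ∃! y, Γ.Adj x y) :
    Nonempty (Γ ≃g copies (Nat.card V / 2) (⊤ : SimpleGraph (Fin 2))) := by
  classical
  choose m hm hm' using h
  have hmm : ∀ x, m (m x) = x := fun x => (hm' _ _ (hm x).symm).symm
  -- The fibres of x ↦ {x, m x} are the edges. Their number is recovered afterwards from the number
  -- of vertices.
  have key : Nonempty (Γ ≃g copies (Nat.card (Set.range fun x => s(x, m x)))
      (⊤ : SimpleGraph (Fin 2))) := by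
    refine nonempty_iso_copies Γ _ (fun x => (⟨s(x, m x), x, rfl⟩ :
      Set.range fun x => s(x, m x))) ?_ _ rfl ?_
    · intro x y hxy
      have hy := hm' _ _ hxy
      subst hy
      simp [hmm, Sym2.eq_swap]
    · rintro ⟨_, x, rfl⟩
      have hmem : ∀ y, s(y, m y) = s(x, m x) ↔ y = x ∨ y = m x := by
        intro y
        constructor
        · intro h
          have : y ∈ s(x, m x) := h ▸ Sym2.mem_mk_left _ _
          simpa using this
        · rintro (rfl | rfl)
          · rfl
          · rw [hmm, Sym2.eq_swap]
      have hne : m x ≠ x := fun h => Γ.loopless.irrefl x (by simpa [h] using hm x)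
      refine ⟨{ toFun := fun y => if y.1 = x then 0 else 1
                invFun := fun i => if i = 0 then ⟨x, rfl⟩ else ⟨m x, by simp [hmm, Sym2.eq_swap]⟩
                left_inv := ?_
                right_inv := ?_
                map_rel_iff' := ?_ }⟩
      · rintro ⟨y, hy⟩
        rcases (hmem y).1 (congrArg Subtype.val hy) with rfl | rfl
        · simp
        · simp [hne]
      · intro i
        fin_cases i <;> simp [hne]
      · rintro ⟨y, hy⟩ ⟨z, hz⟩
        rcases (hmem y).1 (congrArg Subtype.val hy) with rfl | rfl <;>
        rcases (hmem z).1 (congrArg Subtype.val hz) with rfl | rfl <;>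
        simp [hne, hm, (hm _).symm]
  have hc := card_eq_of_iso_copies key
  rw [Nat.card_fin] at hc
  rwa [hc, Nat.mul_div_cancel _ (by norm_num)]

end Copies

/-! ### Coordinates for the Fano plane and its collineation group. -/

section Fano

open Matrix

-- Distinct nonzero vectors over the two-element field are independent, and the plane they span has
-- exactly three nonzero vectors; w is its normal.
set_option synthInstance.maxSize 10000 in
set_option synthInstance.maxHeartbeats 1000000 in
theorem exists_normal_vector : ∀ u v : Fin 3 → ZMod 2, u ≠ 0 → v ≠ 0 → u ≠ v →
    ∃ w : Fin 3 → ZMod 2, w ≠ 0 ∧ ∀ t : Fin 3 → ZMod 2, t ≠ 0 →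
      (t 0 * w 0 + t 1 * w 1 + t 2 * w 2 = 0 ↔ t = u ∨ t = v ∨ t = u + v) := by
  decide +kernel

-- The expression is the 3 × 3 determinant as expanded by `det_fin_three`: two independent vectors
-- extend to a basis.
set_option synthInstance.maxSize 10000 in
set_option synthInstance.maxHeartbeats 1000000 in
theorem exists_frame_of_ne : ∀ u v : Fin 3 → ZMod 2, u ≠ 0 → v ≠ 0 → u ≠ v →
    ∃ w : Fin 3 → ZMod 2,
      u 0 * v 1 * w 2 - u 0 * v 2 * w 1 - u 1 * v 0 * w 2 + u 1 * v 2 * w 0 + u 2 * v 0 * w 1 -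
        u 2 * v 1 * w 0 = 1 := by
  decide +kernel

-- The basis extension can be kept inside the affine plane on which the functional l takes the value
-- 1; matrices matching two such bases preserve l.
set_option synthInstance.maxSize 10000 in
set_option synthInstance.maxHeartbeats 1000000 in
theorem exists_affine_frame_of_ne : ∀ l u v : Fin 3 → ZMod 2,
    l 0 * u 0 + l 1 * u 1 + l 2 * u 2 = 1 → l 0 * v 0 + l 1 * v 1 + l 2 * v 2 = 1 → u ≠ v →
    ∃ w : Fin 3 → ZMod 2, l 0 * w 0 + l 1 * w 1 + l 2 * w 2 = 1 ∧
      u 0 * v 1 * w 2 - u 0 * v 2 * w 1 - u 1 * v 0 * w 2 + u 1 * v 2 * w 0 + u 2 * v 0 * w 1 -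
        u 2 * v 1 * w 0 = 1 := by
  decide +kernel

theorem zmod_two_eq_one_of_ne_zero : ∀ a : ZMod 2, a ≠ 0 → a = 1 := by decide

/-- Two bases of determinant one are related by a matrix of determinant one. -/
theorem exists_mulVec_frame_eq (u v : Fin 3 → Fin 3 → ZMod 2) (hu : (Matrix.of u).det = 1)
    (hv : (Matrix.of v).det = 1) :
    ∃ M : Matrix (Fin 3) (Fin 3) (ZMod 2), M.det = 1 ∧ ∀ i, M *ᵥ u i = v i := by
  have hU : ∀ i, (Matrix.of u)ᵀ *ᵥ Pi.single i 1 = u i := fun i => by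
    rw [mulVec_single_one]; rfl
  have hW : ∀ i, (Matrix.of v)ᵀ *ᵥ Pi.single i 1 = v i := fun i => by
    rw [mulVec_single_one]; rfl
  refine ⟨(Matrix.of v)ᵀ * ((Matrix.of u)ᵀ)⁻¹, ?_, fun i => ?_⟩
  · rw [det_mul, det_nonsing_inv, det_transpose, det_transpose, hu, hv, Ring.inverse_one, mul_one]
  · rw [← hU, mulVec_mulVec, nonsing_inv_mul_cancel_right, hW]
    rw [det_transpose, hu]
    exact isUnit_one

theorem eq_of_frame {u : Fin 3 → Fin 3 → ZMod 2} (hu : (Matrix.of u).det = 1)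
    {v w : Fin 3 → ZMod 2} (h : ∀ i, u i ⬝ᵥ v = u i ⬝ᵥ w) : v = w := by
  have h1 : Matrix.of u *ᵥ v = Matrix.of u *ᵥ w := funext h
  apply mulVec_injective_of_isUnit (A := Matrix.of u) _ h1
  rw [isUnit_iff_isUnit_det, hu]
  exact isUnit_one

/-- The rank inequality for N * N = 0 gives twice the rank of N at most 3, so the rank is at most 1.
-/
theorem eq_vecMulVec_of_mul_self_eq_zero {N : Matrix (Fin 3) (Fin 3) (ZMod 2)} (hN : N * N = 0) :
    ∃ c f : Fin 3 → ZMod 2, N = vecMulVec c f := by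
  have h := rank_add_rank_le_card_of_mul_eq_zero hN
  rw [Fintype.card_fin] at h
  have h1 : N.rank ≤ 1 := by omega
  obtain ⟨⟨c, hc⟩, h2⟩ := finrank_le_one_iff.1 h1
  choose f hf using fun j => h2 ⟨N *ᵥ Pi.single j 1, Pi.single j 1, rfl⟩
  refine ⟨c, f, ?_⟩
  ext i j
  have := congrArg (fun x => x.1 i) (hf j)
  simp only [mulVec_single_one] at this
  rw [vecMulVec_apply, mul_comm]
  exact this.symm

/-- Coordinates that identify an incidence structure with the Fano plane: points and lines
correspond to nonzero vectors, incidence is orthogonality. -/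
structure FanoCoords {X L : Type*} (I : X → L → Prop) where
  /-- coordinates of points -/
  pt : X → Fin 3 → ZMod 2
  /-- coordinates of lines -/
  ln : L → Fin 3 → ZMod 2
  pt_ne : ∀ x, pt x ≠ 0
  ln_ne : ∀ l, ln l ≠ 0
  pt_inj : Function.Injective pt
  ln_inj : Function.Injective ln
  pt_surj : ∀ v, v ≠ 0 → ∃ x, pt x = v
  ln_surj : ∀ v, v ≠ 0 → ∃ l, ln l = v
  inc : ∀ x l, I x l ↔ pt x ⬝ᵥ ln l = 0

theorem surj_nonzero_of_injective {X : Type*} [Finite X] (hX : Nat.card X = 7)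
    (f : X → Fin 3 → ZMod 2) (h0 : ∀ x, f x ≠ 0) (hf : Function.Injective f) :
    ∀ v, v ≠ 0 → ∃ x, f x = v := by
  have := Fintype.ofFinite X
  let g : X → {v : Fin 3 → ZMod 2 // v ≠ 0} := fun x => ⟨f x, h0 x⟩
  have hg : Function.Injective g := fun x y h => hf (congrArg Subtype.val h)
  have hc : Fintype.card X = Fintype.card {v : Fin 3 → ZMod 2 // v ≠ 0} := by
    rw [← Nat.card_eq_fintype_card, hX]
    decide
  have := (Fintype.bijective_iff_injective_and_card g).2 ⟨hg, hc⟩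
  intro v hv
  obtain ⟨x, hx⟩ := this.2 ⟨v, hv⟩
  exact ⟨x, congrArg Subtype.val hx⟩

/-- Three lines without a common point serve as coordinate lines, and the i-th coordinate of a point
says whether it is off the i-th of them. The three points of every line then have coordinate vectors
summing to zero, so lines become planes of the vector space. -/
theorem exists_fanoCoords {X L : Type*} [Finite X] [Finite L] (I : X → L → Prop)
    (hX : Nat.card X = 7) (hL : Nat.card L = 7) (h3 : ∀ l, {x | I x l}.ncard = 3)
    (hs : ∀ x, {l | I x l}.ncard = 3)
    (hm : ∀ l l', l ≠ l' → {x | I x l ∧ I x l'}.ncard = 1) : Nonempty (FanoCoords I) := by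
  classical
  have huniq : ∀ x y l l', x ≠ y → I x l → I y l → I x l' → I y l' → l = l' := by
    intro x y l l' hxy h1 h2 h3 h4
    by_contra hne
    obtain ⟨z, hz⟩ := Set.ncard_eq_one.1 (hm l l' hne)
    have hx : x ∈ ({z} : Set X) := hz ▸ ⟨h1, h3⟩
    have hy : y ∈ ({z} : Set X) := hz ▸ ⟨h2, h4⟩
    exact hxy (hx.trans hy.symm)
  -- The three lines through x cover six further points; if all of them avoided y, only five points
  -- would be available.
  have hline : ∀ x y, x ≠ y → ∃ l, I x l ∧ I y l := by
    intro x y hxy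
    by_contra hno
    push Not at hno
    have h := card_le_of_ncard (A := {l // I x l}) (B := {z // z ≠ y ∧ z ≠ x})
      (fun l z => I z l) 2 (fun l => by
        rw [ncard_setOf_subtype (fun z => z ≠ y ∧ z ≠ x) (fun z => I z l)]
        have h1 := ncard_and_ne (fun z => I z l.1) x l.2
        rw [h3] at h1
        rw [← show _ = 2 from h1]
        congr 1
        ext z
        constructor
        · rintro ⟨⟨_, h⟩, h'⟩
          exact ⟨h, h'⟩
        · rintro ⟨h, h'⟩
          refine ⟨⟨?_, h⟩, h'⟩
          rintro rfl
          exact hno l l.2 h')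
      (fun z l l' h h' => Subtype.ext (huniq x z l l' z.2.2.symm l.2 h l'.2 h'))
    have h1 : Nat.card {l // I x l} = 3 := by
      rw [← hs x]; rfl
    have h2 : Nat.card {z // z ≠ y ∧ z ≠ x} = 5 := by
      have e1 := Set.ncard_sdiff_singleton_of_mem (s := (Set.univ : Set X)) (a := y) trivial
      have e2 := Set.ncard_sdiff_singleton_of_mem (s := (Set.univ : Set X) \ {y}) (a := x)
        ⟨trivial, hxy⟩
      rw [e1, Set.ncard_univ, hX] at e2
      change Set.ncard {z | z ≠ y ∧ z ≠ x} = _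
      rw [← show _ = 5 from e2]
      congr 1
      ext z
      simp
    omega
  obtain ⟨l₁, l₂, h12⟩ : ∃ l l' : L, l ≠ l' := by
    have := Finite.one_lt_card_iff_nontrivial.1 (by omega : 1 < Nat.card L)
    exact exists_pair_ne L
  obtain ⟨p, hp⟩ := Set.ncard_eq_one.1 (hm l₁ l₂ h12)
  obtain ⟨l₃, hl₃⟩ : ∃ l, ¬ I p l := by
    by_contra hall
    push Not at hall
    have : {l | I p l} = Set.univ := Set.eq_univ_of_forall hall
    have h := hs p
    rw [this, Set.ncard_univ] at h
    omega
  let l : Fin 3 → L := ![l₁, l₂, l₃]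
  let pt : X → Fin 3 → ZMod 2 := fun x i => if I x (l i) then 0 else 1
  have pt_ne : ∀ x, pt x ≠ 0 := by
    intro x hx
    have h : ∀ i, I x (l i) := by
      intro i
      by_contra hi
      have := congrFun hx i
      simp [pt, hi] at this
    have hxp : x ∈ ({p} : Set X) := hp ▸ ⟨h 0, h 1⟩
    rw [Set.mem_singleton_iff] at hxp
    subst hxp
    exact hl₃ (h 2)
  -- On a coordinate line the coordinate vanishes at all three points of m. Otherwise m meets the
  -- coordinate line in one point q, so the values are one 0 and two 1s, and their sum is again
  -- zero.
  have pts : ∀ x y m, x ≠ y → I x m → I y m →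
      ∃ z, I z m ∧ pt z = pt x + pt y ∧ ∀ t, I t m → t = x ∨ t = y ∨ t = z := by
    intro x y m hxy hx hy
    have hx' : x ∈ {x | I x m} := hx
    obtain ⟨z, hz, hzx, hzy⟩ : ∃ z, I z m ∧ z ≠ x ∧ z ≠ y := by
      by_contra hno
      push Not at hno
      have : {x | I x m} ⊆ {x, y} := by
        intro z hz
        by_cases hzx : z = x
        · exact Or.inl hzx
        · exact Or.inr (hno z hz hzx)
      have := Set.ncard_le_ncard this
      rw [h3, Set.ncard_pair hxy] at this
      omega
    have hall : ({x, y, z} : Set X) = {x | I x m} := by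
      refine Set.eq_of_subset_of_ncard_le ?_ ?_
      · rintro t (rfl | rfl | rfl) <;> assumption
      · rw [h3, Set.ncard_eq_three.2 ⟨x, y, z, hxy, hzx.symm, hzy.symm, rfl⟩]
    refine ⟨z, hz, ?_, fun t ht => ?_⟩
    · ext i
      by_cases hmi : m = l i
      · subst hmi
        simp [pt, hx, hy, hz]
      · obtain ⟨q, hq⟩ := Set.ncard_eq_one.1 (hm m (l i) hmi)
        have hq' : ∀ t, I t m → (I t (l i) ↔ t = q) := fun t ht =>
          ⟨fun h => (hq ▸ ⟨ht, h⟩ : t ∈ ({q} : Set X)), fun h => by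
            have : t ∈ {x | I x m ∧ I x (l i)} := by rw [hq]; exact h
            exact this.2⟩
        have hqm : q ∈ ({x, y, z} : Set X) := by
          have : q ∈ {x | I x m ∧ I x (l i)} := by rw [hq]; rfl
          rw [hall]
          exact this.1
        simp only [pt, hq' _ hx, hq' _ hy, hq' _ hz, Pi.add_apply]
        rcases hqm with rfl | rfl | rfl
        · simp [hzx, hxy.symm]
        · simp [hzy, hxy]
        · simp [hzx.symm, hzy.symm]
          decide
    · have : t ∈ ({x, y, z} : Set X) := hall ▸ ht
      simpa using this
  have pt_inj : Function.Injective pt := by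
    intro x y hxy
    by_contra hne
    obtain ⟨m, hx, hy⟩ := hline x y hne
    obtain ⟨z, -, hz, -⟩ := pts x y m hne hx hy
    apply pt_ne z
    rw [hz, hxy]
    ext i
    exact CharTwo.add_self_eq_zero _
  have hln : ∀ m, ∃ w : Fin 3 → ZMod 2, w ≠ 0 ∧ ∀ x, I x m ↔ pt x ⬝ᵥ w = 0 := by
    intro m
    obtain ⟨x, y, z, hxy, -, -, hh⟩ := Set.ncard_eq_three.1 (h3 m)
    have hx : I x m := by
      have : x ∈ {x | I x m} := by rw [hh]; simp
      exact this
    have hy : I y m := by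
      have : y ∈ {x | I x m} := by rw [hh]; simp
      exact this
    obtain ⟨z, hz, hsum, hall⟩ := pts x y m hxy hx hy
    obtain ⟨w, hw, hw'⟩ := exists_normal_vector (pt x) (pt y) (pt_ne x) (pt_ne y)
      (fun h => hxy (pt_inj h))
    refine ⟨w, hw, fun t => ?_⟩
    have h1 := hw' (pt t) (pt_ne t)
    rw [← hsum] at h1
    rw [dotProduct, Fin.sum_univ_three, h1, pt_inj.eq_iff, pt_inj.eq_iff, pt_inj.eq_iff]
    refine ⟨hall t, ?_⟩
    rintro (rfl | rfl | rfl) <;> assumption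
  choose ln ln_ne inc using hln
  have ln_inj : Function.Injective ln := by
    intro m m' h
    by_contra hne
    have h1 := hm m m' hne
    have h2 : {x | I x m ∧ I x m'} = {x | I x m} := by
      ext x
      simp only [Set.mem_ofPred_eq, inc, h, and_self]
    rw [h2, h3] at h1
    omega
  exact ⟨{ pt, ln, pt_ne, ln_ne, pt_inj, ln_inj, inc := fun x l => inc l x
           pt_surj := surj_nonzero_of_injective hX pt pt_ne pt_inj
           ln_surj := surj_nonzero_of_injective hL ln ln_ne ln_inj }⟩

namespace FanoCoords

variable {X L : Type*} {I : X → L → Prop}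

/-- Over the two-element field a functional is determined by its zeros, since its only other value
is 1. -/
theorem eq_of_orthogonal (C : FanoCoords I) {w w' : Fin 3 → ZMod 2}
    (h : ∀ x, C.pt x ⬝ᵥ w = 0 ↔ C.pt x ⬝ᵥ w' = 0) : w = w' := by
  apply dotProduct_eq
  intro v
  by_cases hv : v = 0
  · simp [hv]
  obtain ⟨x, rfl⟩ := C.pt_surj v hv
  rw [dotProduct_comm, dotProduct_comm w']
  by_cases h0 : C.pt x ⬝ᵥ w = 0
  · rw [h0, (h x).1 h0]
  · rw [zmod_two_eq_one_of_ne_zero _ h0, zmod_two_eq_one_of_ne_zero _ (fun h1 => h0 ((h x).2 h1))]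

theorem matrix_ext (C : FanoCoords I) {A B : Matrix (Fin 3) (Fin 3) (ZMod 2)}
    (h : ∀ x, A *ᵥ C.pt x = B *ᵥ C.pt x) : A = B := by
  apply ext_of_mulVec_single
  intro i
  obtain ⟨x, hx⟩ := C.pt_surj (Pi.single i 1) (by simp)
  rw [← hx, h]

theorem line_ext (C : FanoCoords I) {l l' : L} (h : ∀ x, I x l ↔ I x l') : l = l' :=
  C.ln_inj (C.eq_of_orthogonal fun x => by rw [← C.inc, ← C.inc, h])

/-- Complete the two normals to a basis by w. A nonzero vector orthogonal to both normals must pair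
with w to 1, so its three pairings are prescribed. -/
theorem point_ext (C : FanoCoords I) {x x' : X} {l l' : L} (hl : l ≠ l') (h1 : I x l) (h2 : I x l') (h3 : I x' l)
    (h4 : I x' l') : x = x' := by
  obtain ⟨w, hw⟩ := exists_frame_of_ne (C.ln l) (C.ln l') (C.ln_ne l) (C.ln_ne l')
    (fun h => hl (C.ln_inj h))
  have hdet : (Matrix.of ![C.ln l, C.ln l', w]).det = 1 := by
    rw [det_fin_three, ← hw]
    simp
  rw [C.inc, dotProduct_comm] at h1 h2 h3 h4
  have hone : ∀ y, C.ln l ⬝ᵥ C.pt y = 0 → C.ln l' ⬝ᵥ C.pt y = 0 → w ⬝ᵥ C.pt y = 1 := by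
    intro y hy hy'
    apply zmod_two_eq_one_of_ne_zero
    intro hy''
    apply C.pt_ne y
    refine eq_of_frame hdet fun i => ?_
    fin_cases i <;> simp [hy, hy', hy'']
  apply C.pt_inj
  refine eq_of_frame hdet fun i => ?_
  fin_cases i
  · simp [h1, h3]
  · simp [h2, h4]
  · simp [hone _ h1 h2, hone _ h3 h4]

variable {H : Type*} [Group H] [MulAction H X]

/-- The matrix `M` describes the action of some element of `H` on the points. -/
def Realizes (C : FanoCoords I) (H : Type*) [Group H] [MulAction H X]
    (M : Matrix (Fin 3) (Fin 3) (ZMod 2)) : Prop :=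
  ∃ h : H, ∀ x, C.pt (h • x) = M *ᵥ C.pt x

theorem Realizes.one (C : FanoCoords I) : C.Realizes H 1 := ⟨1, fun x => by simp⟩

theorem Realizes.mul {C : FanoCoords I} {A B : Matrix (Fin 3) (Fin 3) (ZMod 2)}
    (hA : C.Realizes H A) (hB : C.Realizes H B) : C.Realizes H (A * B) := by
  obtain ⟨g, hg⟩ := hA
  obtain ⟨h, hh⟩ := hB
  exact ⟨g * h, fun x => by rw [mul_smul, hg, hh, mulVec_mulVec]⟩

variable [MulAction H L]

theorem inv_smul_inc (hI : ∀ (h : H) x l, I (h • x) (h • l) ↔ I x l) (h : H) (x : X) (l : L) :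
    I (h⁻¹ • x) l ↔ I x (h • l) := by
  rw [← hI h, smul_inv_smul]

/-- A permutation of the points that maps lines to lines is linear. -/
theorem exists_matrix (C : FanoCoords I) (hI : ∀ (h : H) x l, I (h • x) (h • l) ↔ I x l) (h : H) :
    ∃ M : Matrix (Fin 3) (Fin 3) (ZMod 2), M.det = 1 ∧ ∀ x, C.pt (h • x) = M *ᵥ C.pt x := by
  classical
  have : Nonempty X := ⟨(C.pt_surj (Pi.single 0 1) (by simp)).choose⟩
  choose! g hg using C.pt_surj
  have hgx : ∀ x, g (C.pt x) = x := fun x => C.pt_inj (hg _ (C.pt_ne x))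
  -- The permutation of nonzero vectors, extended by 0 ↦ 0. Additivity says that the third point of
  -- a line goes to the third point of the image line; additive maps are linear over the prime
  -- field.
  let φ : (Fin 3 → ZMod 2) → Fin 3 → ZMod 2 := fun v => if v = 0 then 0 else C.pt (h • g v)
  have hφ0 : φ 0 = 0 := if_pos rfl
  have hφ : ∀ x, φ (C.pt x) = C.pt (h • x) := fun x => by simp [φ, C.pt_ne, hgx]
  have hself : ∀ v : Fin 3 → ZMod 2, v + v = 0 := fun v => by
    ext i; exact CharTwo.add_self_eq_zero _
  have hadd : ∀ u v, φ (u + v) = φ u + φ v := by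
    intro u v
    by_cases hu : u = 0
    · simp [hu, hφ0]
    by_cases hv : v = 0
    · simp [hv, hφ0]
    by_cases huv : u = v
    · rw [huv, hself, hself, hφ0]
    have hs : u + v ≠ 0 := fun h0 => huv (by
      have := congrArg (· + v) h0
      simpa [add_assoc, hself] using this)
    obtain ⟨x, rfl⟩ := C.pt_surj u hu
    obtain ⟨y, rfl⟩ := C.pt_surj v hv
    obtain ⟨z, hz⟩ := C.pt_surj _ hs
    obtain ⟨w, hw, hw'⟩ := exists_normal_vector _ _ hu hv huv
    obtain ⟨l, rfl⟩ := C.ln_surj w hw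
    have hl : ∀ t, I t l ↔ C.pt t = C.pt x ∨ C.pt t = C.pt y ∨ C.pt t = C.pt x + C.pt y :=
      fun t => by rw [C.inc, dotProduct, Fin.sum_univ_three, hw' _ (C.pt_ne t)]
    have hx := (hI h x l).2 ((hl x).2 (Or.inl rfl))
    have hy := (hI h y l).2 ((hl y).2 (Or.inr (Or.inl rfl)))
    rw [C.inc] at hx hy
    have hxy : C.pt (h • x) ≠ C.pt (h • y) := fun e => huv (by
      rw [smul_left_cancel h (C.pt_inj e)])
    have hs' : C.pt (h • x) + C.pt (h • y) ≠ 0 := fun h0 => hxy (by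
      have := congrArg (· + C.pt (h • y)) h0
      simpa [add_assoc, hself] using this)
    -- s is the third point on the image line, so its preimage is on l. It is neither x nor y, since
    -- that would make the other image have zero coordinates.
    obtain ⟨s, hs⟩ := C.pt_surj _ hs'
    have hsl : I s (h • l) := by rw [C.inc, hs, add_dotProduct, hx, hy, add_zero]
    rw [← inv_smul_inc hI, hl] at hsl
    rw [← hz, hφ, hφ, hφ, ← hs]
    rcases hsl with e | e | e
    · have := C.pt_inj e
      rw [inv_smul_eq_iff] at this
      rw [this] at hs
      exact absurd (by simpa using hs.symm) (C.pt_ne (h • y))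
    · have := C.pt_inj e
      rw [inv_smul_eq_iff] at this
      rw [this] at hs
      exact absurd (by simpa using hs.symm) (C.pt_ne (h • x))
    · rw [← hz] at e
      have := C.pt_inj e
      rw [inv_smul_eq_iff] at this
      rw [this]
  let f : (Fin 3 → ZMod 2) →ₗ[ZMod 2] Fin 3 → ZMod 2 :=
    AddMonoidHom.toZModLinearMap 2 { toFun := φ, map_zero' := hφ0, map_add' := hadd }
  have hM : ∀ v, LinearMap.toMatrix' f *ᵥ v = φ v := fun v => LinearMap.toMatrix'_mulVec f v
  refine ⟨LinearMap.toMatrix' f, ?_, fun x => by rw [hM, hφ]⟩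
  apply zmod_two_eq_one_of_ne_zero
  intro hdet
  obtain ⟨v, hv, h0⟩ := exists_mulVec_eq_zero_iff.2 hdet
  obtain ⟨x, rfl⟩ := C.pt_surj v hv
  rw [hM, hφ] at h0
  exact C.pt_ne _ h0

/-- Normals transform contragrediently to points: the transpose pulls the normal of the image line
back to that of the original. -/
theorem transpose_mulVec_ln (C : FanoCoords I) (hI : ∀ (h : H) x l, I (h • x) (h • l) ↔ I x l) {h : H}
    {M : Matrix (Fin 3) (Fin 3) (ZMod 2)} (hM : ∀ x, C.pt (h • x) = M *ᵥ C.pt x) (l : L) :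
    Mᵀ *ᵥ C.ln (h • l) = C.ln l := by
  apply C.eq_of_orthogonal
  intro x
  rw [dotProduct_mulVec, vecMul_transpose, ← hM, ← C.inc, ← C.inc, hI]

theorem smul_line_eq_of_smul_point_eq (C : FanoCoords I) (hI : ∀ (h : H) x l, I (h • x) (h • l) ↔ I x l) {h : H}
    (hx : ∀ x : X, h • x = x) (l : L) : h • l = l :=
  C.line_ext fun x => by rw [← hI h x l, hx]





theorem mulVec_injective_of_det_eq_one {M : Matrix (Fin 3) (Fin 3) (ZMod 2)} (hM : M.det = 1) :
    Function.Injective M.mulVec := by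
  apply mulVec_injective_of_isUnit
  rw [isUnit_iff_isUnit_det, hM]
  exact isUnit_one

theorem det_frame_eq_one {u v w : Fin 3 → ZMod 2}
    (hw : u 0 * v 1 * w 2 - u 0 * v 2 * w 1 - u 1 * v 0 * w 2 + u 1 * v 2 * w 0 + u 2 * v 0 * w 1 -
        u 2 * v 1 * w 0 = 1) : (Matrix.of ![u, v, w]).det = 1 := by
  rw [det_fin_three, ← hw]
  simp

theorem lines_twoTransitive (C : FanoCoords I) (hI : ∀ (h : H) x l, I (h • x) (h • l) ↔ I x l)
    (hall : ∀ M : Matrix (Fin 3) (Fin 3) (ZMod 2), M.det = 1 → C.Realizes H M) :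
    MulAction.IsMultiplyPretransitive H L 2 := by
  rw [MulAction.is_two_pretransitive_iff]
  intro a b c d hab hcd
  obtain ⟨w, hw⟩ := exists_frame_of_ne _ _ (C.ln_ne a) (C.ln_ne b) (fun h => hab (C.ln_inj h))
  obtain ⟨w', hw'⟩ := exists_frame_of_ne _ _ (C.ln_ne c) (C.ln_ne d) (fun h => hcd (C.ln_inj h))
  -- A goes from the target frame to the source frame because transposes act on normals backwards.
  obtain ⟨A, hA, hAu⟩ := exists_mulVec_frame_eq _ _ (det_frame_eq_one hw') (det_frame_eq_one hw)
  obtain ⟨h, hh⟩ := hall Aᵀ (by rw [det_transpose, hA])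
  have key := C.transpose_mulVec_ln hI hh
  rw [transpose_transpose] at key
  exact ⟨h, C.ln_inj (mulVec_injective_of_det_eq_one hA ((key a).trans (hAu 0).symm)),
    C.ln_inj (mulVec_injective_of_det_eq_one hA ((key b).trans (hAu 1).symm))⟩

/-- The stabilizer of a line is 2-transitive on the points off the line. -/
theorem exists_smul_points_off_line (C : FanoCoords I)
    (hI : ∀ (h : H) x l, I (h • x) (h • l) ↔ I x l)
    (hall : ∀ M : Matrix (Fin 3) (Fin 3) (ZMod 2), M.det = 1 → C.Realizes H M)
    {l : L} {a b c d : X} (hab : a ≠ b) (hcd : c ≠ d) (ha : ¬ I a l) (hb : ¬ I b l)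
    (hc : ¬ I c l) (hd : ¬ I d l) : ∃ h : H, h • l = l ∧ h • a = c ∧ h • b = d := by
  have hone : ∀ x, ¬ I x l → C.pt x ⬝ᵥ C.ln l = 1 := fun x hx =>
    zmod_two_eq_one_of_ne_zero _ (fun h => hx ((C.inc x l).2 h))
  have hone' : ∀ x, ¬ I x l → C.ln l 0 * C.pt x 0 + C.ln l 1 * C.pt x 1 + C.ln l 2 * C.pt x 2 = 1 :=
    fun x hx => by
      rw [← hone x hx, dotProduct_comm, dotProduct, Fin.sum_univ_three]
  -- Both frames consist of vectors off l, where the normal of l takes the value 1; a matrix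
  -- carrying one frame to the other therefore preserves that normal.
  obtain ⟨w, hwl, hw⟩ := exists_affine_frame_of_ne _ _ _ (hone' a ha) (hone' b hb)
    (fun h => hab (C.pt_inj h))
  obtain ⟨w', hwl', hw'⟩ := exists_affine_frame_of_ne _ _ _ (hone' c hc) (hone' d hd)
    (fun h => hcd (C.pt_inj h))
  obtain ⟨M, hM, hMu⟩ := exists_mulVec_frame_eq _ _ (det_frame_eq_one hw) (det_frame_eq_one hw')
  obtain ⟨h, hh⟩ := hall M hM
  refine ⟨h, ?_, C.pt_inj ((hh a).trans (hMu 0)), C.pt_inj ((hh b).trans (hMu 1))⟩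
  have key := C.transpose_mulVec_ln hI hh l
  have hw1 : w ⬝ᵥ C.ln l = 1 := by
    rw [← hwl, dotProduct_comm, dotProduct, Fin.sum_univ_three]
  have hw1' : w' ⬝ᵥ C.ln l = 1 := by
    rw [← hwl', dotProduct_comm, dotProduct, Fin.sum_univ_three]
  have hfix : Mᵀ *ᵥ C.ln l = C.ln l := by
    refine eq_of_frame (det_frame_eq_one hw) fun i => ?_
    rw [dotProduct_mulVec, vecMul_transpose, hMu]
    fin_cases i
    · simp [hone _ ha, hone _ hc]
    · simp [hone _ hb, hone _ hd]
    · simp [hw1, hw1']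
  exact C.ln_inj (mulVec_injective_of_det_eq_one (by rw [det_transpose, hM]) (key.trans hfix.symm))

/-- The stabilizer of a point is 2-transitive on the lines that avoid the point. -/
theorem exists_smul_lines_off_point (C : FanoCoords I)
    (hI : ∀ (h : H) x l, I (h • x) (h • l) ↔ I x l)
    (hall : ∀ M : Matrix (Fin 3) (Fin 3) (ZMod 2), M.det = 1 → C.Realizes H M)
    {x : X} {a b c d : L} (hab : a ≠ b) (hcd : c ≠ d) (ha : ¬ I x a) (hb : ¬ I x b)
    (hc : ¬ I x c) (hd : ¬ I x d) : ∃ h : H, h • x = x ∧ h • a = c ∧ h • b = d := by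
  have hone : ∀ l, ¬ I x l → C.ln l ⬝ᵥ C.pt x = 1 := fun l hx =>
    zmod_two_eq_one_of_ne_zero _ (fun h => hx ((C.inc x l).2 (by rw [dotProduct_comm, h])))
  have hone' : ∀ l, ¬ I x l → C.pt x 0 * C.ln l 0 + C.pt x 1 * C.ln l 1 + C.pt x 2 * C.ln l 2 = 1 :=
    fun l hx => by
      rw [← hone l hx, dotProduct_comm, dotProduct, Fin.sum_univ_three]
  obtain ⟨w, hwl, hw⟩ := exists_affine_frame_of_ne _ _ _ (hone' a ha) (hone' b hb)
    (fun h => hab (C.ln_inj h))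
  obtain ⟨w', hwl', hw'⟩ := exists_affine_frame_of_ne _ _ _ (hone' c hc) (hone' d hd)
    (fun h => hcd (C.ln_inj h))
  obtain ⟨A, hA, hAu⟩ := exists_mulVec_frame_eq _ _ (det_frame_eq_one hw') (det_frame_eq_one hw)
  obtain ⟨h, hh⟩ := hall Aᵀ (by rw [det_transpose, hA])
  have key := C.transpose_mulVec_ln hI hh
  rw [transpose_transpose] at key
  refine ⟨h, C.pt_inj ?_, C.ln_inj (mulVec_injective_of_det_eq_one hA ((key a).trans (hAu 0).symm)),
    C.ln_inj (mulVec_injective_of_det_eq_one hA ((key b).trans (hAu 1).symm))⟩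
  have hw1 : w ⬝ᵥ C.pt x = 1 := by
    rw [← hwl, dotProduct_comm, dotProduct, Fin.sum_univ_three]
  have hw1' : w' ⬝ᵥ C.pt x = 1 := by
    rw [← hwl', dotProduct_comm, dotProduct, Fin.sum_univ_three]
  rw [hh]
  refine eq_of_frame (det_frame_eq_one hw') fun i => ?_
  rw [dotProduct_mulVec, vecMul_transpose, hAu]
  fin_cases i
  · simp [hone _ ha, hone _ hc]
  · simp [hone _ hb, hone _ hd]
  · simp [hw1, hw1']

theorem exists_second_orthogonal : ∀ p f : Fin 3 → ZMod 2,
    ∃ w : Fin 3 → ZMod 2, w ≠ 0 ∧ w ≠ f ∧ p 0 * w 0 + p 1 * w 1 + p 2 * w 2 = 0 := by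
  decide +kernel

/-- An element that interchanges two lines has a power that acts as an involution on points. -/
theorem exists_involution (C : FanoCoords I) [Finite X]
    (hI : ∀ (h : H) x l, I (h • x) (h • l) ↔ I x l) {l m : L} (hlm : l ≠ m) {h : H}
    (h1 : h • l = m) (h2 : h • m = l) :
    ∃ t : H, (∀ x : X, t • t • x = x) ∧ ∃ x : X, t • x ≠ x := by
  have hpow : ∀ j, h ^ (2 * j) • l = l := by
    intro j
    induction j with
    | zero => simp
    | succ j ih => rw [mul_add, mul_one, pow_add, mul_smul, pow_two, mul_smul, h1, h2, ih]
  set σ : Equiv.Perm X := MulAction.toPermHom H X h with hσ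
  have hσpow : ∀ n (x : X), (σ ^ n) x = h ^ n • x := by
    intro n x
    rw [hσ, ← map_pow]
    rfl
  have hpos : 0 < orderOf σ := orderOf_pos σ
  -- An odd power of h still interchanges l and m, so it cannot be trivial on points. Hence the
  -- order is even, and half of it gives the involution.
  obtain ⟨j, hj⟩ : ∃ j, orderOf σ = 2 * j := by
    rcases Nat.even_or_odd' (orderOf σ) with ⟨j, hj | hj⟩
    · exact ⟨j, hj⟩
    · exfalso
      have hfix : ∀ x : X, h ^ orderOf σ • x = x := fun x => by
        rw [← hσpow, pow_orderOf_eq_one]; rfl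
      have := C.smul_line_eq_of_smul_point_eq hI hfix m
      rw [hj, pow_succ, mul_smul, h2, hpow] at this
      exact hlm this
  refine ⟨h ^ j, fun x => ?_, ?_⟩
  · rw [smul_smul, ← pow_add, ← two_mul, ← hj, ← hσpow, pow_orderOf_eq_one]; rfl
  · by_contra hno
    push Not at hno
    have : σ ^ j = 1 := Equiv.ext fun x => by rw [hσpow, hno]; rfl
    have := orderOf_le_of_pow_eq_one (by omega) this
    omega

/-- A point on a line is the intersection of that line with a second one, so 2-transitivity on lines
moves flags to flags. -/
theorem exists_smul_flag (C : FanoCoords I)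
    (hI : ∀ (h : H) x l, I (h • x) (h • l) ↔ I x l)
    (h2 : MulAction.IsMultiplyPretransitive H L 2) {x y : X} {l m : L} (hx : I x l) (hy : I y m) :
    ∃ h : H, h • x = y ∧ h • l = m := by
  rw [MulAction.is_two_pretransitive_iff] at h2
  have second : ∀ x l, ∃ l', l ≠ l' ∧ I x l' := by
    intro x l
    obtain ⟨w, hw0, hwl, hw⟩ := exists_second_orthogonal (C.pt x) (C.ln l)
    obtain ⟨l', rfl⟩ := C.ln_surj w hw0
    refine ⟨l', ?_, ?_⟩
    · rintro rfl
      exact hwl rfl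
    · rw [C.inc, dotProduct, Fin.sum_univ_three, hw]
  obtain ⟨l', hl, hx'⟩ := second x l
  obtain ⟨m', hm, hy'⟩ := second y m
  obtain ⟨h, rfl, rfl⟩ := h2 hl hm
  exact ⟨h, C.point_ext hm ((hI _ _ _).2 hx) ((hI _ _ _).2 hx') hy hy', rfl⟩

/-- A group of collineations of the Fano plane that is 2-transitive on lines contains all
collineations. -/
theorem realizes_of_twoTransitive (C : FanoCoords I) [Finite X]
    (hI : ∀ (h : H) x l, I (h • x) (h • l) ↔ I x l)
    (h2 : MulAction.IsMultiplyPretransitive H L 2) (M : Matrix (Fin 3) (Fin 3) (ZMod 2))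
    (hM : M.det = 1) : C.Realizes H M := by
  obtain ⟨l₁, hl₁⟩ := C.ln_surj (Pi.single 0 1) (by simp)
  obtain ⟨l₂, hl₂⟩ := C.ln_surj (Pi.single 1 1) (by simp)
  have hne : l₁ ≠ l₂ := by
    rintro rfl
    have := congrFun (hl₁.symm.trans hl₂) 0
    simp at this
  obtain ⟨s, hs1, hs2⟩ := MulAction.is_two_pretransitive_iff.1 h2 hne hne.symm
  obtain ⟨t, htt, x₀, hx₀⟩ := C.exists_involution hI hne hs1 hs2
  obtain ⟨T, -, hT⟩ := C.exists_matrix hI t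
  have hTT : T * T = 1 := C.matrix_ext fun x => by
    rw [← mulVec_mulVec, ← hT, ← hT, htt, one_mulVec]
  have hchar : ∀ A : Matrix (Fin 3) (Fin 3) (ZMod 2), A + A = 0 := fun A => by
    ext i j; exact CharTwo.add_self_eq_zero _
  -- In characteristic 2 an involution T has (1 + T)² = 1 + T² = 0, so 1 + T is of rank at most one
  -- and T is v ↦ v + f(v)c.
  have hNN : (1 + T) * (1 + T) = 0 := by
    rw [mul_add, add_mul, add_mul, hTT, mul_one, one_mul, mul_one, add_comm T 1, hchar]
  obtain ⟨c, f, hcf⟩ := eq_vecMulVec_of_mul_self_eq_zero hNN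
  have hTcf : T = 1 + vecMulVec c f := by
    rw [← hcf, ← add_assoc, hchar, zero_add]
  have hTv : ∀ v, T *ᵥ v = v + (f ⬝ᵥ v) • c := fun v => by
    rw [hTcf, add_mulVec, one_mulVec, vecMulVec_mulVec, op_smul_eq_smul]
  have hc : c ≠ 0 := by
    rintro rfl
    apply hx₀
    apply C.pt_inj
    rw [hT, hTv, smul_zero, add_zero]
  have hf : f ≠ 0 := by
    rintro rfl
    apply hx₀
    apply C.pt_inj
    rw [hT, hTv, zero_dotProduct, zero_smul, add_zero]
  obtain ⟨x, hx⟩ := C.pt_surj c hc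
  obtain ⟨l, hl⟩ := C.ln_surj f hf
  -- The centre lies on the axis: T² sends x₀ to x₀ + f(c)c, which has to be x₀ again.
  have hxl : I x l := by
    rw [C.inc, hx, hl, dotProduct_comm]
    have h0 : T *ᵥ T *ᵥ C.pt x₀ = C.pt x₀ := by rw [mulVec_mulVec, hTT, one_mulVec]
    have hfx : f ⬝ᵥ C.pt x₀ = 1 := by
      apply zmod_two_eq_one_of_ne_zero
      intro h
      apply hx₀
      apply C.pt_inj
      rw [hT, hTv, h, zero_smul, add_zero]
    rw [hTv, hTv, hfx, one_smul, dotProduct_add, hfx, add_smul, one_smul, add_assoc, ← add_assoc c]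
      at h0
    by_contra hfc
    rw [zmod_two_eq_one_of_ne_zero _ hfc, one_smul] at h0
    have hcc : c + c = 0 := by ext i; exact CharTwo.add_self_eq_zero _
    rw [hcc, zero_add] at h0
    exact hc (by simpa using h0)
  -- Conjugation moves the flag (centre, axis), so flag transitivity yields every transvection.
  have htrans : ∀ (y : X) (m : L), I y m → C.Realizes H (1 + vecMulVec (C.pt y) (C.ln m)) := by
    intro y m hym
    obtain ⟨h, rfl, rfl⟩ := C.exists_smul_flag hI h2 hxl hym
    obtain ⟨A, -, hA⟩ := C.exists_matrix hI h
    refine ⟨h * t * h⁻¹, fun z => ?_⟩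
    obtain ⟨z, rfl⟩ : ∃ w, z = h • w := ⟨h⁻¹ • z, by simp⟩
    have h1 : C.ln (h • l) ⬝ᵥ C.pt (h • z) = f ⬝ᵥ C.pt z := by
      rw [hA, ← hl, ← C.transpose_mulVec_ln hI hA l, dotProduct_mulVec, mulVec_transpose]
    rw [add_mulVec, one_mulVec, vecMulVec_mulVec, op_smul_eq_smul, h1, mul_smul, mul_smul,
      inv_smul_smul, hA, hT, hTv, mulVec_add, mulVec_smul, ← hA, ← hx, ← hA]
  -- Invertible diagonal matrices over the two-element field are trivial, so elementary
  -- transvections generate everything.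
  refine diagonal_transvection_induction_of_det_ne_zero (C.Realizes H) M (by rw [hM]; decide)
    ?_ ?_ (fun A B _ _ hA hB => hA.mul hB)
  · intro D hD
    rw [det_diagonal] at hD
    have : D = 1 := funext fun i => zmod_two_eq_one_of_ne_zero _
      (Finset.prod_ne_zero_iff.1 hD i (Finset.mem_univ i))
    subst this
    rw [show (1 : Fin 3 → ZMod 2) = fun _ => 1 from rfl, diagonal_one]
    exact Realizes.one C
  · rintro ⟨i, j, hij, a⟩
    rw [TransvectionStruct.toMatrix_mk, transvection]
    by_cases ha : a = 0
    · rw [ha, single_zero, add_zero]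
      exact Realizes.one C
    · obtain ⟨y, hy⟩ := C.pt_surj (Pi.single i 1) (by simp)
      obtain ⟨m, hm⟩ := C.ln_surj (Pi.single j 1) (by simp)
      have := htrans y m (by rw [C.inc, hy, hm]; simp [hij])
      rw [hy, hm, ← single_eq_single_vecMulVec_single] at this
      rwa [zmod_two_eq_one_of_ne_zero _ ha]


/-- The action of `SL(3, 2)` on the points. -/
noncomputable def slPerm (C : FanoCoords I) :
    SpecialLinearGroup (Fin 3) (ZMod 2) →* Equiv.Perm X :=
  have key : ∀ (M : SpecialLinearGroup (Fin 3) (ZMod 2)) (x : X),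
      ∃ y, C.pt y = (M : Matrix (Fin 3) (Fin 3) (ZMod 2)) *ᵥ C.pt x := fun M x =>
    C.pt_surj _ fun h => C.pt_ne x
      (mulVec_injective_of_det_eq_one M.2 (h.trans (mulVec_zero _).symm))
  MonoidHom.toHomPerm
    { toFun := fun M x => (key M x).choose
      map_one' := funext fun x => C.pt_inj (by
        rw [(key 1 x).choose_spec]
        exact one_mulVec _)
      map_mul' := fun A B => funext fun x => C.pt_inj (by
        rw [(key (A * B) x).choose_spec]
        change _ = C.pt (key A (key B x).choose).choose
        rw [(key A _).choose_spec, (key B x).choose_spec, mulVec_mulVec]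
        rfl) }

theorem pt_slPerm (C : FanoCoords I) (M : SpecialLinearGroup (Fin 3) (ZMod 2)) (x : X) :
    C.pt (C.slPerm M x) = (M : Matrix (Fin 3) (Fin 3) (ZMod 2)) *ᵥ C.pt x :=
  (C.pt_surj _ fun h => C.pt_ne x
      (mulVec_injective_of_det_eq_one M.2 (h.trans (mulVec_zero _).symm))).choose_spec

theorem slPerm_injective (C : FanoCoords I) : Function.Injective C.slPerm := by
  intro A B h
  apply Subtype.ext
  apply C.matrix_ext
  intro x
  rw [← pt_slPerm, h, pt_slPerm]

theorem inducedPerm_le_range_slPerm (C : FanoCoords I)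
    (hI : ∀ (h : H) x l, I (h • x) (h • l) ↔ I x l) : inducedPerm H X ≤ C.slPerm.range := by
  rintro _ ⟨h, rfl⟩
  obtain ⟨M, hM, hh⟩ := C.exists_matrix hI h
  exact ⟨⟨M, hM⟩, Equiv.ext fun x => C.pt_inj ((C.pt_slPerm _ x).trans (hh x).symm)⟩

theorem nonempty_sl_mulEquiv_psl : Nonempty (SpecialLinearGroup (Fin 3) (ZMod 2) ≃*
    ProjectiveSpecialLinearGroup (Fin 3) (ZMod 2)) := by
  have h : Subgroup.center (SpecialLinearGroup (Fin 3) (ZMod 2)) = ⊥ := by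
    rw [eq_bot_iff]
    intro A hA
    obtain ⟨r, hr, hrA⟩ := Matrix.SpecialLinearGroup.mem_center_iff.1 hA
    have : r = 1 := zmod_two_eq_one_of_ne_zero r (by
      rintro rfl
      revert hr
      decide)
    subst this
    rw [Subgroup.mem_bot]
    apply Subtype.ext
    rw [← hrA]
    simp
  exact ⟨(QuotientGroup.quotientBot.symm.trans (QuotientGroup.quotientMulEquivOfEq h.symm))⟩

/-- The induced group lies in the faithful image of SL(3,2), which equals PSL(3,2) as the centre is
trivial. An abstract isomorphism forces equal orders, hence equality. -/
theorem isoPSL32_inducedPerm_iff (C : FanoCoords I) [Finite X]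
    (hI : ∀ (h : H) x l, I (h • x) (h • l) ↔ I x l) :
    IsoPSL32 (inducedPerm H X) ↔
      ∀ M : Matrix (Fin 3) (Fin 3) (ZMod 2), M.det = 1 → C.Realizes H M := by
  obtain ⟨e⟩ := nonempty_sl_mulEquiv_psl
  let e' := MonoidHom.ofInjective C.slPerm_injective
  have hle := C.inducedPerm_le_range_slPerm hI
  constructor
  · rintro ⟨f⟩ M hM
    have hcard : Nat.card C.slPerm.range ≤ Nat.card (inducedPerm H X) := by
      rw [Nat.card_congr (f.trans (e.symm.trans e')).toEquiv]
    have heq := Subgroup.eq_of_le_of_card_ge hle hcard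
    have hmem : C.slPerm ⟨M, hM⟩ ∈ inducedPerm H X := heq ▸ ⟨_, rfl⟩
    obtain ⟨h, hh⟩ := hmem
    refine ⟨h, fun x => ?_⟩
    have := C.pt_slPerm ⟨M, hM⟩ x
    rw [← hh] at this
    exact this
  · intro hall
    have heq : inducedPerm H X = C.slPerm.range := by
      apply le_antisymm hle
      rintro _ ⟨M, rfl⟩
      obtain ⟨h, hh⟩ := hall M.1 M.2
      refine ⟨h, Equiv.ext fun x => C.pt_inj ?_⟩
      rw [pt_slPerm]
      exact hh x
    exact ⟨(MulEquiv.subgroupCongr heq).trans (e'.symm.trans e)⟩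

theorem smul_point_eq_of_smul_line_eq (C : FanoCoords I)
    (hI : ∀ (h : H) x l, I (h • x) (h • l) ↔ I x l) {h : H} (hl : ∀ l : L, h • l = l) (x : X) :
    h • x = x := by
  obtain ⟨M, -, hM⟩ := C.exists_matrix hI h
  apply C.pt_inj
  rw [hM]
  apply dotProduct_eq
  intro v
  by_cases hv : v = 0
  · simp [hv]
  obtain ⟨l, rfl⟩ := C.ln_surj v hv
  have := C.transpose_mulVec_ln hI hM l
  rw [hl] at this
  conv_rhs => rw [← this]
  rw [dotProduct_mulVec, vecMul_transpose]

/-- An element fixes all points exactly when it fixes all lines, so both actions have the same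
kernel. -/
theorem nonempty_inducedPerm_points_mulEquiv_lines (C : FanoCoords I)
    (hI : ∀ (h : H) x l, I (h • x) (h • l) ↔ I x l) :
    Nonempty (inducedPerm H X ≃* inducedPerm H L) := by
  have h : (MulAction.toPermHom H X).ker = (MulAction.toPermHom H L).ker := by
    ext h
    rw [MonoidHom.mem_ker, MonoidHom.mem_ker]
    constructor
    · intro h1
      exact Equiv.ext fun l => C.smul_line_eq_of_smul_point_eq hI
        (fun x => by have := congrArg (fun σ : Equiv.Perm X => σ x) h1; exact this) l
    · intro h1
      exact Equiv.ext fun x => C.smul_point_eq_of_smul_line_eq hI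
        (fun x => by have := congrArg (fun σ : Equiv.Perm L => σ x) h1; exact this) x
  exact ⟨(QuotientGroup.quotientKerEquivRange _).symm.trans
    ((QuotientGroup.quotientMulEquivOfEq h).trans (QuotientGroup.quotientKerEquivRange _))⟩

/-- The description of the plane by vectors gives the description by subspaces. -/
theorem exists_subspace_coords (C : FanoCoords I) :
    ∃ (f : X ≃ {W : Submodule (ZMod 2) (Fin 3 → ZMod 2) // Module.finrank (ZMod 2) W = 1})
      (h : L ≃ {W : Submodule (ZMod 2) (Fin 3 → ZMod 2) // Module.finrank (ZMod 2) W = 2}),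
      ∀ x l, I x l ↔ (f x).1 ≤ (h l).1 := by
  let φ : (Fin 3 → ZMod 2) → (Fin 3 → ZMod 2) →ₗ[ZMod 2] ZMod 2 := fun w =>
    { toFun := fun v => v ⬝ᵥ w
      map_add' := fun a b => add_dotProduct a b w
      map_smul' := fun a b => smul_dotProduct a b w }
  have hφ : ∀ w v, φ w v = v ⬝ᵥ w := fun _ _ => rfl
  have hker : ∀ w, w ≠ 0 → Module.finrank (ZMod 2) (LinearMap.ker (φ w)) = 2 := by
    intro w hw
    have h0 : φ w ≠ 0 := by
      intro h0
      apply hw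
      apply dotProduct_eq
      intro v
      rw [dotProduct_comm, zero_dotProduct, ← hφ, h0]
      rfl
    have := Module.Dual.finrank_ker_add_one_of_ne_zero h0
    rw [Module.finrank_fin_fun] at this
    omega
  let f : X → {W : Submodule (ZMod 2) (Fin 3 → ZMod 2) // Module.finrank (ZMod 2) W = 1} :=
    fun x => ⟨Submodule.span (ZMod 2) {C.pt x}, finrank_span_singleton (C.pt_ne x)⟩
  let h : L → {W : Submodule (ZMod 2) (Fin 3 → ZMod 2) // Module.finrank (ZMod 2) W = 2} :=
    fun l => ⟨LinearMap.ker (φ (C.ln l)), hker _ (C.ln_ne l)⟩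
  have hinc : ∀ x l, I x l ↔ (f x).1 ≤ (h l).1 := by
    intro x l
    rw [C.inc]
    simp only [f, h, Submodule.span_singleton_le_iff_mem, LinearMap.mem_ker, hφ]
  have hf : Function.Bijective f := by
    constructor
    · intro x y hxy
      have h1 : C.pt x ∈ Submodule.span (ZMod 2) {C.pt y} := by
        rw [← show Submodule.span (ZMod 2) {C.pt x} = Submodule.span (ZMod 2) {C.pt y} from
          congrArg Subtype.val hxy]
        exact Submodule.mem_span_singleton_self _
      obtain ⟨a, ha⟩ := Submodule.mem_span_singleton.1 h1
      have : a = 1 := zmod_two_eq_one_of_ne_zero a (by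
        rintro rfl
        rw [zero_smul] at ha
        exact C.pt_ne x ha.symm)
      rw [this, one_smul] at ha
      exact C.pt_inj ha.symm
    · rintro ⟨W, hW⟩
      obtain ⟨⟨v, hvW⟩, hv, hall⟩ := finrank_eq_one_iff'.1 hW
      obtain ⟨x, rfl⟩ := C.pt_surj v (fun h => hv (Subtype.ext h))
      refine ⟨x, Subtype.ext (Submodule.eq_of_le_of_finrank_eq ?_ ?_)⟩
      · simpa [f] using hvW
      · rw [hW]
        exact finrank_span_singleton (C.pt_ne x)
  have hh : Function.Bijective h := by
    constructor
    · intro l m hlm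
      apply C.line_ext
      intro x
      rw [hinc, hinc, hlm]
    · rintro ⟨W, hW⟩
      have hlt : W < ⊤ := by
        rw [lt_top_iff_ne_top]
        rintro rfl
        rw [finrank_top, Module.finrank_fin_fun] at hW
        omega
      obtain ⟨g, hg, hle⟩ := Submodule.exists_le_ker_of_lt_top W hlt
      let w : Fin 3 → ZMod 2 := fun i => g (Pi.single i 1)
      have hgw : g = φ w := by
        apply LinearMap.pi_ext'
        intro i
        apply LinearMap.ext_ring
        simp [hφ, w]
      have hw : w ≠ 0 := by
        intro h0
        apply hg
        rw [hgw, h0]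
        ext
        simp [hφ]
      obtain ⟨l, hl⟩ := C.ln_surj w hw
      refine ⟨l, Subtype.ext (Submodule.eq_of_le_of_finrank_eq ?_ ?_).symm⟩
      · rw [hgw, ← hl] at hle
        exact hle
      · rw [hW]
        exact (hker _ (C.ln_ne l)).symm
  exact ⟨Equiv.ofBijective f hf, Equiv.ofBijective h hh, hinc⟩

end FanoCoords

end Fano

/-! ### Two-arc transitivity as a local condition. -/

section GraphActions

variable {G W : Type*} [Group G] [MulAction G W]

theorem smul_adj_iff (S : SimpleGraph W) [ActsByAut G S] (g : G) {x y : W} :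
    S.Adj (g • x) (g • y) ↔ S.Adj x y :=
  ⟨fun h => by simpa using ActsByAut.smul_adj (Γ := S) g⁻¹ h, ActsByAut.smul_adj g⟩

theorem isTwoArcTransitive_iff (S : SimpleGraph W) [inst : ActsByAut G S]
    [MulAction.IsPretransitive G W] :
    IsTwoArcTransitive G S ↔
      ∀ x, MulAction.IsMultiplyPretransitive (MulAction.stabilizer G x) (S.neighborSet x) 2 := by
  constructor
  · intro h x
    rw [MulAction.is_two_pretransitive_iff]
    rintro ⟨a, ha⟩ ⟨b, hb⟩ ⟨c, hc⟩ ⟨d, hd⟩ hab hcd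
    obtain ⟨g, h1, h2, h3⟩ := h.two_arc_trans (x := a) (y := x) (z := b) (x' := c) (y' := x)
      (z' := d) ⟨SimpleGraph.Adj.symm ha, hb, fun h => hab (Subtype.ext h)⟩
      ⟨SimpleGraph.Adj.symm hc, hd, fun h => hcd (Subtype.ext h)⟩
    exact ⟨⟨g, h2⟩, Subtype.ext h1, Subtype.ext h3⟩
  · intro h
    refine ⟨inst, inferInstance, ?_⟩
    rintro a x b c y d ⟨h1, h2, h3⟩ ⟨h1', h2', h3'⟩
    obtain ⟨g, rfl⟩ := MulAction.exists_smul_eq G x y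
    have e1 : S.Adj (g • x) (g • a) := (smul_adj_iff S g).2 h1.symm
    have e2 : S.Adj (g • x) (g • b) := (smul_adj_iff S g).2 h2
    have h' := h (g • x)
    rw [MulAction.is_two_pretransitive_iff] at h'
    obtain ⟨t, ht1, ht2⟩ := @h' ⟨g • a, e1⟩ ⟨g • b, e2⟩ ⟨c, h1'.symm⟩ ⟨d, h2'⟩
      (fun h => h3 (smul_left_cancel g (congrArg Subtype.val h)))
      (fun h => h3' (congrArg Subtype.val h))
    refine ⟨t.1 * g, ?_, ?_, ?_⟩
    · rw [mul_smul]; exact congrArg Subtype.val ht1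
    · rw [mul_smul]; exact t.2
    · rw [mul_smul]; exact congrArg Subtype.val ht2

theorem isMultiplyPretransitive_two_of_equiv {H X Y : Type*} [Group H] [MulAction H X]
    [MulAction H Y] (e : X ≃ Y) (he : ∀ (h : H) x, e (h • x) = h • e x)
    (hX : MulAction.IsMultiplyPretransitive H X 2) :
    MulAction.IsMultiplyPretransitive H Y 2 := by
  rw [MulAction.is_two_pretransitive_iff] at hX ⊢
  intro a b c d hab hcd
  obtain ⟨h, h1, h2⟩ := hX (a := e.symm a) (b := e.symm b) (c := e.symm c) (d := e.symm d)
    (by simpa using hab) (by simpa using hcd)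
  refine ⟨h, ?_, ?_⟩
  · have := he h (e.symm a)
    rw [h1] at this
    simpa using this.symm
  · have := he h (e.symm b)
    rw [h2] at this
    simpa using this.symm

end GraphActions

/-! ### Arc-transitive graphs of valency two and dihedral groups. -/

section Cycles

variable {G W : Type*} [Group G] [MulAction G W]

theorem exists_cycle_coords [Finite W] (S : SimpleGraph W) [ActsByAut G S] (hS : S.Connected)
    (h2 : ∀ x, (S.neighborSet x).ncard = 2)
    (harc : ∀ {x y x' y' : W}, S.Adj x y → S.Adj x' y' → ∃ g : G, g • x = x' ∧ g • y = y') :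
    ∃ n, 3 ≤ n ∧ ∃ f : ZMod n ≃ W, ∀ a b, S.Adj (f a) (f b) ↔ b = a + 1 ∨ a = b + 1 := by
  obtain ⟨x₁⟩ := hS.nonempty
  obtain ⟨x₀, x₂, h02, hnb⟩ := Set.ncard_eq_two.1 (h2 x₁)
  have h0 : S.Adj x₁ x₀ := by
    have : x₀ ∈ S.neighborSet x₁ := by rw [hnb]; simp
    exact this
  have h2' : S.Adj x₁ x₂ := by
    have : x₂ ∈ S.neighborSet x₁ := by rw [hnb]; simp
    exact this
  -- g shifts the path x₀, x₁, x₂ one step along, so it acts as a rotation and its powers applied to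
  -- x₀ trace the whole graph.
  obtain ⟨g, hg0, hg1⟩ := harc h0.symm h2'
  have hadj : ∀ (i : ℤ) y, S.Adj (g ^ i • x₀) y ↔ y = g ^ (i - 1) • x₀ ∨ y = g ^ (i + 1) • x₀ := by
    intro i y
    have e0 : g ^ i • x₀ = g ^ (i - 1) • x₁ := by
      rw [← hg0, smul_smul, ← zpow_add_one, sub_add_cancel]
    have e2 : g ^ (i + 1) • x₀ = g ^ (i - 1) • x₂ := by
      rw [← hg1, ← hg0, smul_smul, smul_smul, ← zpow_add_one, ← zpow_add_one]
      congr 2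
      ring
    rw [e0, e2, ← smul_adj_iff S (g ^ (i - 1))⁻¹, inv_smul_smul, ← inv_smul_eq_iff,
      ← inv_smul_eq_iff]
    change (g ^ (i - 1))⁻¹ • y ∈ S.neighborSet x₁ ↔ _
    rw [hnb]
    rfl
  have hsurj : ∀ y, ∃ i : ℤ, y = g ^ i • x₀ := by
    intro y
    have hr := hS.preconnected x₀ y
    rw [SimpleGraph.reachable_iff_reflTransGen] at hr
    induction hr with
    | refl => exact ⟨0, by simp⟩
    | tail _ hbc ih =>
      obtain ⟨i, rfl⟩ := ih
      rcases (hadj i _).1 hbc with h | h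
      · exact ⟨_, h⟩
      · exact ⟨_, h⟩
  set n := Function.minimalPeriod (g • ·) x₀ with hn
  have heq : ∀ i j : ℤ, g ^ i • x₀ = g ^ j • x₀ ↔ (i : ZMod n) = (j : ZMod n) := by
    intro i j
    rw [ZMod.intCast_eq_intCast_iff_dvd_sub, hn, ← MulAction.zpow_smul_eq_iff_minimalPeriod_dvd,
      sub_eq_neg_add, zpow_add, mul_smul, zpow_neg, inv_smul_eq_iff, eq_comm]
  let F : ZMod n → W := fun a => g ^ (a.cast : ℤ) • x₀
  have hF : ∀ i : ℤ, F i = g ^ i • x₀ := fun i => (heq _ _).2 (by simp)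
  have hlift : ∀ a : ZMod n, ∃ i : ℤ, a = i := fun a => ⟨a.cast, by simp⟩
  have hbij : Function.Bijective F := by
    constructor
    · intro a b hab
      obtain ⟨i, rfl⟩ := hlift a
      obtain ⟨j, rfl⟩ := hlift b
      rw [hF, hF] at hab
      exact (heq i j).1 hab
    · intro y
      obtain ⟨i, rfl⟩ := hsurj y
      exact ⟨i, hF i⟩
  have hn3 : 3 ≤ n := by
    by_contra hlt
    have hd1 : x₀ ≠ g • x₀ := by rw [hg0]; exact h0.ne'
    have hd2 : x₀ ≠ g • g • x₀ := by rw [hg0, hg1]; exact h02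
    -- Minimal period 0 means an infinite orbit, with `ZMod 0` being the integers; finiteness of the
    -- graph excludes it.
    have hn0 : n ≠ 0 := by
      intro hn0
      have : Finite (ZMod n) := Finite.of_injective F hbij.1
      rw [hn0] at this
      exact Infinite.not_finite (α := ℤ) this
    have e1 := heq 0 1
    have e2 := heq 0 2
    rw [zpow_zero, one_smul, zpow_one] at e1
    rw [zpow_zero, one_smul, zpow_two, mul_smul] at e2
    generalize n = m at *
    rcases (by omega : m = 1 ∨ m = 2) with rfl | rfl
    · exact hd1 (e1.2 (by decide))
    · exact hd2 (e2.2 (by decide))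
  refine ⟨n, hn3, Equiv.ofBijective F hbij, fun a b => ?_⟩
  obtain ⟨i, rfl⟩ := hlift a
  obtain ⟨j, rfl⟩ := hlift b
  rw [Equiv.ofBijective_apply, Equiv.ofBijective_apply, hF, hF, hadj, heq, heq]
  push_cast
  rw [or_comm, eq_sub_iff_add_eq, eq_comm (a := (j : ZMod n) + 1)]

theorem nonempty_iso_cycleGraph (S : SimpleGraph W) {n : ℕ} (hn : 3 ≤ n) (f : ZMod n ≃ W)
    (hf : ∀ a b, S.Adj (f a) (f b) ↔ b = a + 1 ∨ a = b + 1) :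
    Nonempty (S ≃g SimpleGraph.cycleGraph n) := by
  obtain ⟨m, rfl⟩ : ∃ m, n = m + 2 := ⟨n - 2, by omega⟩
  refine ⟨RelIso.symm { toEquiv := (f : Fin (m + 2) ≃ W), map_rel_iff' := ?_ }⟩
  intro a b
  rw [SimpleGraph.cycleGraph_adj]
  refine (hf a b).trans ?_
  rw [sub_eq_iff_eq_add', sub_eq_iff_eq_add', or_comm]
  rfl

/-- The action of the dihedral group on the vertices of a cycle. -/
def dihedralPerm (n : ℕ) : DihedralGroup n →* Equiv.Perm (ZMod n) :=
  MonoidHom.toHomPerm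
    { toFun := fun d x => match d with
        | .r i => x + i
        -- The sign of j is dictated by the multiplication table of `DihedralGroup`.
        | .sr j => -j - x
      map_one' := by
        funext x
        exact add_zero x
      map_mul' := by
        rintro (i | i) (j | j) <;> funext x
        · change x + (i + j) = x + j + i
          ring
        · change -(j - i) - x = -j - x + i
          ring
        · change -(i + j) - x = -i - (x + j)
          ring
        · change x + (j - i) = -i - (-j - x)
          ring }

theorem two_ne_zero_zmod {n : ℕ} (hn : 3 ≤ n) : (2 : ZMod n) ≠ 0 := by
  intro h
  have : ((2 : ℕ) : ZMod n) = 0 := by exact_mod_cast h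
  rw [ZMod.natCast_eq_zero_iff] at this
  have := Nat.le_of_dvd (by omega) this
  omega

theorem dihedralPerm_injective {n : ℕ} (hn : 3 ≤ n) : Function.Injective (dihedralPerm n) := by
  rw [injective_iff_map_eq_one]
  rintro (i | j) h
  · have : (0 : ZMod n) + i = 0 := congrArg (fun σ : Equiv.Perm (ZMod n) => σ 0) h
    rw [zero_add] at this
    rw [this]
    rfl
  · exfalso
    have h0 : -j - (0 : ZMod n) = 0 := congrArg (fun σ : Equiv.Perm (ZMod n) => σ 0) h
    have h1 : -j - (1 : ZMod n) = 1 := congrArg (fun σ : Equiv.Perm (ZMod n) => σ 1) h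
    rw [sub_zero] at h0
    rw [h0] at h1
    apply two_ne_zero_zmod hn
    calc (2 : ZMod n) = 1 + 1 := by norm_num
      _ = 1 + (0 - 1) := by rw [h1]
      _ = 0 := by ring

/-- The first step fixes the direction ε. Turning back later would give σ (k + 2) = σ k, hence 2 = 0
in `ZMod n`, which fails for n ≥ 3. -/
theorem cycle_automorphism_eq {n : ℕ} (hn : 3 ≤ n) (σ : Equiv.Perm (ZMod n))
    (hσ : ∀ a, σ (a + 1) = σ a + 1 ∨ σ a = σ (a + 1) + 1) :
    ∃ ε : ZMod n, (ε = 1 ∨ ε = -1) ∧ ∀ a, σ a = σ 0 + ε * a := by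
  have hσ' : ∀ a, σ (a + 1) = σ a + 1 ∨ σ (a + 1) = σ a + -1 := by
    intro a
    rcases hσ a with h | h
    · exact Or.inl h
    · right
      rw [h]
      ring
  obtain ⟨ε, hε, h1⟩ : ∃ ε : ZMod n, (ε = 1 ∨ ε = -1) ∧ σ 1 = σ 0 + ε := by
    rcases hσ' 0 with h | h
    · exact ⟨1, Or.inl rfl, by simpa using h⟩
    · exact ⟨-1, Or.inr rfl, by simpa using h⟩
  have hε' : ∀ a, σ (a + 1) = σ a + ε ∨ σ (a + 1) = σ a - ε := by
    intro a
    rcases hε with rfl | rfl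
    · rcases hσ' a with h | h
      · exact Or.inl h
      · exact Or.inr (h.trans (by ring))
    · rcases hσ' a with h | h
      · exact Or.inr (h.trans (by ring))
      · exact Or.inl h
  have key : ∀ k : ℕ, σ k = σ 0 + ε * k ∧ σ (k + 1 : ℕ) = σ 0 + ε * (k + 1 : ℕ) := by
    intro k
    induction k with
    | zero => simp [h1]
    | succ k ih =>
      refine ⟨ih.2, ?_⟩
      rcases hε' ((k + 1 : ℕ) : ZMod n) with h | h
      · rw [Nat.cast_add_one (k + 1), h, ih.2]
        ring
      · exfalso
        rw [ih.2] at h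
        have : σ (((k + 1 : ℕ) : ZMod n) + 1) = σ k := by
          rw [h, ih.1]
          push_cast
          ring
        have := σ.injective this
        apply two_ne_zero_zmod hn
        push_cast at this
        calc (2 : ZMod n) = ((k : ZMod n) + 1 + 1) - k := by ring
          _ = 0 := by rw [this]; ring
  refine ⟨ε, hε, fun a => ?_⟩
  have : NeZero n := ⟨by omega⟩
  have := (key a.val).1
  simpa using this

/-- Rigidity of the cycle puts the induced group inside the dihedral one; an arc can be moved to any
arc, in either direction, so all of it is reached. -/
theorem nonempty_mulEquiv_dihedralGroup (S : SimpleGraph W) [ActsByAut G S] {n : ℕ} (hn : 3 ≤ n)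
    (f : ZMod n ≃ W) (hf : ∀ a b, S.Adj (f a) (f b) ↔ b = a + 1 ∨ a = b + 1)
    (harc : ∀ {x y x' y' : W}, S.Adj x y → S.Adj x' y' → ∃ g : G, g • x = x' ∧ g • y = y') :
    Nonempty (G ⧸ (MulAction.toPermHom G W).ker ≃* DihedralGroup n) := by
  let ψ : G →* Equiv.Perm (ZMod n) :=
    f.symm.permCongrHom.toMonoidHom.comp (MulAction.toPermHom G W)
  have hψ : ∀ g a, ψ g a = f.symm (g • f a) := fun _ _ => rfl
  have hker : (MulAction.toPermHom G W).ker = ψ.ker := by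
    ext g
    simp [ψ, MonoidHom.mem_ker]
  have hlin : ∀ g, ∃ ε : ZMod n, (ε = 1 ∨ ε = -1) ∧ ∀ a, ψ g a = ψ g 0 + ε * a := by
    intro g
    refine cycle_automorphism_eq hn _ fun a => ?_
    have h1 : S.Adj (f a) (f (a + 1)) := (hf _ _).2 (Or.inl rfl)
    rw [← smul_adj_iff S g, ← f.apply_symm_apply (g • f a), ← f.apply_symm_apply (g • f (a + 1)),
      hf] at h1
    exact h1
  have hr : ∀ i x, dihedralPerm n (.r i) x = x + i := fun _ _ => rfl
  have hsr : ∀ i x, dihedralPerm n (.sr i) x = -i - x := fun _ _ => rfl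
  have harc' : ∀ c ε : ZMod n, (ε = 1 ∨ ε = -1) → ∃ g, ∀ a, ψ g a = c + ε * a := by
    intro c ε hε
    have h0 : S.Adj (f 0) (f 1) := (hf _ _).2 (Or.inl (by ring))
    have h1 : S.Adj (f c) (f (c + ε)) := by
      rw [hf]
      rcases hε with rfl | rfl
      · exact Or.inl rfl
      · right; ring
    obtain ⟨g, e0, e1⟩ := harc h0 h1
    have e0' : ψ g 0 = c := by rw [hψ, e0, f.symm_apply_apply]
    have e1' : ψ g 1 = c + ε := by rw [hψ, e1, f.symm_apply_apply]
    obtain ⟨δ, -, hδ⟩ := hlin g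
    have := hδ 1
    rw [e1', e0', mul_one] at this
    have : ε = δ := add_left_cancel this
    exact ⟨g, fun a => by rw [hδ, e0', this]⟩
  have hrange : ψ.range = (dihedralPerm n).range := by
    apply le_antisymm
    · rintro _ ⟨g, rfl⟩
      obtain ⟨ε, rfl | rfl, h⟩ := hlin g
      · refine ⟨.r (ψ g 0), Equiv.ext fun a => ?_⟩
        rw [hr, h a]
        ring
      · refine ⟨.sr (-ψ g 0), Equiv.ext fun a => ?_⟩
        rw [hsr, h a]
        ring
    · rintro _ ⟨i | i, rfl⟩
      · obtain ⟨g, hg⟩ := harc' i 1 (Or.inl rfl)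
        refine ⟨g, Equiv.ext fun a => ?_⟩
        rw [hg, hr]
        ring
      · obtain ⟨g, hg⟩ := harc' (-i) (-1) (Or.inr rfl)
        refine ⟨g, Equiv.ext fun a => ?_⟩
        rw [hg, hsr]
        ring
  exact ⟨(QuotientGroup.quotientMulEquivOfEq hker).trans
    ((QuotientGroup.quotientKerEquivRange ψ).trans ((MulEquiv.subgroupCongr hrange).trans
      (MonoidHom.ofInjective (dihedralPerm_injective hn)).symm))⟩

end Cycles

/-! ### Blocks, the incidence structure at a block, and the admissible parameters. -/

namespace SymQuot

variable {G V : Type*} [Group G] [MulAction G V] {Γ : SimpleGraph V} {P : InvPartition G V}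

theorem InvPartition.exists_blockOf_eq (P : InvPartition G V) (B : P.Block) :
    ∃ x, P.blockOf x = B := Quotient.exists_rep B

theorem InvPartition.isPretransitive_block (P : InvPartition G V)
    [MulAction.IsPretransitive G V] : MulAction.IsPretransitive G P.Block := by
  refine ⟨fun B C => ?_⟩
  obtain ⟨x, rfl⟩ := P.exists_blockOf_eq B
  obtain ⟨y, rfl⟩ := P.exists_blockOf_eq C
  obtain ⟨g, rfl⟩ := MulAction.exists_smul_eq G x y
  exact ⟨g, rfl⟩

theorem smul_mem_blocksNear_iff [ActsByAut G Γ] (g : G) {x : V} {C : P.Block} :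
    g • C ∈ blocksNear Γ P (g • x) ↔ C ∈ blocksNear Γ P x := by
  constructor
  · rintro ⟨y, hy, h⟩
    refine ⟨g⁻¹ • y, ?_, ?_⟩
    · have hy' : P.blockOf y = g • C := hy
      change P.blockOf (g⁻¹ • y) = C
      rw [← P.smul_blockOf, hy', inv_smul_smul]
    · rwa [← smul_adj_iff Γ g, smul_inv_smul]
  · rintro ⟨y, hy, h⟩
    refine ⟨g • y, ?_, (smul_adj_iff Γ g).2 h⟩
    exact congrArg (fun D : P.Block => g • D) hy

theorem adj_mem_blocksNear {x y : V} (h : Γ.Adj x y) : P.blockOf y ∈ blocksNear Γ P x :=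
  ⟨y, rfl, h⟩

theorem smul_mem_toward_iff [ActsByAut G Γ] (g : G) {x : V} {B C : P.Block} :
    g • x ∈ toward Γ P (g • B) (g • C) ↔ x ∈ toward Γ P B C := by
  change P.blockOf (g • x) = g • B ∧ g • C ∈ blocksNear Γ P (g • x) ↔
    P.blockOf x = B ∧ C ∈ blocksNear Γ P x
  rw [smul_mem_blocksNear_iff, ← P.smul_blockOf, smul_left_cancel_iff]

theorem toward_smul [ActsByAut G Γ] (g : G) (B C : P.Block) :
    toward Γ P (g • B) (g • C) = (fun x => g • x) '' toward Γ P B C := by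
  ext x
  constructor
  · intro h
    refine ⟨g⁻¹ • x, ?_, by simp⟩
    rwa [← smul_mem_toward_iff g, smul_inv_smul]
  · rintro ⟨y, hy, rfl⟩
    exact (smul_mem_toward_iff g).2 hy

/-- A point of a block misses an adjacent block when it has no neighbour in it. -/
def Misses (Γ : SimpleGraph V) (P : InvPartition G V) (B : P.Block) (x : P.carrier B)
    (C : (quotientGraph Γ P).neighborSet B) : Prop :=
  (C : P.Block) ∉ blocksNear Γ P x

theorem smul_misses_iff [ActsByAut G Γ] {B : P.Block} (h : MulAction.stabilizer G B)
    (x : P.carrier B) (C : (quotientGraph Γ P).neighborSet B) :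
    Misses Γ P B (h • x) (h • C) ↔ Misses Γ P B x C :=
  not_congr (smul_mem_blocksNear_iff (h : G))

theorem mem_toward_iff {B : P.Block} (x : P.carrier B) (C : P.Block) :
    (x : V) ∈ toward Γ P B C ↔ C ∈ blocksNear Γ P (x : V) :=
  ⟨fun h => h.2, fun h => ⟨x.2, h⟩⟩

namespace Setting

variable {v k r b : ℕ}

theorem exists_adj (S : Setting Γ P v k r b) (B : P.Block) :
    ∃ C, (quotientGraph Γ P).Adj B C := by
  have h := S.params.valency B
  have : 0 < ((quotientGraph Γ P).neighborSet B).ncard := by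
    have := S.two_le_b
    omega
  exact Set.nonempty_of_ncard_ne_zero this.ne'

theorem exists_two_adj (S : Setting Γ P v k r b) (B : P.Block) :
    ∃ C D, (quotientGraph Γ P).Adj B C ∧ (quotientGraph Γ P).Adj B D ∧ C ≠ D := by
  have h := S.params.valency B
  have : 1 < ((quotientGraph Γ P).neighborSet B).ncard := by
    have := S.two_le_b
    omega
  obtain ⟨C, hC, D, hD, hCD⟩ := (Set.one_lt_ncard_iff_nontrivial_and_finite.1 this).1
  exact ⟨C, D, hC, hD, hCD⟩

/-- The quotient has an edge, so some edge of Γ joins distinct blocks; by arc-transitivity every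
edge does. -/
theorem blockOf_ne_of_adj (S : Setting Γ P v k r b) {x y : V} (h : Γ.Adj x y) :
    P.blockOf x ≠ P.blockOf y := by
  obtain ⟨B⟩ := S.connected.nonempty
  obtain ⟨C, hne, x', rfl, y', rfl, h'⟩ := S.exists_adj B
  obtain ⟨g, rfl, rfl⟩ := S.symmetric.arc_trans h' h
  rw [← P.smul_blockOf, ← P.smul_blockOf]
  exact fun e => hne (smul_left_cancel g e)

theorem adj_of_mem_blocksNear (S : Setting Γ P v k r b) {x : V} {C : P.Block}
    (h : C ∈ blocksNear Γ P x) : (quotientGraph Γ P).Adj (P.blockOf x) C := by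
  obtain ⟨y, rfl, hxy⟩ := h
  exact ⟨S.blockOf_ne_of_adj hxy, x, rfl, y, rfl, hxy⟩

theorem quotient_adj (S : Setting Γ P v k r b) {x y : V} (h : Γ.Adj x y) :
    (quotientGraph Γ P).Adj (P.blockOf x) (P.blockOf y) :=
  S.adj_of_mem_blocksNear (adj_mem_blocksNear h)

theorem quotient_arc_trans (S : Setting Γ P v k r b) {B C B' C' : P.Block}
    (h : (quotientGraph Γ P).Adj B C) (h' : (quotientGraph Γ P).Adj B' C') :
    ∃ g : G, g • B = B' ∧ g • C = C' := by
  obtain ⟨-, x, rfl, y, rfl, hxy⟩ := h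
  obtain ⟨-, x', rfl, y', rfl, hxy'⟩ := h'
  obtain ⟨g, rfl, rfl⟩ := S.symmetric.arc_trans hxy hxy'
  exact ⟨g, rfl, rfl⟩

theorem isPretransitive_block (S : Setting Γ P v k r b) :
    MulAction.IsPretransitive G P.Block :=
  have := S.symmetric.vertex_trans
  P.isPretransitive_block

theorem isTwoArcTransitive_quotient_iff [ActsByAut G Γ] (S : Setting Γ P v k r b) :
    IsTwoArcTransitive G (quotientGraph Γ P) ↔ ∀ B : P.Block,
      MulAction.IsMultiplyPretransitive (MulAction.stabilizer G B)
        ((quotientGraph Γ P).neighborSet B) 2 :=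
  have := S.isPretransitive_block
  isTwoArcTransitive_iff _

theorem card_carrier (S : Setting Γ P v k r b) (B : P.Block) : Nat.card (P.carrier B) = v :=
  S.params.block_size B

theorem card_neighborSet (S : Setting Γ P v k r b) (B : P.Block) :
    Nat.card ((quotientGraph Γ P).neighborSet B) = b :=
  S.params.valency B

theorem exists_hasLambda [ActsByAut G Γ] (S : Setting Γ P v k r b)
    (h : IsTwoArcTransitive G (quotientGraph Γ P)) : ∃ lam, HasLambda Γ P lam := by
  obtain ⟨B⟩ := S.connected.nonempty
  obtain ⟨C, D, hC, hD, hCD⟩ := S.exists_two_adj B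
  refine ⟨(toward Γ P B C ∩ toward Γ P B D).ncard, fun B' C' D' hC' hD' hCD' => ?_⟩
  obtain ⟨g, rfl, rfl, rfl⟩ := h.two_arc_trans ⟨hC.symm, hD, hCD⟩ ⟨hC'.symm, hD', hCD'⟩
  rw [toward_smul, toward_smul, ← Set.image_inter (MulAction.injective g),
    Set.ncard_image_of_injective _ (MulAction.injective g)]

instance [Finite V] (P : InvPartition G V) : Finite P.Block := Quotient.finite _

variable [Finite V]

theorem card_eq (S : Setting Γ P v k r b) : Nat.card V = Nat.card P.Block * v := by
  have := card_mul_eq_of_ncard (fun (x : V) (B : P.Block) => P.blockOf x = B) 1 v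
    (fun x => Set.ncard_eq_one.2 ⟨P.blockOf x, by ext; simp [eq_comm]⟩)
    (fun B => S.params.block_size B)
  rwa [mul_one] at this

theorem ncard_misses (S : Setting Γ P v k r b) (B : P.Block)
    (C : (quotientGraph Γ P).neighborSet B) : {x | Misses Γ P B x C}.ncard = 3 := by
  rw [show {x | Misses Γ P B x C} = {x : P.carrier B | (C : P.Block) ∉ blocksNear Γ P (x : V)}
    from rfl, ncard_setOf_subtype (fun x => x ∈ P.carrier B)
    (fun x => (C : P.Block) ∉ blocksNear Γ P x)]
  have h1 := S.params.toward_card B C C.2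
  have h2 := S.params.block_size B
  have h3 : {x | x ∈ P.carrier B ∧ (C : P.Block) ∉ blocksNear Γ P x} =
      P.carrier B \ toward Γ P B C := by
    ext x
    exact ⟨fun h => ⟨h.1, fun h' => h.2 h'.2⟩, fun h => ⟨h.1, fun h' => h.2 ⟨h.1, h'⟩⟩⟩
  rw [h3, Set.ncard_sdiff (fun x hx => hx.1), h1, h2, S.k_eq]
  omega

theorem ncard_missed (S : Setting Γ P v k r b) (B : P.Block) (x : P.carrier B) :
    {C | Misses Γ P B x C}.ncard = b - r := by
  rw [show {C | Misses Γ P B x C} = {C : (quotientGraph Γ P).neighborSet B |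
    (C : P.Block) ∉ blocksNear Γ P (x : V)} from rfl, ncard_setOf_subtype
    (fun C => C ∈ (quotientGraph Γ P).neighborSet B) (fun C => C ∉ blocksNear Γ P (x : V))]
  rw [← S.params.valency B, ← S.params.blocksNear_card x, ← Set.ncard_sdiff]
  · rfl
  · intro C hC
    have := S.adj_of_mem_blocksNear hC
    rwa [x.2] at this

theorem r_le_b (S : Setting Γ P v k r b) : r ≤ b := by
  obtain ⟨B⟩ := S.connected.nonempty
  obtain ⟨x, rfl⟩ := P.exists_blockOf_eq B
  rw [← S.params.valency (P.blockOf x), ← S.params.blocksNear_card x]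
  exact Set.ncard_le_ncard fun C hC => S.adj_of_mem_blocksNear hC

/-- Inclusion and exclusion: v - 2k + λ with k = v - 3. The sum form avoids subtraction. -/
theorem ncard_misses_both (S : Setting Γ P v k r b) {lam : ℕ} (hlam : HasLambda Γ P lam)
    (B : P.Block) {C D : (quotientGraph Γ P).neighborSet B} (hCD : C ≠ D) :
    {x | Misses Γ P B x C ∧ Misses Γ P B x D}.ncard + v = 6 + lam := by
  have h1 := S.params.toward_card B C C.2
  have h2 := S.params.toward_card B D D.2
  have h3 := hlam B C D C.2 D.2 (fun h => hCD (Subtype.ext h))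
  have h4 := S.params.block_size B
  have h5 := Set.ncard_union_add_ncard_inter (toward Γ P B C) (toward Γ P B D)
  rw [show {x | Misses Γ P B x C ∧ Misses Γ P B x D} = {x : P.carrier B |
    (C : P.Block) ∉ blocksNear Γ P (x : V) ∧ (D : P.Block) ∉ blocksNear Γ P (x : V)} from rfl,
    ncard_setOf_subtype (fun x => x ∈ P.carrier B)
    (fun x => (C : P.Block) ∉ blocksNear Γ P x ∧ (D : P.Block) ∉ blocksNear Γ P x)]
  have h6 : {x | x ∈ P.carrier B ∧ (C : P.Block) ∉ blocksNear Γ P x ∧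
      (D : P.Block) ∉ blocksNear Γ P x} = P.carrier B \ (toward Γ P B C ∪ toward Γ P B D) := by
    ext x
    constructor
    · rintro ⟨hB, hC, hD⟩
      refine ⟨hB, ?_⟩
      rintro (h | h)
      · exact hC h.2
      · exact hD h.2
    · rintro ⟨hB, h⟩
      exact ⟨hB, fun h' => h (Or.inl ⟨hB, h'⟩), fun h' => h (Or.inr ⟨hB, h'⟩)⟩
  have h7 : toward Γ P B C ∪ toward Γ P B D ⊆ P.carrier B := by
    rintro x (h | h)
    · exact h.1
    · exact h.1
  have h8 := Set.ncard_sdiff_add_ncard_of_subset h7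
  have := S.k_eq
  rw [h6]
  omega

theorem hasLambda_of_ncard (S : Setting Γ P v k r b) {lam m : ℕ} (hlam : HasLambda Γ P lam)
    (h : lam + 6 = v + m) (B : P.Block) {C D : (quotientGraph Γ P).neighborSet B} (hCD : C ≠ D) :
    {x | Misses Γ P B x C ∧ Misses Γ P B x D}.ncard = m := by
  have := S.ncard_misses_both hlam B hCD
  omega

theorem parameters (S : Setting Γ P v k r b) {lam : ℕ} (hlam : HasLambda Γ P lam) :
    ((v, b, r) = (4, 4, 1) ∧ lam = 0) ∨ ((v, b, r) = (6, 4, 2) ∧ lam = 1) ∨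
    ((v, b, r) = (7, 7, 4) ∧ lam = 2) ∨ ((v, b, r) = (3 * b, b, b - 1) ∧ lam = 3 * b - 6) := by
  obtain ⟨B⟩ := S.connected.nonempty
  obtain ⟨C, D, hC, hD, hCD⟩ := S.exists_two_adj B
  have hm0 := S.ncard_misses_both hlam B (C := ⟨C, hC⟩) (D := ⟨D, hD⟩)
    (fun h => hCD (congrArg Subtype.val h))
  have hr := S.r_le_b
  have hb := S.two_le_b
  have hv := S.k_eq
  have hk := S.k_pos
  have key := triple_system_parameters (Misses Γ P B) (b - r) (6 + lam - v)
    (S.ncard_misses B) (S.ncard_missed B)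
    (fun C D hCD => by have := S.ncard_misses_both hlam B hCD; omega)
    (by rw [S.card_neighborSet]; exact hb) (by rw [S.card_carrier]; omega)
  rw [S.card_neighborSet, S.card_carrier] at key
  simp only [Prod.mk.injEq]
  rcases key with h | h | h | h
  · exact Or.inr (Or.inr (Or.inr ⟨⟨by omega, trivial, by omega⟩, by omega⟩))
  · exact Or.inr (Or.inl ⟨⟨by omega, by omega, by omega⟩, by omega⟩)
  · exact Or.inr (Or.inr (Or.inl ⟨⟨by omega, by omega, by omega⟩, by omega⟩))
  · exact Or.inl ⟨⟨by omega, by omega, by omega⟩, by omega⟩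

end Setting

end SymQuot

/-! ### Local 2-transitivity in each case and the characterization. -/

namespace SymQuot

variable {G V : Type*} [Group G] [MulAction G V] {Γ : SimpleGraph V} {P : InvPartition G V}

namespace Setting

variable {v k r b : ℕ}

/-- Given C ≠ D, choose x missing C. Missing only C, it has a neighbour y in D, so the arc (x, y) of
Γ encodes the pair (C, D), and arc-transitivity of Γ moves pairs to pairs. -/
theorem isMultiplyPretransitive_of_missing_one [ActsByAut G Γ] [Finite V]
    (S : Setting Γ P v k r b) (h1 : b - r = 1) (B : P.Block) :
    MulAction.IsMultiplyPretransitive (MulAction.stabilizer G B)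
        ((quotientGraph Γ P).neighborSet B) 2 := by
  have huniq : ∀ (x : P.carrier B) C D, Misses Γ P B x C → Misses Γ P B x D → C = D := by
    intro x C D hC hD
    obtain ⟨E, hE⟩ := Set.ncard_eq_one.1 ((S.ncard_missed B x).trans h1)
    have h2 : C ∈ ({E} : Set _) := hE ▸ hC
    have h3 : D ∈ ({E} : Set _) := hE ▸ hD
    exact h2.trans h3.symm
  have hex : ∀ C, ∃ x, Misses Γ P B x C := by
    intro C
    exact Set.nonempty_of_ncard_ne_zero (s := {x | Misses Γ P B x C})
      (by rw [S.ncard_misses B C]; omega)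
  rw [MulAction.is_two_pretransitive_iff]
  intro C D C' D' hCD hCD'
  obtain ⟨x, hx⟩ := hex C
  obtain ⟨x', hx'⟩ := hex C'
  have hxD : (D : P.Block) ∈ blocksNear Γ P (x : V) := by
    by_contra h
    exact hCD (huniq x C D hx h)
  have hxD' : (D' : P.Block) ∈ blocksNear Γ P (x' : V) := by
    by_contra h
    exact hCD' (huniq x' C' D' hx' h)
  obtain ⟨y, hy, hxy⟩ := hxD
  obtain ⟨y', hy', hxy'⟩ := hxD'
  obtain ⟨g, hg, hgy⟩ := S.symmetric.arc_trans hxy hxy'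
  have hgB : g • B = B := by
    have e1 : P.blockOf (x : V) = B := x.2
    have e2 : P.blockOf (x' : V) = B := x'.2
    calc g • B = g • P.blockOf (x : V) := by rw [e1]
      _ = P.blockOf (x' : V) := by rw [P.smul_blockOf, hg]
      _ = B := e2
  let h : MulAction.stabilizer G B := ⟨g, hgB⟩
  have hhx : h • x = x' := Subtype.ext hg
  refine ⟨h, huniq x' _ _ (by rw [← hhx, smul_misses_iff]; exact hx) hx', Subtype.ext ?_⟩
  have e1 : P.blockOf y = D := hy
  have e2 : P.blockOf y' = D' := hy'
  change g • (D : P.Block) = D'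
  rw [← e1, ← e2, ← hgy, P.smul_blockOf]

theorem isMultiplyPretransitive_of_valency_two [ActsByAut G Γ] [Finite V]
    (S : Setting Γ P v k r b) (hb : b = 2) (B : P.Block) :
    MulAction.IsMultiplyPretransitive (MulAction.stabilizer G B)
        ((quotientGraph Γ P).neighborSet B) 2 := by
  rw [MulAction.is_two_pretransitive_iff]
  intro C D C' D' hCD hCD'
  obtain ⟨g, hgB, hgC⟩ := S.quotient_arc_trans C.2 C'.2
  let h : MulAction.stabilizer G B := ⟨g, hgB⟩
  have hhC : h • C = C' := Subtype.ext hgC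
  refine ⟨h, hhC, ?_⟩
  have hall : ({C', D'} : Set _) = Set.univ := by
    refine Set.eq_of_subset_of_ncard_le (Set.subset_univ _) ?_
    rw [Set.ncard_univ, S.card_neighborSet, hb, Set.ncard_pair hCD']
  have hm : h • D ∈ ({C', D'} : Set _) := hall ▸ Set.mem_univ _
  rcases hm with hm | hm
  · exact absurd (smul_left_cancel h (hm.trans hhC.symm)) hCD.symm
  · exact hm

/-- Here r = k = 1: a vertex of B sees one block, and a block is seen by one vertex of B. -/
theorem exists_equiv_of_near_one [ActsByAut G Γ] [Finite V]
    (S : Setting Γ P v k r b) (hp : (v, b, r) = (4, 4, 1)) (B : P.Block) :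
    ∃ e : P.carrier B ≃ (quotientGraph Γ P).neighborSet B,
      ∀ (h : MulAction.stabilizer G B) x, e (h • x) = h • e x := by
  simp only [Prod.mk.injEq] at hp
  obtain ⟨rfl, rfl, rfl⟩ := hp
  choose near hnear using fun x : V => Set.ncard_eq_one.1 (S.params.blocksNear_card x)
  have hmem : ∀ x C, C ∈ blocksNear Γ P x ↔ C = near x := fun x C => by rw [hnear]; rfl
  have hadj : ∀ x : P.carrier B, (quotientGraph Γ P).Adj B (near x) := fun x => by
    have := S.adj_of_mem_blocksNear ((hmem (x : V) _).2 rfl)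
    rwa [x.2] at this
  let f : P.carrier B → (quotientGraph Γ P).neighborSet B := fun x => ⟨near x, hadj x⟩
  have hf : Function.Bijective f := by
    have := Fintype.ofFinite (P.carrier B)
    have := Fintype.ofFinite ((quotientGraph Γ P).neighborSet B)
    refine (Fintype.bijective_iff_injective_and_card f).2 ⟨?_, ?_⟩
    · intro x y hxy
      have h1 := S.params.toward_card B _ (hadj x)
      have hk := S.k_eq
      obtain ⟨z, hz⟩ := Set.ncard_eq_one.1 (h1.trans (by omega))
      have hx : (x : V) ∈ ({z} : Set V) := hz ▸ ⟨x.2, (hmem _ _).2 rfl⟩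
      have hy : (y : V) ∈ ({z} : Set V) := hz ▸ ⟨y.2, (hmem _ _).2 (congrArg Subtype.val hxy)⟩
      exact Subtype.ext (hx.trans hy.symm)
    · rw [← Nat.card_eq_fintype_card, ← Nat.card_eq_fintype_card, S.card_carrier,
        S.card_neighborSet]
  refine ⟨Equiv.ofBijective f hf, fun h x => Subtype.ext ?_⟩
  change near (h • x : P.carrier B) = (h : G) • near x
  symm
  rw [← hmem]
  exact (smul_mem_blocksNear_iff (h : G)).2 ((hmem _ _).2 rfl)

theorem isoA4OrS4_permOnBlock_iff [ActsByAut G Γ] [Finite V]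
    (S : Setting Γ P v k r b) (hp : (v, b, r) = (4, 4, 1)) (B : P.Block) :
    IsoA4OrS4 (permOnBlock P B) ↔
      MulAction.IsMultiplyPretransitive (MulAction.stabilizer G B)
        ((quotientGraph Γ P).neighborSet B) 2 := by
  obtain ⟨e, he⟩ := S.exists_equiv_of_near_one hp B
  simp only [Prod.mk.injEq] at hp
  rw [isoA4OrS4_inducedPerm_iff (by rw [S.card_carrier, hp.1])]
  refine ⟨isMultiplyPretransitive_two_of_equiv e he,
    isMultiplyPretransitive_two_of_equiv e.symm fun h C => ?_⟩
  rw [Equiv.symm_apply_eq, he, Equiv.apply_symm_apply]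

theorem isoA4OrS4_permOnNbrs_iff [ActsByAut G Γ]
    (S : Setting Γ P v k r b) (hb : b = 4) (B : P.Block) :
    IsoA4OrS4 (permOnNbrs Γ P B) ↔
      MulAction.IsMultiplyPretransitive (MulAction.stabilizer G B)
        ((quotientGraph Γ P).neighborSet B) 2 :=
  isoA4OrS4_inducedPerm_iff (by rw [S.card_neighborSet, hb])

theorem nonempty_fanoCoords [Finite V] (S : Setting Γ P v k r b) (hp : (v, b, r) = (7, 7, 4))
    (hlam : HasLambda Γ P 2) (B : P.Block) : Nonempty (FanoCoords (Misses Γ P B)) := by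
  simp only [Prod.mk.injEq] at hp
  obtain ⟨rfl, rfl, rfl⟩ := hp
  exact exists_fanoCoords (Misses Γ P B) (S.card_carrier B) (S.card_neighborSet B)
    (S.ncard_misses B) (S.ncard_missed B)
    (fun C D hCD => S.hasLambda_of_ncard hlam (by norm_num) B hCD)

theorem exists_quotient_cycle_coords [ActsByAut G Γ] [Finite V] (S : Setting Γ P v k r b)
    (hv : v = 6) (hb : b = 2) : 3 ≤ Nat.card V / 6 ∧ ∃ f : ZMod (Nat.card V / 6) ≃ P.Block,
      ∀ a b, (quotientGraph Γ P).Adj (f a) (f b) ↔ b = a + 1 ∨ a = b + 1 := by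
  obtain ⟨n, hn, f, hf⟩ := exists_cycle_coords (G := G) (quotientGraph Γ P) S.connected
    (fun B => by rw [S.params.valency B, hb]) S.quotient_arc_trans
  have h1 := S.card_eq
  rw [← Nat.card_congr f, Nat.card_zmod, hv] at h1
  have h2 : Nat.card V / 6 = n := by omega
  rw [h2]
  exact ⟨hn, f, hf⟩

/-- The characterization of the imprimitive quotients that are 2-arc transitive. -/
theorem isTwoArcTransitive_iff_cases [ActsByAut G Γ] [Finite V] (S : Setting Γ P v k r b) :
    IsTwoArcTransitive G (quotientGraph Γ P) ↔
      CaseA Γ P v b r ∨ CaseB Γ P v b r ∨ CaseC Γ P v b r ∨ (∃ a : ℕ, CaseD Γ P v b r a) ∨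
        CaseE Γ P v b r := by
  have hiff := S.isTwoArcTransitive_quotient_iff
  constructor
  · intro h
    obtain ⟨lam, hlam⟩ := S.exists_hasLambda h
    rcases S.parameters hlam with ⟨hp, rfl⟩ | ⟨hp, rfl⟩ | ⟨hp, rfl⟩ | ⟨hp, rfl⟩
    · exact Or.inl ⟨hp, hlam, fun B => (S.isoA4OrS4_permOnBlock_iff hp B).2 (hiff.1 h B)⟩
    · refine Or.inr (Or.inr (Or.inr (Or.inr ⟨hp, hlam, fun B => ?_⟩)))
      simp only [Prod.mk.injEq] at hp
      exact (S.isoA4OrS4_permOnNbrs_iff hp.2.1 B).2 (hiff.1 h B)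
    · refine Or.inr (Or.inr (Or.inl ⟨hp, hlam, fun B => ?_⟩))
      obtain ⟨C⟩ := S.nonempty_fanoCoords hp hlam B
      exact (C.isoPSL32_inducedPerm_iff smul_misses_iff).2
        (C.realizes_of_twoTransitive smul_misses_iff (hiff.1 h B))
    -- Disjoint triples: b = 2 is case (b), where the quotient is a cycle, and b ≥ 3 is case (d)
    -- with a = b.
    · rcases Nat.lt_or_ge b 3 with hb | hb
      · have hb2 : b = 2 := by have := S.two_le_b; omega
        simp only [Prod.mk.injEq] at hp
        have hv : v = 6 := by omega
        obtain ⟨hn, f, hf⟩ := S.exists_quotient_cycle_coords hv hb2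
        refine Or.inr (Or.inl ⟨?_, ?_, nonempty_iso_cycleGraph _ hn f hf⟩)
        · simp only [Prod.mk.injEq]
          omega
        · rwa [hb2] at hlam
      · exact Or.inr (Or.inr (Or.inr (Or.inl ⟨b, hb, hp, hlam⟩)))
  · rw [hiff]
    rintro (⟨hp, -, h⟩ | ⟨hp, -, -⟩ | ⟨hp, hlam, h⟩ | ⟨a, ha, hp, -⟩ | ⟨hp, -, h⟩) B
    · exact (S.isoA4OrS4_permOnBlock_iff hp B).1 (h B)
    · simp only [Prod.mk.injEq] at hp
      exact S.isMultiplyPretransitive_of_valency_two hp.2.1 B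
    · obtain ⟨C⟩ := S.nonempty_fanoCoords hp hlam B
      exact C.lines_twoTransitive smul_misses_iff
        ((C.isoPSL32_inducedPerm_iff smul_misses_iff).1 (h B))
    · simp only [Prod.mk.injEq] at hp
      exact S.isMultiplyPretransitive_of_missing_one (by omega) B
    · simp only [Prod.mk.injEq] at hp
      exact (S.isoA4OrS4_permOnNbrs_iff hp.2.1 B).1 (h B)

end Setting

end SymQuot

/-! ### Recognizing small bipartite graphs from their valency. -/

section Bipartite

variable {T : Type*} [Finite T] (F : SimpleGraph T) (p : T → Prop) (n : ℕ)

/-- Labels for the two parts of a bipartition that are matched by a bijection of the parts. -/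
theorem exists_sum_equiv (hp : {x | p x}.ncard = n) (m : {x // p x} ≃ {x // ¬ p x}) :
    ∃ e : Fin n ⊕ Fin n ≃ T, (∀ i, p (e (Sum.inl i))) ∧ (∀ i, ¬ p (e (Sum.inr i))) ∧
      ∀ i (h : p (e (Sum.inl i))), (m ⟨e (Sum.inl i), h⟩ : T) = e (Sum.inr i) := by
  classical
  have := Fintype.ofFinite {x // p x}
  let a : {x // p x} ≃ Fin n := Fintype.equivFinOfCardEq (by
    rw [← Nat.card_eq_fintype_card, ← hp]; rfl)
  refine ⟨(a.symm.sumCongr (a.symm.trans m)).trans (Equiv.sumCompl p), ?_, ?_, ?_⟩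
  · intro i
    exact (a.symm i).2
  · intro i
    exact (m (a.symm i)).2
  · intro i h
    rfl

theorem nonempty_equiv_of_ncard (hp : {x | p x}.ncard = n) (hp' : {x | ¬ p x}.ncard = n) :
    Nonempty ({x // p x} ≃ {x // ¬ p x}) := by
  have := Fintype.ofFinite {x // p x}
  have := Fintype.ofFinite {x // ¬ p x}
  refine ⟨Fintype.equivOfCardEq ?_⟩
  rw [← Nat.card_eq_fintype_card, ← Nat.card_eq_fintype_card]
  exact hp.trans hp'.symm

theorem nonempty_iso_completeBipartiteGraph (hF : ∀ x y, F.Adj x y → (p x ↔ ¬ p y))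
    (hp : {x | p x}.ncard = n) (hp' : {x | ¬ p x}.ncard = n)
    (hd : ∀ x, (F.neighborSet x).ncard = n) :
    Nonempty (F ≃g completeBipartiteGraph (Fin n) (Fin n)) := by
  have hadj : ∀ x y, p x → ¬ p y → F.Adj x y := by
    intro x y hx hy
    have : F.neighborSet x = {x | ¬ p x} := by
      refine Set.eq_of_subset_of_ncard_le (fun z hz => (hF x z hz).1 hx) ?_
      rw [hd, hp']
    have hy' : y ∈ F.neighborSet x := by rw [this]; exact hy
    exact hy'
  obtain ⟨m⟩ := nonempty_equiv_of_ncard p n hp hp'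
  obtain ⟨e, h1, h2, -⟩ := exists_sum_equiv p n hp m
  refine ⟨RelIso.symm { toEquiv := e, map_rel_iff' := ?_ }⟩
  rintro (i | i) (j | j)
  · simpa using fun h => (hF _ _ h).1 (h1 i) (h1 j)
  · simpa using hadj _ _ (h1 i) (h2 j)
  · simpa using (hadj _ _ (h1 j) (h2 i)).symm
  · simpa using fun h => h2 i ((hF _ _ h).2 (h2 j))

/-- Every vertex has exactly one non-neighbour in the other part; this relation is symmetric and so
a bijection of the parts. -/
theorem nonempty_iso_completeBipartiteGraph_sdiff_matching
    (hF : ∀ x y, F.Adj x y → (p x ↔ ¬ p y))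
    (hp : {x | p x}.ncard = n) (hp' : {x | ¬ p x}.ncard = n)
    (hd : ∀ x, (F.neighborSet x).ncard + 1 = n) :
    Nonempty (F ≃g completeBipartiteGraph (Fin n) (Fin n) \ matching n) := by
  have hone : ∀ x, p x → ∃ y, ¬ p y ∧ ∀ z, ¬ p z → (¬ F.Adj x z ↔ z = y) := by
    intro x hx
    have hsub : F.neighborSet x ⊆ {x | ¬ p x} := fun z hz => (hF x z hz).1 hx
    have h1 : ({x | ¬ p x} \ F.neighborSet x).ncard = 1 := by
      have := Set.ncard_sdiff_add_ncard_of_subset hsub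
      have := hd x
      omega
    obtain ⟨y, hy⟩ := Set.ncard_eq_one.1 h1
    have hy' : y ∈ {x | ¬ p x} \ F.neighborSet x := by rw [hy]; rfl
    refine ⟨y, hy'.1, fun z hz => ⟨fun h => ?_, ?_⟩⟩
    · have : z ∈ ({y} : Set T) := hy ▸ ⟨hz, h⟩
      exact this
    · rintro rfl
      exact hy'.2
  have hone' : ∀ x, ¬ p x → ∃ y, p y ∧ ∀ z, p z → (¬ F.Adj x z ↔ z = y) := by
    intro x hx
    have hsub : F.neighborSet x ⊆ {x | p x} := fun z hz => (hF z x hz.symm).2 hx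
    have h1 : ({x | p x} \ F.neighborSet x).ncard = 1 := by
      have := Set.ncard_sdiff_add_ncard_of_subset hsub
      have := hd x
      omega
    obtain ⟨y, hy⟩ := Set.ncard_eq_one.1 h1
    have hy' : y ∈ {x | p x} \ F.neighborSet x := by rw [hy]; rfl
    refine ⟨y, hy'.1, fun z hz => ⟨fun h => ?_, ?_⟩⟩
    · have : z ∈ ({y} : Set T) := hy ▸ ⟨hz, h⟩
      exact this
    · rintro rfl
      exact hy'.2
  choose m hm hm1 using hone
  choose m' hm' hm1' using hone'
  let M : {x // p x} ≃ {x // ¬ p x} :=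
    { toFun := fun x => ⟨m x x.2, hm x x.2⟩
      invFun := fun y => ⟨m' y y.2, hm' y y.2⟩
      left_inv := fun x => Subtype.ext ((hm1' (m x x.2) (hm x x.2) x x.2).1 (fun h =>
        (hm1 x x.2 (m x x.2) (hm x x.2)).2 rfl h.symm)).symm
      right_inv := fun y => Subtype.ext ((hm1 (m' y y.2) (hm' y y.2) y y.2).1 (fun h =>
        (hm1' y y.2 (m' y y.2) (hm' y y.2)).2 rfl h.symm)).symm }
  obtain ⟨e, h1, h2, h3⟩ := exists_sum_equiv p n hp M
  have h4 : ∀ i j, F.Adj (e (Sum.inl i)) (e (Sum.inr j)) ↔ i ≠ j := by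
    intro i j
    rw [← not_iff_not, hm1 _ (h1 i) _ (h2 j), not_not,
      show m _ (h1 i) = e (Sum.inr i) from h3 i (h1 i), e.injective.eq_iff, Sum.inr.injEq, eq_comm]
  refine ⟨RelIso.symm { toEquiv := e, map_rel_iff' := ?_ }⟩
  rintro (i | i) (j | j)
  · simpa [matching] using fun h => (hF _ _ h).1 (h1 i) (h1 j)
  · rw [h4]
    simp [matching, eq_comm (a := j)]
  · rw [F.adj_comm, h4]
    simp [matching, eq_comm]
  · simpa [matching] using fun h => h2 i ((hF _ _ h).2 (h2 j))

theorem nonempty_iso_copies_of_bipartite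
    (hp : {x | p x}.ncard = n) (hp' : {x | ¬ p x}.ncard = n)
    (hd : ∀ x, (F.neighborSet x).ncard = 1) :
    Nonempty (F ≃g copies n (⊤ : SimpleGraph (Fin 2))) := by
  have h := nonempty_iso_copies_top F fun x => by
    obtain ⟨y, hy⟩ := Set.ncard_eq_one.1 (hd x)
    refine ⟨y, ?_, fun z hz => ?_⟩
    · have : y ∈ F.neighborSet x := by rw [hy]; rfl
      exact this
    · have : z ∈ ({y} : Set T) := hy ▸ hz
      exact this
  have hcard : Nat.card T = n + n := by
    rw [← Set.ncard_add_ncard_compl {x | p x}, hp]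
    exact congrArg (n + ·) hp'
  rwa [hcard, show (n + n) / 2 = n by omega] at h

theorem nonempty_iso_cycleGraph_six :
    Nonempty ((completeBipartiteGraph (Fin 3) (Fin 3) \ matching 3) ≃g
      SimpleGraph.cycleGraph 6) := by
  -- The parts are the even and odd vertices of the hexagon, and removed edges join opposite
  -- vertices.
  let f : Fin 3 ⊕ Fin 3 → Fin 6 := Sum.elim ![0, 4, 2] ![3, 1, 5]
  have hf : Function.Bijective f := by decide
  refine ⟨{ toEquiv := Equiv.ofBijective f hf, map_rel_iff' := ?_ }⟩
  rintro (i | i) (j | j) <;>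
    simp only [Equiv.ofBijective_apply, SimpleGraph.cycleGraph_adj, matching,
      SimpleGraph.sdiff_adj, SimpleGraph.fromRel_adj, completeBipartiteGraph_adj] <;>
    revert i j <;> simp [f] <;> decide

end Bipartite

/-! ### The structure of Γ in cases (a) and (b). -/

namespace SymQuot

variable {G V : Type*} [Group G] [MulAction G V] {Γ : SimpleGraph V} {P : InvPartition G V}

namespace Setting

variable {v k r b : ℕ}

/-- All vertices of `B ∩ Γ(C)` have the same number of neighbours in `C`. -/
theorem exists_degree_between [Finite V] [ActsByAut G Γ] (S : Setting Γ P v k r b) :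
    ∃ d, 1 ≤ d ∧ d ≤ k ∧ ∀ x : V, ∀ C ∈ blocksNear Γ P x,
      {y | y ∈ P.carrier C ∧ Γ.Adj x y}.ncard = d := by
  obtain ⟨B⟩ := S.connected.nonempty
  obtain ⟨C, hBC, x, rfl, y, rfl, hxy⟩ := S.exists_adj B
  have hadj : (quotientGraph Γ P).Adj (P.blockOf x) (P.blockOf y) := S.quotient_adj hxy
  refine ⟨{z | z ∈ P.carrier (P.blockOf y) ∧ Γ.Adj x z}.ncard, ?_, ?_, ?_⟩
  · rw [Nat.one_le_iff_ne_zero]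
    exact Set.ncard_ne_zero_of_mem (a := y) ⟨rfl, hxy⟩
  · rw [← S.params.toward_card _ _ hadj.symm]
    exact Set.ncard_le_ncard fun z hz => ⟨hz.1, x, rfl, hz.2.symm⟩
  · rintro x' _ ⟨y', rfl, hxy'⟩
    obtain ⟨g, rfl, rfl⟩ := S.symmetric.arc_trans hxy hxy'
    rw [← Set.ncard_image_of_injective {z | z ∈ P.carrier (P.blockOf y) ∧ Γ.Adj x z}
      (MulAction.injective g)]
    congr 1
    ext z
    constructor
    · rintro ⟨hz, h⟩
      have hz' : P.blockOf z = g • P.blockOf y := hz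
      refine ⟨g⁻¹ • z, ⟨?_, ?_⟩, by simp⟩
      · change P.blockOf (g⁻¹ • z) = P.blockOf y
        rw [← P.smul_blockOf, hz', inv_smul_smul]
      · rwa [← smul_adj_iff Γ g, smul_inv_smul]
    · rintro ⟨z, ⟨hz, h⟩, rfl⟩
      exact ⟨congrArg (fun D : P.Block => g • D) hz, (smul_adj_iff Γ g).2 h⟩

/-- The bipartition of `Γ[B, C]`, with its valency. -/
theorem between_bipartite [Finite V] [ActsByAut G Γ] (S : Setting Γ P v k r b) {d : ℕ}
    (hd : ∀ x : V, ∀ C ∈ blocksNear Γ P x, {y | y ∈ P.carrier C ∧ Γ.Adj x y}.ncard = d)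
    {B C : P.Block} (hBC : (quotientGraph Γ P).Adj B C) :
    (∀ x y, (between Γ P B C).Adj x y → (P.blockOf (x : V) = B ↔ ¬ P.blockOf (y : V) = B)) ∧
    {x : ↥(toward Γ P B C ∪ toward Γ P C B) | P.blockOf (x : V) = B}.ncard = k ∧
    {x : ↥(toward Γ P B C ∪ toward Γ P C B) | ¬ P.blockOf (x : V) = B}.ncard = k ∧
    ∀ x, ((between Γ P B C).neighborSet x).ncard = d := by
  have hne : B ≠ C := hBC.ne
  have hnb : ∀ y : ↥(toward Γ P B C ∪ toward Γ P C B),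
      ¬ P.blockOf (y : V) = B ↔ P.blockOf (y : V) = C := by
    rintro ⟨y, hy | hy⟩
    · have : P.blockOf y = B := hy.1
      simp [this, hne]
    · have : P.blockOf y = C := hy.1
      simp [this, hne.symm]
  refine ⟨?_, ?_, ?_, ?_⟩
  · intro x y hxy
    have h := S.blockOf_ne_of_adj (x := (x : V)) (y := (y : V)) hxy
    constructor
    · intro h1 h2
      exact h (h1.trans h2.symm)
    · intro h2
      by_contra h1
      exact h (((hnb x).1 h1).trans ((hnb y).1 h2).symm)
  · rw [ncard_setOf_subtype (fun x => x ∈ toward Γ P B C ∪ toward Γ P C B)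
      (fun x => P.blockOf x = B), ← S.params.toward_card B C hBC]
    congr 1
    ext x
    constructor
    · rintro ⟨h | h, h'⟩
      · exact h
      · exact absurd (h'.symm.trans h.1) hne
    · intro h
      exact ⟨Or.inl h, h.1⟩
  · rw [ncard_setOf_subtype (fun x => x ∈ toward Γ P B C ∪ toward Γ P C B)
      (fun x => ¬ P.blockOf x = B), ← S.params.toward_card C B hBC.symm]
    congr 1
    ext x
    constructor
    · rintro ⟨h | h, h'⟩
      · exact absurd h.1 h'
      · exact h
    · intro h
      refine ⟨Or.inr h, fun h' => hne (h'.symm.trans h.1)⟩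
  · rintro ⟨x, hx⟩
    rw [show (between Γ P B C).neighborSet ⟨x, hx⟩ =
      {y : ↥(toward Γ P B C ∪ toward Γ P C B) | Γ.Adj x y} from rfl,
      ncard_setOf_subtype (fun x => x ∈ toward Γ P B C ∪ toward Γ P C B) (fun y => Γ.Adj x y)]
    rcases hx with hx | hx
    · rw [← hd x C hx.2]
      congr 1
      ext y
      constructor
      · rintro ⟨h | h, h'⟩
        · exact absurd (Eq.trans hx.1 (Eq.symm h.1)) (S.blockOf_ne_of_adj h')
        · exact ⟨h.1, h'⟩
      · rintro ⟨h, h'⟩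
        exact ⟨Or.inr ⟨h, x, hx.1, h'.symm⟩, h'⟩
    · rw [← hd x B hx.2]
      congr 1
      ext y
      constructor
      · rintro ⟨h | h, h'⟩
        · exact ⟨h.1, h'⟩
        · exact absurd (Eq.trans hx.1 (Eq.symm h.1)) (S.blockOf_ne_of_adj h')
      · rintro ⟨h, h'⟩
        exact ⟨Or.inl ⟨h, x, hx.1, h'.symm⟩, h'⟩

theorem caseA_structure [Finite V] [ActsByAut G Γ] (S : Setting Γ P v k r b)
    (h : CaseA Γ P v b r) : (∀ B : P.Block, IsoA4OrS4 (permOnNbrs Γ P B)) ∧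
      Nonempty (Γ ≃g copies (Nat.card V / 2) (⊤ : SimpleGraph (Fin 2))) := by
  obtain ⟨hp, -, hiso⟩ := h
  refine ⟨fun B => ?_, nonempty_iso_copies_top Γ fun x => ?_⟩
  · have h4 := (S.isoA4OrS4_permOnBlock_iff hp B).1 (hiso B)
    simp only [Prod.mk.injEq] at hp
    exact (S.isoA4OrS4_permOnNbrs_iff hp.2.1 B).2 h4
  · simp only [Prod.mk.injEq] at hp
    obtain ⟨C, hC⟩ := Set.ncard_eq_one.1 ((S.params.blocksNear_card x).trans hp.2.2)
    obtain ⟨y, hy, hxy⟩ : C ∈ blocksNear Γ P x := by rw [hC]; rfl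
    refine ⟨y, hxy, fun z hz => ?_⟩
    have hzC : P.blockOf z ∈ ({C} : Set _) := hC ▸ adj_mem_blocksNear hz
    have hadj := S.quotient_adj hxy
    have hk := S.k_eq
    obtain ⟨w, hw⟩ := Set.ncard_eq_one.1
      ((S.params.toward_card _ _ hadj.symm).trans (by omega))
    have h1 : y ∈ ({w} : Set V) := hw ▸ ⟨rfl, x, rfl, hxy.symm⟩
    have h2 : z ∈ ({w} : Set V) := hw ▸ ⟨Eq.trans hzC (Eq.symm hy), x, rfl, hz.symm⟩
    exact h2.trans h1.symm

theorem caseB_structure [Finite V] [ActsByAut G Γ] (S : Setting Γ P v k r b)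
    (h : CaseB Γ P v b r) :
    (Nonempty (Γ ≃g copies (3 * (Nat.card V / 6)) (⊤ : SimpleGraph (Fin 2))) ∨
      Nonempty (Γ ≃g copies (Nat.card V / 6) (SimpleGraph.cycleGraph 6)) ∨
      Nonempty (Γ ≃g copies (Nat.card V / 6) (completeBipartiteGraph (Fin 3) (Fin 3)))) ∧
    Nonempty (G ⧸ (MulAction.toPermHom G P.Block).ker ≃* DihedralGroup (Nat.card V / 6)) := by
  obtain ⟨hp, -, -⟩ := h
  simp only [Prod.mk.injEq] at hp
  obtain ⟨rfl, rfl, rfl⟩ := hp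
  obtain ⟨hn, f, hf⟩ := S.exists_quotient_cycle_coords rfl rfl
  refine ⟨?_, nonempty_mulEquiv_dihedralGroup (quotientGraph Γ P) hn f hf S.quotient_arc_trans⟩
  have hk3 : k = 3 := by have := S.k_eq; omega
  subst hk3
  obtain ⟨d, hd1, hd3, hd⟩ := S.exists_degree_between
  choose near hnear using fun x : V => Set.ncard_eq_one.1 (S.params.blocksNear_card x)
  have hmem : ∀ x C, C ∈ blocksNear Γ P x ↔ C = near x := fun x C => by rw [hnear]; rfl
  have hadj : ∀ x, (quotientGraph Γ P).Adj (P.blockOf x) (near x) := fun x =>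
    S.adj_of_mem_blocksNear ((hmem x _).2 rfl)
  -- With r = 1, sending x to the edge {block of x, block seen by x} splits Γ into the graphs
  -- Γ[B,C]. These are 3 + 3 bipartite of valency d ≤ 3, which gives the three possibilities.
  let e : V → Set.range fun x => s(P.blockOf x, near x) := fun x => ⟨_, x, rfl⟩
  have he : ∀ x y, Γ.Adj x y → e x = e y := by
    intro x y hxy
    have h1 := (hmem x _).1 (adj_mem_blocksNear hxy)
    have h2 := (hmem y _).1 (adj_mem_blocksNear hxy.symm)
    apply Subtype.ext
    change s(P.blockOf x, near x) = s(P.blockOf y, near y)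
    rw [← h1, ← h2, Sym2.eq_swap]
  have hfib : ∀ x, e ⁻¹' {e x} =
      toward Γ P (P.blockOf x) (near x) ∪ toward Γ P (near x) (P.blockOf x) := by
    intro x
    ext y
    have h1 : y ∈ e ⁻¹' {e x} ↔ s(P.blockOf y, near y) = s(P.blockOf x, near x) :=
      Subtype.ext_iff
    rw [h1, Sym2.eq_iff]
    have h2 : ∀ B C, y ∈ toward Γ P B C ↔ P.blockOf y = B ∧ near y = C := fun B C => by
      rw [eq_comm (a := near y), ← hmem]
      rfl
    rw [Set.mem_union, h2, h2]
  have key : ∀ {W : Type} (K : SimpleGraph W) [Finite W], Nat.card W = 6 →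
      (∀ B C, (quotientGraph Γ P).Adj B C → Nonempty (between Γ P B C ≃g K)) →
      Nonempty (Γ ≃g copies (Nat.card V / 6) K) := by
    intro W K _ hW hK
    have := nonempty_iso_copies Γ K e he _ rfl (by
      rintro ⟨_, x, rfl⟩
      change Nonempty (Γ.induce (e ⁻¹' {e x}) ≃g K)
      rw [hfib]
      exact hK _ _ (hadj x))
    have hc := card_eq_of_iso_copies this
    rw [hW] at hc
    rwa [hc, Nat.mul_div_cancel _ (by norm_num)]
  have h3 : d = 1 ∨ d = 2 ∨ d = 3 := by omega
  rcases h3 with rfl | rfl | rfl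
  · left
    have h1 := nonempty_iso_copies_top Γ fun x => by
      obtain ⟨y, hy⟩ := Set.ncard_eq_one.1 (hd x (near x) ((hmem x _).2 rfl))
      have hy' : y ∈ ({y} : Set V) := rfl
      rw [← hy] at hy'
      refine ⟨y, hy'.2, fun z hz => ?_⟩
      have : z ∈ ({y} : Set V) := hy ▸ ⟨(hmem x _).1 (adj_mem_blocksNear hz), hz⟩
      exact this
    have hc := S.card_eq
    rwa [show Nat.card V / 2 = 3 * (Nat.card V / 6) by omega] at h1
  · right; left
    refine key _ (by simp) fun B C hBC => ?_
    obtain ⟨h1, h2, h3, h4⟩ := S.between_bipartite hd hBC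
    obtain ⟨φ⟩ := nonempty_iso_completeBipartiteGraph_sdiff_matching _ _ 3 h1 h2 h3
      (fun x => by rw [h4])
    obtain ⟨ψ⟩ := nonempty_iso_cycleGraph_six
    exact ⟨φ.trans ψ⟩
  · right; right
    refine key _ (by simp) fun B C hBC => ?_
    obtain ⟨h1, h2, h3, h4⟩ := S.between_bipartite hd hBC
    exact nonempty_iso_completeBipartiteGraph _ _ 3 h1 h2 h3 h4

end Setting

end SymQuot

/-! ### Cases (d) and (e): coding Γ by arcs and 2-paths of the quotient. -/

namespace SymQuot

variable {G V : Type*} [Group G] [MulAction G V] {Γ : SimpleGraph V} {P : InvPartition G V}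

theorem ncard_dart_fst_eq {W : Type*} [Finite W] (S : SimpleGraph W) (B : W) (q : W → Prop) :
    {t : S.Dart | t.fst = B ∧ q t.snd}.ncard = {C | S.Adj B C ∧ q C}.ncard := by
  have hinj : Set.InjOn (fun t : S.Dart => t.snd) {t : S.Dart | t.fst = B ∧ q t.snd} := by
    intro s hs t ht hst
    exact SimpleGraph.Dart.ext _ _ (Prod.ext (hs.1.trans ht.1.symm) hst)
  rw [← hinj.ncard_image]
  congr 1
  ext C
  constructor
  · rintro ⟨⟨⟨B', C'⟩, h⟩, ⟨rfl, hq⟩, rfl⟩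
    exact ⟨h, hq⟩
  · rintro ⟨h, hq⟩
    exact ⟨⟨(B, C), h⟩, ⟨rfl, hq⟩, rfl⟩

namespace Setting

variable {v k r b : ℕ}

/-- When every vertex misses exactly one of the blocks adjacent to its own block, that block. -/
theorem exists_missed_block [Finite V] [ActsByAut G Γ] (S : Setting Γ P v k r b)
    (h1 : b - r = 1) : ∃ ms : V → P.Block,
      (∀ x, (quotientGraph Γ P).Adj (P.blockOf x) (ms x)) ∧
      (∀ x C, (quotientGraph Γ P).Adj (P.blockOf x) C → (C ∉ blocksNear Γ P x ↔ C = ms x)) ∧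
      ∀ (g : G) x, ms (g • x) = g • ms x := by
  have hone : ∀ x : V, ∃ D, (quotientGraph Γ P).Adj (P.blockOf x) D ∧
      ∀ C, (quotientGraph Γ P).Adj (P.blockOf x) C → (C ∉ blocksNear Γ P x ↔ C = D) := by
    intro x
    obtain ⟨D, hD⟩ := Set.ncard_eq_one.1 ((S.ncard_missed (P.blockOf x) ⟨x, rfl⟩).trans h1)
    have hD' : D ∈ ({D} : Set _) := rfl
    rw [← hD] at hD'
    refine ⟨D, D.2, fun C hC => ⟨fun h => ?_, ?_⟩⟩
    · have : (⟨C, hC⟩ : (quotientGraph Γ P).neighborSet (P.blockOf x)) ∈ ({D} : Set _) := hD ▸ h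
      exact congrArg Subtype.val this
    · rintro rfl
      exact hD'
  choose ms hms1 hms2 using hone
  refine ⟨ms, hms1, hms2, fun g x => ?_⟩
  symm
  have hadj : (quotientGraph Γ P).Adj (P.blockOf (g • x)) (g • ms x) := by
    rw [← P.smul_blockOf]
    exact (smul_adj_iff _ g).2 (hms1 x)
  rw [← hms2 (g • x) _ hadj, smul_mem_blocksNear_iff, hms2 x _ (hms1 x)]

theorem caseD_structure [Finite V] [ActsByAut G Γ] (S : Setting Γ P v k r b) {a : ℕ}
    (h : CaseD Γ P v b r a) :
    ∃ (R : InvPartition G V) (hR : R.Refines P),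
      (∀ A : R.Block, (R.carrier A).ncard = 3) ∧
      (∃ (D : Set (P.Block × P.Block × P.Block × P.Block))
        (hD : IsSelfPairedOrbit G (quotientGraph Γ P) D),
        Nonempty (quotientGraph Γ R ≃g
          threeArcGraph (quotientGraph Γ P) D hD.three_arc hD.self_paired)) ∧
      Nonempty (quotientGraph (quotientGraph Γ R) (R.hat P hR) ≃g quotientGraph Γ P) ∧
      HasParameters (quotientGraph Γ R) (R.hat P hR) a (a - 1) (a - 1) a := by
  obtain ⟨ha, hp, -⟩ := h
  simp only [Prod.mk.injEq] at hp
  obtain ⟨rfl, rfl, rfl⟩ := hp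
  obtain ⟨ms, hadj, hms, hequiv⟩ := S.exists_missed_block (by omega)
  have hnear : ∀ x C, (quotientGraph Γ P).Adj (P.blockOf x) C → C ≠ ms x →
      C ∈ blocksNear Γ P x := by
    intro x C hC hne
    by_contra hno
    exact hne ((hms x C hC).1 hno)
  have hne : ∀ {x y}, Γ.Adj x y → P.blockOf y ≠ ms x := by
    intro x y hxy he
    exact ((hms x _ (S.quotient_adj hxy)).2 he) (adj_mem_blocksNear hxy)
  -- Two vertices are equivalent when they share both their block and the block they miss; the
  -- classes, of size 3, correspond to the arcs of the quotient.
  let R : InvPartition G V :=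
    { toSetoid := Setoid.ker fun x => (P.blockOf x, ms x)
      smul_rel := by
        intro g x y hxy
        have h1 : (P.blockOf x, ms x) = (P.blockOf y, ms y) := hxy
        change (P.blockOf (g • x), ms (g • x)) = (P.blockOf (g • y), ms (g • y))
        rw [Prod.mk.injEq] at h1
        rw [hequiv, hequiv, ← P.smul_blockOf, ← P.smul_blockOf, h1.1, h1.2] }
  have hRrel : ∀ x y, R.blockOf x = R.blockOf y ↔ P.blockOf x = P.blockOf y ∧ ms x = ms y := by
    intro x y
    refine Quotient.eq.trans ?_
    exact Prod.ext_iff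
  have hR : R.Refines P := fun x y hxy => ((hRrel x y).1 hxy).1
  have hfib : ∀ B C, (quotientGraph Γ P).Adj B C →
      {x | P.blockOf x = B ∧ ms x = C}.ncard = 3 := by
    intro B C hBC
    have h1 := S.ncard_misses B ⟨C, hBC⟩
    rw [show {x | Misses Γ P B x ⟨C, hBC⟩} = {x : P.carrier B | C ∉ blocksNear Γ P (x : V)} from rfl,
      ncard_setOf_subtype (fun x => x ∈ P.carrier B) (fun x => C ∉ blocksNear Γ P x)] at h1
    rw [← h1]
    congr 1
    ext x
    refine and_congr_right fun hx => ?_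
    have hx' : P.blockOf x = B := hx
    rw [hms x C (hx' ▸ hBC), eq_comm]
  let κ : R.Block → (quotientGraph Γ P).Dart :=
    Quotient.lift (fun x => ⟨(P.blockOf x, ms x), hadj x⟩) (fun x y hxy =>
      SimpleGraph.Dart.ext _ _ hxy)
  have hκ : ∀ x, κ (R.blockOf x) = ⟨(P.blockOf x, ms x), hadj x⟩ := fun _ => rfl
  have hκbij : Function.Bijective κ := by
    constructor
    · intro A A' hAA
      obtain ⟨x, rfl⟩ := R.exists_blockOf_eq A
      obtain ⟨y, rfl⟩ := R.exists_blockOf_eq A'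
      rw [hκ, hκ, SimpleGraph.Dart.ext_iff, Prod.mk.injEq] at hAA
      exact (hRrel x y).2 hAA
    · rintro ⟨⟨B, C⟩, hBC⟩
      obtain ⟨x, rfl, rfl⟩ := Set.nonempty_of_ncard_ne_zero (s := {x | P.blockOf x = B ∧ ms x = C})
        (by rw [hfib B C hBC]; omega)
      exact ⟨R.blockOf x, rfl⟩
  let K : R.Block ≃ (quotientGraph Γ P).Dart := Equiv.ofBijective κ hκbij
  have hK : ∀ x, K (R.blockOf x) = ⟨(P.blockOf x, ms x), hadj x⟩ := fun _ => rfl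
  have hRadj : ∀ {x y}, Γ.Adj x y → (quotientGraph Γ R).Adj (R.blockOf x) (R.blockOf y) :=
    fun {x y} hxy => ⟨fun he => S.blockOf_ne_of_adj hxy (hR _ _ he), x, rfl, y, rfl, hxy⟩
  have hRfst : ∀ {A A'}, (quotientGraph Γ R).Adj A A' →
      ∃ x y, Γ.Adj x y ∧ R.blockOf x = A ∧ R.blockOf y = A' := by
    rintro A A' ⟨-, x, hx, y, hy, hxy⟩
    exact ⟨x, y, hxy, hx, hy⟩
  refine ⟨R, hR, ?_, ?_, ?_⟩
  · intro A
    obtain ⟨x, rfl⟩ := R.exists_blockOf_eq A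
    rw [← hfib _ _ (hadj x)]
    congr 1
    ext y
    exact hRrel y x
  -- The 3-arcs read off from edges of Γ. They form one orbit since G is transitive on arcs, and
  -- reversing an edge reverses the 3-arc.
  · let D : Set (P.Block × P.Block × P.Block × P.Block) :=
      {t | ∃ x y, Γ.Adj x y ∧ t = (ms x, P.blockOf x, P.blockOf y, ms y)}
    have hD : IsSelfPairedOrbit G (quotientGraph Γ P) D := by
      refine ⟨?_, ?_, ?_⟩
      · rintro _ ⟨x, y, hxy, rfl⟩
        exact ⟨(hadj x).symm, S.quotient_adj hxy, hadj y, (hne hxy).symm, hne hxy.symm⟩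
      · rintro p q s t ⟨x, y, hxy, he⟩
        simp only [Prod.mk.injEq] at he
        obtain ⟨rfl, rfl, rfl, rfl⟩ := he
        exact ⟨y, x, hxy.symm, rfl⟩
      · obtain ⟨B⟩ := S.connected.nonempty
        obtain ⟨C, -, x, -, y, -, hxy⟩ := S.exists_adj B
        refine ⟨(ms x, P.blockOf x, P.blockOf y, ms y), Set.ext fun t => ⟨?_, ?_⟩⟩
        · rintro ⟨x', y', hxy', rfl⟩
          obtain ⟨g, rfl, rfl⟩ := S.symmetric.arc_trans hxy hxy'
          refine ⟨g, ?_⟩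
          rw [hequiv, hequiv]
          rfl
        · rintro ⟨g, rfl⟩
          refine ⟨g • x, g • y, (smul_adj_iff Γ g).2 hxy, ?_⟩
          rw [hequiv, hequiv]
          rfl
    refine ⟨D, hD, ⟨{ toEquiv := K, map_rel_iff' := ?_ }⟩⟩
    intro A A'
    constructor
    · rintro ⟨x, y, hxy, he⟩
      simp only [Prod.mk.injEq] at he
      have h1 : A = R.blockOf x := K.injective (by
        rw [hK]
        exact SimpleGraph.Dart.ext _ _ (Prod.ext he.2.1 he.1))
      have h2 : A' = R.blockOf y := K.injective (by
        rw [hK]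
        exact SimpleGraph.Dart.ext _ _ (Prod.ext he.2.2.1 he.2.2.2))
      rw [h1, h2]
      exact hRadj hxy
    · intro hAA
      obtain ⟨x, y, hxy, rfl, rfl⟩ := hRfst hAA
      exact ⟨x, y, hxy, rfl⟩
  -- Blocks of blocks are the original blocks; under `K` and `τ`, the four parameters become counts
  -- of arcs with a given first vertex.
  · let τ' : (R.hat P hR).Block → P.Block := Quotient.lift (R.above P hR) fun _ _ h => h
    have hτbij : Function.Bijective τ' := by
      constructor
      · intro E E'
        induction E using Quotient.inductionOn
        induction E' using Quotient.inductionOn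
        intro he
        exact Quotient.sound he
      · intro B
        obtain ⟨x, rfl⟩ := P.exists_blockOf_eq B
        exact ⟨(R.hat P hR).blockOf (R.blockOf x), rfl⟩
    let τ : (R.hat P hR).Block ≃ P.Block := Equiv.ofBijective τ' hτbij
    have hτ : ∀ A, τ ((R.hat P hR).blockOf A) = (K A).fst := by
      intro A
      obtain ⟨x, rfl⟩ := R.exists_blockOf_eq A
      rfl
    have hcar : ∀ A E, A ∈ (R.hat P hR).carrier E ↔ (K A).fst = τ E := by
      intro A E
      rw [← hτ, τ.injective.eq_iff]
      rfl
    have hKx : ∀ x, (K (R.blockOf x)).fst = P.blockOf x := fun _ => rfl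
    have hKx' : ∀ x, (K (R.blockOf x)).snd = ms x := fun _ => rfl
    have hnearE : ∀ A E, E ∈ blocksNear (quotientGraph Γ R) (R.hat P hR) A ↔
        (quotientGraph Γ P).Adj (K A).fst (τ E) ∧ τ E ≠ (K A).snd := by
      intro A E
      constructor
      · rintro ⟨A', hA', hAA⟩
        rw [hcar] at hA'
        obtain ⟨x, y, hxy, rfl, rfl⟩ := hRfst hAA
        rw [← hA']
        exact ⟨S.quotient_adj hxy, hne hxy⟩
      · rintro ⟨h1, h2⟩
        obtain ⟨x, rfl⟩ := R.exists_blockOf_eq A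
        obtain ⟨y, hy, hxy⟩ := hnear x _ h1 h2
        exact ⟨R.blockOf y, (hcar _ _).2 hy, hRadj hxy⟩
    have hQadj : ∀ E E', (quotientGraph (quotientGraph Γ R) (R.hat P hR)).Adj E E' ↔
        (quotientGraph Γ P).Adj (τ E) (τ E') := by
      intro E E'
      constructor
      · rintro ⟨-, A, hA, A', hA', hAA⟩
        rw [hcar] at hA hA'
        obtain ⟨x, y, hxy, rfl, rfl⟩ := hRfst hAA
        rw [← hA, ← hA']
        exact S.quotient_adj hxy
      · intro hEE
        obtain ⟨hne', x, hx, y, hy, hxy⟩ := hEE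
        refine ⟨fun he => hne' (congrArg τ he), R.blockOf x, (hcar _ _).2 hx, R.blockOf y,
          (hcar _ _).2 hy, hRadj hxy⟩
    have hdel : ∀ B C, (quotientGraph Γ P).Adj B C →
        {D | (quotientGraph Γ P).Adj B D ∧ D ≠ C}.ncard = b - 1 := by
      intro B C hBC
      have h1 := ncard_and_ne (fun D => (quotientGraph Γ P).Adj B D) C hBC
      rw [show {D | (quotientGraph Γ P).Adj B D}.ncard = b from S.params.valency B] at h1
      rw [← h1]
      congr 1
      ext D
      exact and_comm
    refine ⟨⟨{ toEquiv := τ, map_rel_iff' := fun {E E'} => (hQadj E E').symm }⟩, ?_, ?_, ?_, ?_⟩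
    · intro E
      have h1 : (R.hat P hR).carrier E = {A | (K A).fst = τ E ∧ True} := by
        ext A
        rw [hcar]
        simp
      rw [h1, ncard_setOf_equiv K (fun t => t.fst = τ E ∧ True),
        ncard_dart_fst_eq (quotientGraph Γ P) (τ E) (fun _ => True), ← S.params.valency (τ E)]
      congr 1
      ext C
      simp
    · intro E E' hEE
      rw [hQadj] at hEE
      have h1 : toward (quotientGraph Γ R) (R.hat P hR) E E' =
          {A | (K A).fst = τ E ∧ (K A).snd ≠ τ E'} := by
        ext A
        change A ∈ (R.hat P hR).carrier E ∧ E' ∈ blocksNear _ (R.hat P hR) A ↔ _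
        rw [hcar, hnearE]
        constructor
        · rintro ⟨e1, e2, e3⟩
          exact ⟨e1, e3.symm⟩
        · rintro ⟨e1, e2⟩
          exact ⟨e1, by rw [e1]; exact hEE, e2.symm⟩
      rw [h1, ncard_setOf_equiv K (fun t => t.fst = τ E ∧ t.snd ≠ τ E'),
        ncard_dart_fst_eq (quotientGraph Γ P) (τ E) (fun C => C ≠ τ E'), hdel _ _ hEE]
    · intro A
      have h1 : blocksNear (quotientGraph Γ R) (R.hat P hR) A =
          {E | (quotientGraph Γ P).Adj (K A).fst (τ E) ∧ τ E ≠ (K A).snd} := by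
        ext E
        exact hnearE A E
      rw [h1, ncard_setOf_equiv τ
        (fun C => (quotientGraph Γ P).Adj (K A).fst C ∧ C ≠ (K A).snd), hdel _ _ (K A).adj]
    · intro E
      rw [← S.params.valency (τ E)]
      have h1 : (quotientGraph (quotientGraph Γ R) (R.hat P hR)).neighborSet E =
          {E' | (quotientGraph Γ P).Adj (τ E) (τ E')} := by
        ext E'
        exact hQadj E E'
      rw [h1, ncard_setOf_equiv τ (fun C => (quotientGraph Γ P).Adj (τ E) C)]
      rfl

/-- As r = 2, a vertex x of B sees two blocks C and D and gives the 2-path C B D; as λ = 1, every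
2-path comes from exactly one vertex. -/
theorem caseE_structure [Finite V] [ActsByAut G Γ] (S : Setting Γ P v k r b)
    (h : CaseE Γ P v b r) :
    ∃ (D : Set (P.Block × P.Block × P.Block × P.Block))
      (hD : IsSelfPairedOrbit G (quotientGraph Γ P) D),
      Nonempty (Γ ≃g twoPathGraph (quotientGraph Γ P) D hD.three_arc hD.self_paired) := by
  obtain ⟨hp, hlam, -⟩ := h
  simp only [Prod.mk.injEq] at hp
  obtain ⟨rfl, rfl, rfl⟩ := hp
  have hpath : ∀ x : V, ∃ p : TwoPath (quotientGraph Γ P), p.1.1 = P.blockOf x ∧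
      ∀ C, C ∈ p.1.2 ↔ C ∈ blocksNear Γ P x := by
    intro x
    obtain ⟨C, D, hCD, hx⟩ := Set.ncard_eq_two.1 (S.params.blocksNear_card x)
    refine ⟨⟨(P.blockOf x, s(C, D)), ?_, ?_⟩, rfl, fun E => ?_⟩
    · simpa using hCD
    · intro E hE
      apply S.adj_of_mem_blocksNear
      rw [hx]
      simpa using hE
    · change E ∈ s(C, D) ↔ _
      rw [hx]
      simp
  choose φ hφ1 hφ2 using hpath
  have hφs : ∀ x C D, C ≠ D → ((φ x).1.2 = s(C, D) ↔ C ∈ blocksNear Γ P x ∧ D ∈ blocksNear Γ P x) := by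
    intro x C D hCD
    rw [← hφ2, ← hφ2, Sym2.mem_and_mem_iff hCD]
  have huniq : ∀ {x y C D}, P.blockOf x = P.blockOf y → C ≠ D → C ∈ blocksNear Γ P x →
      D ∈ blocksNear Γ P x → C ∈ blocksNear Γ P y → D ∈ blocksNear Γ P y → x = y := by
    intro x y C D hxy hCD hC hD hC' hD'
    obtain ⟨z, hz⟩ := Set.ncard_eq_one.1 (hlam (P.blockOf x) C D (S.adj_of_mem_blocksNear hC)
      (S.adj_of_mem_blocksNear hD) hCD)
    have h1 : x ∈ ({z} : Set V) := hz ▸ ⟨⟨rfl, hC⟩, ⟨rfl, hD⟩⟩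
    have h2 : y ∈ ({z} : Set V) := hz ▸ ⟨⟨hxy.symm, hC'⟩, ⟨hxy.symm, hD'⟩⟩
    exact h1.trans h2.symm
  have htwo : ∀ {x C D E}, C ∈ blocksNear Γ P x → D ∈ blocksNear Γ P x → E ∈ blocksNear Γ P x →
      C ≠ E → D ≠ E → C = D := by
    intro x C D E hC hD hE hCE hDE
    obtain ⟨p, q, hpq, hx⟩ := Set.ncard_eq_two.1 (S.params.blocksNear_card x)
    rw [hx, Set.mem_insert_iff, Set.mem_singleton_iff] at hC hD hE
    grind
  have hφbij : Function.Bijective φ := by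
    constructor
    · intro x y hxy
      obtain ⟨C, D, hCD, hx⟩ := Set.ncard_eq_two.1 (S.params.blocksNear_card x)
      have hC : C ∈ blocksNear Γ P x := by rw [hx]; simp
      have hD : D ∈ blocksNear Γ P x := by rw [hx]; simp
      refine huniq (by rw [← hφ1, ← hφ1, hxy]) hCD hC hD ?_ ?_
      · rwa [← hφ2, ← hxy, hφ2]
      · rwa [← hφ2, ← hxy, hφ2]
    · rintro ⟨⟨B, p⟩, hp, hB⟩
      induction p using Sym2.inductionOn with
      | hf C D =>
        have hCD : C ≠ D := by simpa using hp
        obtain ⟨x, hx⟩ := Set.ncard_eq_one.1 (hlam B C D (hB C (by simp)) (hB D (by simp)) hCD)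
        have hx' : x ∈ ({x} : Set V) := rfl
        rw [← hx] at hx'
        exact ⟨x, Subtype.ext (Prod.ext ((hφ1 x).trans hx'.1.1)
          ((hφs x C D hCD).2 ⟨hx'.1.2, hx'.2.2⟩))⟩
  -- An edge xy extends to a 3-arc by the other block seen by x and the other one seen by y; `htwo`
  -- makes both unique, so arc-transitivity gives one orbit.
  let D : Set (P.Block × P.Block × P.Block × P.Block) :=
    {t | ∃ x y, Γ.Adj x y ∧ P.blockOf x = t.2.1 ∧ P.blockOf y = t.2.2.1 ∧
      t.1 ∈ blocksNear Γ P x ∧ t.1 ≠ t.2.2.1 ∧ t.2.2.2 ∈ blocksNear Γ P y ∧ t.2.2.2 ≠ t.2.1}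
  have hother : ∀ {x y}, Γ.Adj x y → ∃ C ∈ blocksNear Γ P x, C ≠ P.blockOf y := by
    intro x y hxy
    obtain ⟨C, D, hCD, hx⟩ := Set.ncard_eq_two.1 (S.params.blocksNear_card x)
    by_cases hC : C = P.blockOf y
    · exact ⟨D, by rw [hx]; simp, fun hD => hCD (hC.trans hD.symm)⟩
    · exact ⟨C, by rw [hx]; simp, hC⟩
  have hD : IsSelfPairedOrbit G (quotientGraph Γ P) D := by
    refine ⟨?_, ?_, ?_⟩
    · rintro ⟨p, q, s, t⟩ ⟨x, y, hxy, rfl, rfl, h1, h2, h3, h4⟩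
      exact ⟨(S.adj_of_mem_blocksNear h1).symm, S.quotient_adj hxy, S.adj_of_mem_blocksNear h3,
        h2, Ne.symm h4⟩
    · rintro p q s t ⟨x, y, hxy, h1, h2, h3, h4, h5, h6⟩
      exact ⟨y, x, hxy.symm, h2, h1, h5, h6, h3, h4⟩
    · obtain ⟨B⟩ := S.connected.nonempty
      obtain ⟨C, -, x, -, y, -, hxy⟩ := S.exists_adj B
      obtain ⟨p, hp, hpy⟩ := hother hxy
      obtain ⟨t, ht, htx⟩ := hother hxy.symm
      refine ⟨(p, P.blockOf x, P.blockOf y, t), Set.ext ?_⟩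
      rintro ⟨p', q', s', t'⟩
      constructor
      · rintro ⟨x', y', hxy', rfl, rfl, h1, h2, h3, h4⟩
        obtain ⟨g, rfl, rfl⟩ := S.symmetric.arc_trans hxy hxy'
        refine ⟨g, ?_⟩
        have e1 : g • p = p' := htwo ((smul_mem_blocksNear_iff g).2 hp) h1
          (adj_mem_blocksNear hxy') (fun e => hpy (smul_left_cancel g e)) h2
        have e2 : g • t = t' := htwo ((smul_mem_blocksNear_iff g).2 ht) h3
          (adj_mem_blocksNear hxy'.symm) (fun e => htx (smul_left_cancel g e)) h4
        rw [← e1, ← e2]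
        rfl
      · rintro ⟨g, he⟩
        obtain ⟨rfl, rfl, rfl, rfl⟩ : g • p = p' ∧ g • P.blockOf x = q' ∧ g • P.blockOf y = s' ∧
            g • t = t' := by
          simpa [Prod.ext_iff] using he
        exact ⟨g • x, g • y, (smul_adj_iff Γ g).2 hxy, rfl, rfl,
          (smul_mem_blocksNear_iff g).2 hp, fun e => hpy (smul_left_cancel g e),
          (smul_mem_blocksNear_iff g).2 ht, fun e => htx (smul_left_cancel g e)⟩
  refine ⟨D, hD, ⟨{ toEquiv := Equiv.ofBijective φ hφbij, map_rel_iff' := ?_ }⟩⟩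
  intro x y
  constructor
  · rintro ⟨p, t, h1, h2, x', y', hxy, h3, h4, h5, h6, h7, h8⟩
    simp only [Equiv.ofBijective_apply, hφ1] at h1 h2 h3 h4 h5 h6 h7 h8
    rw [hφs _ _ _ h6] at h1
    rw [hφs _ _ _ (Ne.symm h8)] at h2
    have e1 : x' = x := huniq h3 h6 h5 (h4 ▸ adj_mem_blocksNear hxy) h1.1 h1.2
    have e2 : y' = y := huniq h4 h8 h7 (h3 ▸ adj_mem_blocksNear hxy.symm) h2.2 h2.1
    rwa [← e1, ← e2]
  · intro hxy
    obtain ⟨p, hp, hpy⟩ := hother hxy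
    obtain ⟨t, ht, htx⟩ := hother hxy.symm
    refine ⟨p, t, ?_, ?_, x, y, hxy, ?_⟩
    · simp only [Equiv.ofBijective_apply, hφ1]
      exact (hφs _ _ _ hpy).2 ⟨hp, adj_mem_blocksNear hxy⟩
    · simp only [Equiv.ofBijective_apply, hφ1]
      exact (hφs _ _ _ (Ne.symm htx)).2 ⟨adj_mem_blocksNear hxy.symm, ht⟩
    · simp only [Equiv.ofBijective_apply, hφ1]
      exact ⟨trivial, trivial, hp, hpy, ht, htx⟩

end Setting

end SymQuot

/-! ### Valencies that tell the three bipartite graphs of case (c) apart. -/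

section Degrees

theorem ncard_neighborSet_eq_of_iso {T U : Type*} {F : SimpleGraph T} {F' : SimpleGraph U}
    (φ : F ≃g F') (x : T) : (F.neighborSet x).ncard = (F'.neighborSet (φ x)).ncard :=
  Nat.card_congr (φ.mapNeighborSet x)

theorem ncard_neighborSet_copies_four_top (p : Fin 4 × Fin 2) :
    ((copies 4 (⊤ : SimpleGraph (Fin 2))).neighborSet p).ncard = 1 := by
  have h : (copies 4 (⊤ : SimpleGraph (Fin 2))).neighborSet p =
      ((Finset.univ.filter fun q => p.1 = q.1 ∧ p.2 ≠ q.2 : Finset (Fin 4 × Fin 2)) :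
        Set (Fin 4 × Fin 2)) := by
    ext q
    simp [copies]
  rw [h, Set.ncard_coe_finset]
  clear h
  revert p
  decide

theorem ncard_neighborSet_completeBipartiteGraph_four (p : Fin 4 ⊕ Fin 4) :
    ((completeBipartiteGraph (Fin 4) (Fin 4)).neighborSet p).ncard = 4 := by
  have h : (completeBipartiteGraph (Fin 4) (Fin 4)).neighborSet p =
      ((Finset.univ.filter fun q => p.isLeft ≠ q.isLeft : Finset (Fin 4 ⊕ Fin 4)) :
        Set (Fin 4 ⊕ Fin 4)) := by
    ext q
    rcases p with p | p <;> rcases q with q | q <;> simp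
  rw [h, Set.ncard_coe_finset]
  clear h
  revert p
  decide

theorem ncard_neighborSet_completeBipartiteGraph_four_sdiff (p : Fin 4 ⊕ Fin 4) :
    ((completeBipartiteGraph (Fin 4) (Fin 4) \ matching 4).neighborSet p).ncard = 3 := by
  have h : (completeBipartiteGraph (Fin 4) (Fin 4) \ matching 4).neighborSet p =
      ((Finset.univ.filter fun q => p.isLeft ≠ q.isLeft ∧ p.elim id id ≠ q.elim id id :
        Finset (Fin 4 ⊕ Fin 4)) : Set (Fin 4 ⊕ Fin 4)) := by
    ext q
    rcases p with p | p <;> rcases q with q | q <;> simp [matching, eq_comm (a := q) (b := p)]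
  rw [h, Set.ncard_coe_finset]
  clear h
  revert p
  decide

end Degrees

/-! ### The structure of Γ in case (c). -/

namespace SymQuot

variable {G V : Type*} [Group G] [MulAction G V] {Γ : SimpleGraph V} {P : InvPartition G V}

namespace Setting

variable {v k r b : ℕ}

theorem ncard_neighborSet [Finite V] (S : Setting Γ P v k r b) {d : ℕ}
    (hd : ∀ x : V, ∀ C ∈ blocksNear Γ P x, {y | y ∈ P.carrier C ∧ Γ.Adj x y}.ncard = d) (x : V) :
    (Γ.neighborSet x).ncard = r * d := by
  have h := card_mul_eq_of_ncard (A := {C // C ∈ blocksNear Γ P x}) (B := {y // Γ.Adj x y})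
    (fun C y => P.blockOf (y : V) = C) d 1 (fun C => by
      rw [ncard_setOf_subtype (fun y => Γ.Adj x y) (fun y => P.blockOf y = C), ← hd x C C.2]
      congr 1
      ext y
      exact and_comm)
    (fun y => Set.ncard_eq_one.2 ⟨⟨P.blockOf (y : V), adj_mem_blocksNear y.2⟩, by
      ext C
      simp [Subtype.ext_iff, eq_comm]⟩)
  have h1 : Nat.card {C // C ∈ blocksNear Γ P x} = r := S.params.blocksNear_card x
  rw [h1, mul_one] at h
  exact h.symm

/-- If `G_{B,C}` is 2-transitive on `B ∩ Γ(C)` then so many common neighbours are there. -/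
theorem exists_common_count [Finite V] [ActsByAut G Γ] (S : Setting Γ P v k r b) {d : ℕ}
    (hd : ∀ x : V, ∀ C ∈ blocksNear Γ P x, {y | y ∈ P.carrier C ∧ Γ.Adj x y}.ncard = d)
    {B C : P.Block} (hBC : (quotientGraph Γ P).Adj B C) (hk : 2 ≤ k)
    (h2 : ∀ x y x' y', x ∈ toward Γ P B C → y ∈ toward Γ P B C → x' ∈ toward Γ P B C →
      y' ∈ toward Γ P B C → x ≠ y → x' ≠ y' →
      ∃ g : G, g • C = C ∧ g • x = x' ∧ g • y = y') :
    ∃ m, d * (d - 1) = (k - 1) * m := by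
  have hcard := S.params.toward_card B C hBC
  obtain ⟨x, hx, y, hy, hxy⟩ := (Set.one_lt_ncard_iff_nontrivial_and_finite.1
    (by omega : 1 < (toward Γ P B C).ncard)).1
  have hgen : ∀ z (q : V → Prop), (∀ w, q w → Γ.Adj z w) → z ∈ P.carrier B →
      {w : {w // w ∈ toward Γ P C B} | q w}.ncard = {w | w ∈ P.carrier C ∧ q w}.ncard := by
    intro z q hq hz
    rw [ncard_setOf_subtype (fun w => w ∈ toward Γ P C B) q]
    congr 1
    ext w
    constructor
    · rintro ⟨h, h'⟩
      exact ⟨h.1, h'⟩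
    · rintro ⟨h, h'⟩
      exact ⟨⟨h, z, hz, (hq w h').symm⟩, h'⟩
  have hdeg : ∀ z : {z // z ∈ toward Γ P B C},
      {w : {w // w ∈ toward Γ P C B} | Γ.Adj z w}.ncard = d := by
    intro z
    rw [hgen z (fun w => Γ.Adj z w) (fun w h => h) z.2.1]
    exact hd z C z.2.2
  have hdeg' : ∀ w : {w // w ∈ toward Γ P C B},
      {z : {z // z ∈ toward Γ P B C} | Γ.Adj z w}.ncard = d := by
    intro w
    rw [ncard_setOf_subtype (fun z => z ∈ toward Γ P B C) (fun z => Γ.Adj z w), ← hd w B w.2.2]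
    congr 1
    ext z
    constructor
    · rintro ⟨h, h'⟩
      exact ⟨h.1, h'.symm⟩
    · rintro ⟨h, h'⟩
      exact ⟨⟨h, w, w.2.1, h'.symm⟩, h'.symm⟩
  refine ⟨{w | w ∈ P.carrier C ∧ (Γ.Adj x w ∧ Γ.Adj y w)}.ncard, ?_⟩
  -- Vertices of C ∩ Γ(B) are the points and vertices of B ∩ Γ(C) the lines; 2-transitivity makes
  -- the intersection numbers constant.
  have h := line_count (X := {w // w ∈ toward Γ P C B}) (L := {z // z ∈ toward Γ P B C})
    (fun w z => Γ.Adj z w) d ({w | w ∈ P.carrier C ∧ (Γ.Adj x w ∧ Γ.Adj y w)}.ncard) d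
    hdeg hdeg' ?_ ⟨x, hx⟩
  · have h1 : Nat.card {z // z ∈ toward Γ P B C} = k := hcard
    rwa [h1] at h
  · rintro ⟨x', hx'⟩ ⟨y', hy'⟩ hne
    rw [hgen x' (fun w => Γ.Adj x' w ∧ Γ.Adj y' w) (fun w h => h.1) hx'.1]
    obtain ⟨g, hgC, rfl, rfl⟩ := h2 x y x' y' hx hy hx' hy' hxy (fun e => hne (Subtype.ext e))
    rw [← Set.ncard_image_of_injective {w | w ∈ P.carrier C ∧ (Γ.Adj x w ∧ Γ.Adj y w)}
      (MulAction.injective g)]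
    congr 1
    ext w
    constructor
    · rintro ⟨h, h'⟩
      have hw : P.blockOf w = C := h
      refine ⟨g⁻¹ • w, ⟨?_, ?_⟩, by simp⟩
      · change P.blockOf (g⁻¹ • w) = C
        rw [← P.smul_blockOf, hw, inv_smul_eq_iff, hgC]
      · rwa [← smul_adj_iff Γ g, ← smul_adj_iff Γ g (x := y), smul_inv_smul]
    · rintro ⟨w, ⟨h, h'⟩, rfl⟩
      have hw : P.blockOf w = C := h
      refine ⟨?_, (smul_adj_iff Γ g).2 h'.1, (smul_adj_iff Γ g).2 h'.2⟩
      change P.blockOf (g • w) = C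
      rw [← P.smul_blockOf, hw, hgC]

theorem connected_of_reachable_in_block (S : Setting Γ P v k r b)
    (h : ∀ x y, P.blockOf x = P.blockOf y → Γ.Reachable x y) : Γ.Connected := by
  obtain ⟨B⟩ := S.connected.nonempty
  obtain ⟨x₀, -⟩ := P.exists_blockOf_eq B
  have key : ∀ B C, (quotientGraph Γ P).Reachable B C →
      ∀ x y, P.blockOf x = B → P.blockOf y = C → Γ.Reachable x y := by
    intro B C hBC
    rw [SimpleGraph.reachable_iff_reflTransGen] at hBC
    induction hBC with
    | refl =>
      intro x y hx hy
      exact h x y (hx.trans hy.symm)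
    | tail _ hCD ih =>
      intro x y hx hy
      obtain ⟨-, u, hu, w, hw, huw⟩ := hCD
      exact ((ih x u hx hu).trans huw.reachable).trans (h w y (Eq.trans hw hy.symm))
  exact { preconnected := fun x y => key _ _ (S.connected.preconnected _ _) x y rfl rfl
          nonempty := ⟨x₀⟩ }

/-- Two vertices of a block see four blocks each, out of seven, so they see a common C. There they
have at least three neighbours each among four vertices, hence a common neighbour. -/
theorem caseC_connected [Finite V] (S : Setting Γ P v k r b)
    (hp : (v, b, r) = (7, 7, 4)) {d : ℕ} (hd3 : 3 ≤ d)
    (hd : ∀ x : V, ∀ C ∈ blocksNear Γ P x, {y | y ∈ P.carrier C ∧ Γ.Adj x y}.ncard = d) :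
    Γ.Connected := by
  simp only [Prod.mk.injEq] at hp
  obtain ⟨rfl, rfl, rfl⟩ := hp
  have hk : k = 4 := by have := S.k_eq; omega
  refine S.connected_of_reachable_in_block fun x y hxy => ?_
  obtain ⟨C, hCx, hCy⟩ : ∃ C, C ∈ blocksNear Γ P x ∧ C ∈ blocksNear Γ P y := by
    have h1 := Set.ncard_union_add_ncard_inter (blocksNear Γ P x) (blocksNear Γ P y)
    rw [S.params.blocksNear_card, S.params.blocksNear_card] at h1
    have h2 : (blocksNear Γ P x ∪ blocksNear Γ P y).ncard ≤ 7 := by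
      rw [← S.params.valency (P.blockOf x)]
      refine Set.ncard_le_ncard ?_
      rintro C (hC | hC)
      · exact S.adj_of_mem_blocksNear hC
      · have := S.adj_of_mem_blocksNear hC
        rwa [← hxy] at this
    exact Set.nonempty_of_ncard_ne_zero (s := blocksNear Γ P x ∩ blocksNear Γ P y) (by omega)
  obtain ⟨z, hzx, hzy⟩ : ∃ z, Γ.Adj x z ∧ Γ.Adj y z := by
    have h1 := Set.ncard_union_add_ncard_inter {z | z ∈ P.carrier C ∧ Γ.Adj x z}
      {z | z ∈ P.carrier C ∧ Γ.Adj y z}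
    rw [hd x C hCx, hd y C hCy] at h1
    have h2 : ({z | z ∈ P.carrier C ∧ Γ.Adj x z} ∪ {z | z ∈ P.carrier C ∧ Γ.Adj y z}).ncard ≤ 4 := by
      rw [← hk, ← S.params.toward_card _ _ (S.adj_of_mem_blocksNear hCx).symm]
      refine Set.ncard_le_ncard ?_
      rintro z (hz | hz)
      · exact ⟨hz.1, x, rfl, hz.2.symm⟩
      · exact ⟨hz.1, y, hxy.symm, hz.2.symm⟩
    obtain ⟨z, hz, hz'⟩ := Set.nonempty_of_ncard_ne_zero
      (s := {z | z ∈ P.carrier C ∧ Γ.Adj x z} ∩ {z | z ∈ P.carrier C ∧ Γ.Adj y z}) (by omega)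
    exact ⟨z, hz.2, hz'.2⟩
  exact hzx.reachable.trans hzy.symm.reachable

theorem caseC_structure [Finite V] [inst : ActsByAut G Γ] (S : Setting Γ P v k r b)
    (h : CaseC Γ P v b r) :
    (∀ B : P.Block, ComplementIsFano Γ P B) ∧
    (∀ B : P.Block, IsoPSL32 (permOnNbrs Γ P B)) ∧
    FaithfulSMul G P.Block ∧
    (∀ B C : P.Block, (quotientGraph Γ P).Adj B C →
      (Nonempty (between Γ P B C ≃g copies 4 (⊤ : SimpleGraph (Fin 2))) ∨
        Nonempty (between Γ P B C ≃g completeBipartiteGraph (Fin 4) (Fin 4) \ matching 4) ∨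
        Nonempty (between Γ P B C ≃g completeBipartiteGraph (Fin 4) (Fin 4))) ∧
      (Nonempty (between Γ P B C ≃g copies 4 (⊤ : SimpleGraph (Fin 2))) →
        IsTwoArcTransitive G Γ) ∧
      (Nonempty (between Γ P B C ≃g completeBipartiteGraph (Fin 4) (Fin 4) \ matching 4) →
        Γ.Connected ∧ ∀ x : V, (Γ.neighborSet x).ncard = 12) ∧
      (Nonempty (between Γ P B C ≃g completeBipartiteGraph (Fin 4) (Fin 4)) →
        Γ.Connected ∧ ∀ x : V, (Γ.neighborSet x).ncard = 16)) := by
  obtain ⟨hp, hlam, hiso⟩ := h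
  have hC : ∀ B, Nonempty (FanoCoords (Misses Γ P B)) := S.nonempty_fanoCoords hp hlam
  have hreal : ∀ B (C : FanoCoords (Misses Γ P B)) (M : Matrix (Fin 3) (Fin 3) (ZMod 2)),
      M.det = 1 → C.Realizes (MulAction.stabilizer G B) M := fun B C =>
    (C.isoPSL32_inducedPerm_iff smul_misses_iff).1 (hiso B)
  refine ⟨fun B => ?_, fun B => ?_, ?_, ?_⟩
  · obtain ⟨C⟩ := hC B
    obtain ⟨f, h, hfh⟩ := C.exists_subspace_coords
    refine ⟨f, h, fun x D => ?_⟩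
    rw [← hfh, mem_toward_iff]
    rfl
  · obtain ⟨C⟩ := hC B
    obtain ⟨e⟩ := C.nonempty_inducedPerm_points_mulEquiv_lines
      (H := MulAction.stabilizer G B) smul_misses_iff
    obtain ⟨f⟩ := hiso B
    exact ⟨e.symm.trans f⟩
  · refine ⟨fun {g g'} hgg => ?_⟩
    have := S.faithful
    refine eq_of_smul_eq_smul (α := V) fun x => ?_
    obtain ⟨C⟩ := hC (P.blockOf x)
    have hfix : ∀ D : P.Block, (g'⁻¹ * g) • D = D := fun D => by
      rw [mul_smul, hgg, inv_smul_smul]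
    have h1 := C.smul_point_eq_of_smul_line_eq smul_misses_iff
      (h := ⟨g'⁻¹ * g, hfix _⟩) (fun D => Subtype.ext (hfix D)) ⟨x, rfl⟩
    have h2 : (g'⁻¹ * g) • x = x := congrArg Subtype.val h1
    rwa [mul_smul, inv_smul_eq_iff] at h2
  · intro B C hBC
    have hp' := hp
    simp only [Prod.mk.injEq] at hp'
    obtain ⟨rfl, rfl, rfl⟩ := hp'
    have hk : k = 4 := by have := S.k_eq; omega
    subst hk
    obtain ⟨d, hd1, hd4, hd⟩ := S.exists_degree_between
    obtain ⟨h1, h2, h3, h4⟩ := S.between_bipartite hd hBC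
    -- The stabilizer of a line is 2-transitive on the four points off it, so d(d - 1) is divisible
    -- by 3.
    have hd2 : d ≠ 2 := by
      obtain ⟨m, hm⟩ := S.exists_common_count hd hBC (by norm_num) (by
        intro x y x' y' hx hy hx' hy' hxy hxy'
        obtain ⟨F⟩ := hC B
        obtain ⟨g, hg1, hg2, hg3⟩ := F.exists_smul_points_off_line smul_misses_iff (hreal B F)
          (l := ⟨C, hBC⟩) (a := ⟨x, hx.1⟩) (b := ⟨y, hy.1⟩) (c := ⟨x', hx'.1⟩) (d := ⟨y', hy'.1⟩)
          (fun e => hxy (congrArg Subtype.val e)) (fun e => hxy' (congrArg Subtype.val e))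
          (fun e => e hx.2) (fun e => e hy.2) (fun e => e hx'.2) (fun e => e hy'.2)
        exact ⟨g, congrArg Subtype.val hg1, congrArg Subtype.val hg2, congrArg Subtype.val hg3⟩)
      rintro rfl
      omega
    obtain ⟨t⟩ : Nonempty ↥(toward Γ P B C ∪ toward Γ P C B) := by
      obtain ⟨-, x, hx, y, hy, hxy⟩ := hBC
      exact ⟨⟨x, Or.inl ⟨hx, y, hy, hxy⟩⟩⟩
    refine ⟨?_, ?_, ?_, ?_⟩
    · rcases (by omega : d = 1 ∨ d = 3 ∨ d = 4) with rfl | rfl | rfl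
      · exact Or.inl (nonempty_iso_copies_of_bipartite _ _ 4 h2 h3 h4)
      · exact Or.inr (Or.inl (nonempty_iso_completeBipartiteGraph_sdiff_matching _ _ 4 h1 h2 h3
          (fun x => by rw [h4])))
      · exact Or.inr (Or.inr (nonempty_iso_completeBipartiteGraph _ _ 4 h1 h2 h3 h4))
    · rintro ⟨φ⟩
      have hd' : d = 1 := by
        rw [← h4 t, ncard_neighborSet_eq_of_iso φ, ncard_neighborSet_copies_four_top]
      subst hd'
      have hu : ∀ {x y z}, Γ.Adj x y → Γ.Adj x z → P.blockOf y = P.blockOf z → y = z := by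
        intro x y z hy hz hyz
        obtain ⟨w, hw⟩ := Set.ncard_eq_one.1 (hd x _ (adj_mem_blocksNear hy))
        have e1 : y ∈ ({w} : Set V) := hw ▸ ⟨rfl, hy⟩
        have e2 : z ∈ ({w} : Set V) := hw ▸ ⟨hyz.symm, hz⟩
        exact e1.trans e2.symm
      have := S.symmetric.vertex_trans
      rw [isTwoArcTransitive_iff]
      intro x
      rw [MulAction.is_two_pretransitive_iff]
      rintro ⟨y₁, e1⟩ ⟨y₂, e2⟩ ⟨z₁, e3⟩ ⟨z₂, e4⟩ hy hz
      -- With d = 1, neighbours of x correspond to the blocks seen by x, the lines avoiding x, on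
      -- which the stabilizer of x is 2-transitive.
      obtain ⟨F⟩ := hC (P.blockOf x)
      obtain ⟨g, hg1, hg2, hg3⟩ := F.exists_smul_lines_off_point smul_misses_iff (hreal _ F)
        (x := ⟨x, rfl⟩) (a := ⟨P.blockOf y₁, S.quotient_adj e1⟩)
        (b := ⟨P.blockOf y₂, S.quotient_adj e2⟩) (c := ⟨P.blockOf z₁, S.quotient_adj e3⟩)
        (d := ⟨P.blockOf z₂, S.quotient_adj e4⟩)
        (fun e => hy (Subtype.ext (hu e1 e2 (congrArg Subtype.val e))))
        (fun e => hz (Subtype.ext (hu e3 e4 (congrArg Subtype.val e))))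
        (fun e => e (adj_mem_blocksNear e1)) (fun e => e (adj_mem_blocksNear e2))
        (fun e => e (adj_mem_blocksNear e3)) (fun e => e (adj_mem_blocksNear e4))
      have hgx : (g : G) • x = x := congrArg Subtype.val hg1
      have hadj : ∀ {y}, Γ.Adj x y → Γ.Adj x ((g : G) • y) := fun {y} hxy => by
        have := (smul_adj_iff Γ (g : G)).2 hxy
        rwa [hgx] at this
      refine ⟨⟨g, hgx⟩, Subtype.ext (hu (hadj e1) e3 ?_), Subtype.ext (hu (hadj e2) e4 ?_)⟩
      · exact congrArg Subtype.val hg2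
      · exact congrArg Subtype.val hg3
    · rintro ⟨φ⟩
      have hd' : d = 3 := by
        rw [← h4 t, ncard_neighborSet_eq_of_iso φ,
          ncard_neighborSet_completeBipartiteGraph_four_sdiff]
      subst hd'
      exact ⟨S.caseC_connected hp le_rfl hd, S.ncard_neighborSet hd⟩
    · rintro ⟨φ⟩
      have hd' : d = 4 := by
        rw [← h4 t, ncard_neighborSet_eq_of_iso φ,
          ncard_neighborSet_completeBipartiteGraph_four]
      subst hd'
      exact ⟨S.caseC_connected hp (by norm_num) hd, S.ncard_neighborSet hd⟩

end Setting

end SymQuot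

/-! ### Imprimitive graphs with a prescribed quotient. -/

section Lift

variable {G V W : Type*} [Group G] [MulAction G V] [MulAction G W]

/-- The partition into the fibres of an equivariant map. -/
def SymQuot.InvPartition.ofMap (f : V → W) (hf : ∀ (g : G) x, f (g • x) = g • f x) : InvPartition G V where
  toSetoid := Setoid.ker f
  smul_rel g {x y} h := by
    have h' : f x = f y := h
    change f (g • x) = f (g • y)
    rw [hf, hf, h']

theorem SymQuot.IsTwoArcTransitive.of_iso {X Y : Type*} [MulAction G X] [MulAction G Y]
    {F : SimpleGraph X} {S : SimpleGraph Y} [ActsByAut G F] (φ : F ≃g S)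
    (hφ : ∀ (g : G) x, φ (g • x) = g • φ x) (h : IsTwoArcTransitive G S) :
    IsTwoArcTransitive G F where
  acts := inferInstance
  vertex_trans := by
    have := h.vertex_trans
    refine ⟨fun x y => ?_⟩
    obtain ⟨g, hg⟩ := MulAction.exists_smul_eq G (φ x) (φ y)
    exact ⟨g, φ.injective (by rw [hφ, hg])⟩
  two_arc_trans := by
    rintro x y z x' y' z' ⟨h1, h2, h3⟩ ⟨h1', h2', h3'⟩
    obtain ⟨g, e1, e2, e3⟩ := h.two_arc_trans
      ⟨φ.map_adj_iff.2 h1, φ.map_adj_iff.2 h2, φ.injective.ne h3⟩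
      ⟨φ.map_adj_iff.2 h1', φ.map_adj_iff.2 h2', φ.injective.ne h3'⟩
    exact ⟨g, φ.injective (by rw [hφ, e1]), φ.injective (by rw [hφ, e2]),
      φ.injective (by rw [hφ, e3])⟩

/-- Common frame of both constructions: the blocks are the fibres of an equivariant map onto the
given graph, so only counts in fibres remain to be supplied. -/
theorem exists_setting_of_map [Finite V] [Finite W] [FaithfulSMul G W] {Γ : SimpleGraph V}
    [ActsByAut G Γ] {S : SimpleGraph W} (f : V → W) (hf : ∀ (g : G) x, f (g • x) = g • f x)
    (hsym : IsSymmetric G Γ) (hadj : ∀ {x y}, Γ.Adj x y → S.Adj (f x) (f y))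
    (hconn : S.Connected) (hval : ∀ x, (S.neighborSet x).ncard = 4)
    (hS : IsTwoArcTransitive G S) {k r l : ℕ} (hk : 1 ≤ k)
    (hfib : ∀ a, {x | f x = a}.ncard = k + 3)
    (htow : ∀ a b, S.Adj a b → {x | f x = a ∧ ∃ y, f y = b ∧ Γ.Adj x y}.ncard = k)
    (hnear : ∀ x, {b | ∃ y, f y = b ∧ Γ.Adj x y}.ncard = r)
    (hlam : ∀ a b c, S.Adj a b → S.Adj a c → b ≠ c →
      {x | (f x = a ∧ ∃ y, f y = b ∧ Γ.Adj x y) ∧ (f x = a ∧ ∃ y, f y = c ∧ Γ.Adj x y)}.ncard = l) :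
    ∃ P : InvPartition G V, Setting Γ P (k + 3) k r 4 ∧ HasLambda Γ P l ∧
      IsTwoArcTransitive G (quotientGraph Γ P) ∧
      ∃ φ : quotientGraph Γ P ≃g S, ∀ (g : G) (B : P.Block), φ (g • B) = g • φ B := by
  have hsurj : Function.Surjective f := fun a =>
    Set.nonempty_of_ncard_ne_zero (s := {x | f x = a}) (by rw [hfib]; omega)
  let P : InvPartition G V := InvPartition.ofMap f hf
  let e : P.Block ≃ W := Setoid.quotientKerEquivOfSurjective f hsurj
  have he : ∀ x, e (P.blockOf x) = f x := fun x => rfl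
  have hmem : ∀ x B, x ∈ P.carrier B ↔ f x = e B := fun x B => by
    rw [← he, e.injective.eq_iff]
    rfl
  have hedge : ∀ {B C : P.Block}, S.Adj (e B) (e C) → (quotientGraph Γ P).Adj B C := by
    intro B C h
    obtain ⟨x, hx, y, hy, hxy⟩ := Set.nonempty_of_ncard_ne_zero
      (s := {x | f x = e B ∧ ∃ y, f y = e C ∧ Γ.Adj x y}) (by rw [htow _ _ h]; omega)
    exact ⟨fun e' => S.loopless.irrefl _ (e' ▸ h), x, (hmem _ _).2 hx, y, (hmem _ _).2 hy, hxy⟩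
  let φ : quotientGraph Γ P ≃g S :=
    { toEquiv := e
      map_rel_iff' := by
        intro B C
        refine ⟨hedge, ?_⟩
        rintro ⟨-, x, hx, y, hy, h⟩
        rw [hmem] at hx hy
        rw [← hx, ← hy]
        exact hadj h }
  have hφ : ∀ (g : G) (B : P.Block), φ (g • B) = g • φ B := by
    intro g B
    obtain ⟨x, rfl⟩ := P.exists_blockOf_eq B
    exact hf g x
  have hcar : ∀ B, P.carrier B = {x | f x = e B} := fun B => Set.ext fun x => hmem x B
  have htoward : ∀ B C, toward Γ P B C = {x | f x = e B ∧ ∃ y, f y = e C ∧ Γ.Adj x y} := by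
    intro B C
    ext x
    simp only [toward, hmem, Set.mem_ofPred_eq]
  refine ⟨P, ?_, ?_, IsTwoArcTransitive.of_iso φ hφ hS, φ, hφ⟩
  · refine ⟨⟨fun {g g'} h => ?_⟩, hsym, fun B => ?_, ⟨fun B => ?_, fun B C h => ?_, fun x => ?_,
      fun B => ?_⟩, rfl, hk, ?_, by norm_num⟩
    · refine eq_of_smul_eq_smul (α := W) fun a => ?_
      obtain ⟨x, rfl⟩ := hsurj a
      rw [← hf, h, hf]
    · rw [hcar, hfib]
      refine ⟨by omega, ?_⟩
      obtain ⟨b, hb⟩ := Set.nonempty_of_ncard_ne_zero (s := S.neighborSet (e B))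
        (by rw [hval]; norm_num)
      obtain ⟨y, rfl⟩ := hsurj b
      rw [← hfib (e B)]
      refine Set.ncard_lt_card fun h => ?_
      have hy : f y = e B := (Set.eq_univ_iff_forall.1 h) y
      rw [hy] at hb
      exact S.loopless.irrefl _ hb
    · rw [hcar, hfib]
    · rw [htoward]
      exact htow _ _ (φ.map_adj_iff.2 h)
    · rw [← hnear x, ← ncard_setOf_equiv e]
      congr 1
      ext C
      simp only [blocksNear, hmem]
    · rw [← hval (e B)]
      exact ncard_neighborSet_eq_of_iso φ B
    · exact (SimpleGraph.Iso.connected_iff φ).2 hconn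
  · intro B C D hC hD hCD
    rw [htoward, htoward]
    exact hlam _ _ _ (φ.map_adj_iff.2 hC) (φ.map_adj_iff.2 hD) (e.injective.ne hCD)

end Lift

/-! ### Self-paired orbits of 3-arcs in valency four. -/

section Symmetric

variable {G W : Type*} [Group G] [MulAction G W] {S : SimpleGraph W}

theorem exists_twoArc [Finite W] (hval : ∀ x, (S.neighborSet x).ncard = 4) {x y : W} (h : S.Adj x y) :
    ∃ z, IsTwoArc S x y z := by
  have h1 : 1 < (S.neighborSet y).ncard := by rw [hval]; norm_num
  obtain ⟨z, hz, hne⟩ := Set.exists_ne_of_one_lt_ncard h1 x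
  exact ⟨z, h, hz, hne.symm⟩

theorem SymQuot.IsTwoArcTransitive.exists_smul_arc [Finite W] (hS : IsTwoArcTransitive G S)
    (hval : ∀ x, (S.neighborSet x).ncard = 4) {x y x' y' : W} (h : S.Adj x y) (h' : S.Adj x' y') :
    ∃ g : G, g • x = x' ∧ g • y = y' := by
  obtain ⟨z, hz⟩ := exists_twoArc hval h
  obtain ⟨z', hz'⟩ := exists_twoArc hval h'
  obtain ⟨g, h1, h2, -⟩ := hS.two_arc_trans hz hz'
  exact ⟨g, h1, h2⟩

/-- A permutation of three points is a 3-cycle or has a fixed point. -/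
theorem exists_fixed_cube {A : Type*} (hA : Nat.card A = 3) (π : Equiv.Perm A) :
    ∃ a, π (π (π a)) = a := by
  have key : ∀ p : Equiv.Perm (Fin 3), ∃ i, p (p (p i)) = i := by decide
  have : Finite A := Nat.finite_of_card_ne_zero (by omega)
  let e : A ≃ Fin 3 := (Finite.equivFin A).trans (finCongr hA)
  obtain ⟨i, hi⟩ := key (e.permCongr π)
  refine ⟨e.symm i, ?_⟩
  rw [Equiv.eq_symm_apply]
  simpa [Equiv.permCongr_apply] using hi

/-- A 2-arc transitive graph of valency four has a self-paired orbit of 3-arcs: some power of an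
automorphism that reverses an arc reverses a 3-arc extending it. -/
theorem exists_isSelfPairedOrbit [Finite W] (hS : IsTwoArcTransitive G S) (hconn : S.Connected)
    (hval : ∀ x, (S.neighborSet x).ncard = 4) :
    ∃ D, IsSelfPairedOrbit G S D ∧ ∃ t, t ∈ D := by
  have := hS.acts
  obtain ⟨s⟩ := hconn.nonempty
  obtain ⟨t, hst⟩ : (S.neighborSet s).Nonempty :=
    Set.nonempty_of_ncard_ne_zero (by rw [hval]; norm_num)
  have hst : S.Adj s t := hst
  obtain ⟨h, h1, h2⟩ := hS.exists_smul_arc hval hst hst.symm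
  -- h interchanges s and t, so h² permutes the three neighbours of s other than t and h⁶ fixes one
  -- of them, a. Then g = h³ interchanges s and t while g² fixes a, so g reverses (a, s, t, g • a).
  have hA : ∀ x, (S.Adj s x ∧ x ≠ t) ↔ (S.Adj s ((h * h) • x) ∧ (h * h) • x ≠ t) := by
    have hs : (h * h) • s = s := by rw [mul_smul, h1, h2]
    have ht : (h * h) • t = t := by rw [mul_smul, h2, h1]
    intro x
    rw [← smul_adj_iff S (h * h) (x := s), hs, ne_eq, ne_eq, ← smul_left_cancel_iff (h * h) (y := t),
      ht]
  obtain ⟨⟨a, ha, hat⟩, hfix⟩ := exists_fixed_cube (A := {x // S.Adj s x ∧ x ≠ t}) (by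
    change {x | S.Adj s x ∧ x ≠ t}.ncard = 3
    have := ncard_and_ne (fun x => S.Adj s x) t hst
    rw [show {x | S.Adj s x} = S.neighborSet s from rfl, hval] at this
    refine Eq.trans ?_ this
    congr 1
    ext x
    exact and_comm)
    ((MulAction.toPerm (h * h)).subtypePerm fun x => (hA x).symm)
  have hfix : (h * h) • (h * h) • (h * h) • a = a := congrArg Subtype.val hfix
  have g1 : (h * h * h) • s = t := by simp only [mul_smul, h1, h2]
  have g2 : (h * h * h) • t = s := by simp only [mul_smul, h1, h2]
  have g3 : (h * h * h) • (h * h * h) • a = a := by simpa only [mul_smul] using hfix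
  generalize h * h * h = g at g1 g2 g3
  have hb : S.Adj t (g • a) := by rw [← g1]; exact (smul_adj_iff S g).2 ha
  have hbs : s ≠ g • a := by
    rw [← g2]
    exact fun e => hat (smul_left_cancel g e).symm
  refine ⟨MulAction.orbit G (a, s, t, g • a), ⟨?_, ?_, _, rfl⟩, _, MulAction.mem_orbit_self _⟩
  · rintro _ ⟨x, rfl⟩
    refine ⟨(smul_adj_iff S x).2 ha.symm, (smul_adj_iff S x).2 hst, (smul_adj_iff S x).2 hb, ?_, ?_⟩
    · exact (MulAction.injective x).ne hat
    · exact (MulAction.injective x).ne hbs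
  · rintro _ _ _ _ ⟨x, hx⟩
    simp only [Prod.smul_mk, Prod.mk.injEq] at hx
    obtain ⟨rfl, rfl, rfl, rfl⟩ := hx
    refine ⟨x * g, ?_⟩
    simp only [Prod.smul_mk, mul_smul, g1, g2, g3]

end Symmetric

/-! ### Every 4-valent example occurs in case (a): the graph on arcs. -/

section DartMatching

variable {G W : Type*} [Group G] [MulAction G W]

/-- The action on the arcs of a graph. -/
abbrev dartAction (S : SimpleGraph W) [ActsByAut G S] : MulAction G S.Dart where
  smul g d := ⟨g • d.toProd, (smul_adj_iff S g).2 d.adj⟩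
  one_smul d := SimpleGraph.Dart.ext _ _ (one_smul G d.toProd)
  mul_smul g h d := SimpleGraph.Dart.ext _ _ (mul_smul g h d.toProd)

/-- The graph in which every arc is joined to its reverse. -/
def dartMatching (S : SimpleGraph W) : SimpleGraph S.Dart where
  Adj d d' := d.fst = d'.snd ∧ d.snd = d'.fst
  symm := ⟨fun _ _ h => ⟨h.2.symm, h.1.symm⟩⟩
  loopless := ⟨fun d h => S.loopless.irrefl d.fst (by have := d.adj; rwa [← h.1] at this)⟩

theorem dart_ext {S : SimpleGraph W} {d d' : S.Dart} (h1 : d.fst = d'.fst) (h2 : d.snd = d'.snd) :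
    d = d' :=
  SimpleGraph.Dart.ext _ _ (Prod.ext h1 h2)

end DartMatching

/-- Blocks consist of the arcs with a common first vertex. Each arc is joined only to its reverse,
so it sees only the block of its second vertex. -/
theorem exists_caseA {G : Type w} {W : Type u} [Finite W] [Group G] [MulAction G W]
    [FaithfulSMul G W] (S : SimpleGraph W) (hconn : S.Connected)
    (hval : ∀ x : W, (S.neighborSet x).ncard = 4) (hS : IsTwoArcTransitive G S) :
    ∃ (V : Type u) (_ : Finite V) (_ : MulAction G V) (Γ : SimpleGraph V)
      (_ : ActsByAut G Γ) (P : InvPartition G V) (v k r b : ℕ),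
      Setting Γ P v k r b ∧ CaseA Γ P v b r ∧
      ∃ φ : quotientGraph Γ P ≃g S, ∀ (g : G) (B : P.Block), φ (g • B) = g • φ B := by
  have := hS.acts
  have hfin : Finite S.Dart :=
    Finite.of_injective (fun d => d.toProd) fun _ _ h => SimpleGraph.Dart.ext _ _ h
  let _ : MulAction G S.Dart := dartAction S
  have hfst : ∀ (g : G) (d : S.Dart), (g • d).fst = g • d.fst := fun _ _ => rfl
  have hsnd : ∀ (g : G) (d : S.Dart), (g • d).snd = g • d.snd := fun _ _ => rfl
  have hacts : ActsByAut G (dartMatching S) := ⟨fun g d d' h =>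
    ⟨by rw [hfst, hsnd, h.1], by rw [hfst, hsnd, h.2]⟩⟩
  have hdart : ∀ d d' : S.Dart, ∃ g : G, g • d = d' := fun d d' => by
    obtain ⟨g, h1, h2⟩ := hS.exists_smul_arc hval d.adj d'.adj
    exact ⟨g, dart_ext h1 h2⟩
  have hsym : IsSymmetric G (dartMatching S) := by
    refine ⟨hacts, ⟨hdart⟩, ?_⟩
    intro x y x' y' h h'
    obtain ⟨g, rfl⟩ := hdart x x'
    refine ⟨g, rfl, dart_ext ?_ ?_⟩
    · rw [← h'.2, hfst, ← h.2, hsnd]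
    · rw [← h'.1, hsnd, ← h.1, hfst]
  have hnear : ∀ (d : S.Dart) b, (∃ y : S.Dart, y.fst = b ∧ (dartMatching S).Adj d y) ↔ d.snd = b :=
    fun d b => ⟨fun ⟨y, hy, h⟩ => h.2.trans hy, fun h => ⟨d.symm, h, rfl, rfl⟩⟩
  have hfib : ∀ (a : W) (p : W → Prop),
      {d : S.Dart | d.fst = a ∧ p d.snd}.ncard = {b | S.Adj a b ∧ p b}.ncard := by
    intro a p
    rw [← Set.InjOn.ncard_image (f := fun d : S.Dart => d.snd)]
    · congr 1
      ext b
      constructor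
      · rintro ⟨d, ⟨rfl, h⟩, rfl⟩
        exact ⟨d.adj, h⟩
      · rintro ⟨h, h'⟩
        exact ⟨⟨(a, b), h⟩, ⟨rfl, h'⟩, rfl⟩
    · rintro d ⟨h, -⟩ d' ⟨h', -⟩ e
      exact dart_ext (h.trans h'.symm) e
  have hfour : ∀ a, {d : S.Dart | d.fst = a}.ncard = 1 + 3 := by
    intro a
    have h := hfib a (fun _ => True)
    simp only [and_true] at h
    rw [h]
    exact hval a
  have htoward : ∀ a b, S.Adj a b →
      {d : S.Dart | d.fst = a ∧ ∃ y : S.Dart, y.fst = b ∧ (dartMatching S).Adj d y}.ncard = 1 := by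
    intro a b hab
    simp only [hnear]
    rw [hfib a (fun c => c = b), Set.ncard_eq_one]
    refine ⟨b, ?_⟩
    ext c
    exact ⟨fun h => h.2, fun h => ⟨h ▸ hab, h⟩⟩
  have hone : ∀ d, {b | ∃ y : S.Dart, y.fst = b ∧ (dartMatching S).Adj d y}.ncard = 1 := by
    intro d
    simp only [hnear]
    rw [Set.ncard_eq_one]
    exact ⟨d.snd, by ext; exact eq_comm⟩
  have hzero : ∀ a b c, S.Adj a b → S.Adj a c → b ≠ c → {d : S.Dart |
      (d.fst = a ∧ ∃ y : S.Dart, y.fst = b ∧ (dartMatching S).Adj d y) ∧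
      (d.fst = a ∧ ∃ y : S.Dart, y.fst = c ∧ (dartMatching S).Adj d y)}.ncard = 0 := by
    intro a b c _ _ hbc
    simp only [hnear]
    rw [Set.ncard_eq_zero]
    ext d
    exact ⟨fun h => hbc (h.1.2.symm.trans h.2.2), fun h => h.elim⟩
  obtain ⟨P, hset, hlam, htwo, hφ⟩ := exists_setting_of_map (k := 1) (r := 1) (l := 0)
    (fun d : S.Dart => d.fst) hfst hsym (fun {x y} h => by
      rw [← h.2]
      exact x.adj)
    hconn hval hS le_rfl hfour htoward hone hzero
  refine ⟨S.Dart, hfin, inferInstance, dartMatching S, hacts, P, 4, 1, 1, 4, hset,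
    ⟨rfl, hlam, fun B => ?_⟩, hφ⟩
  rw [hset.isoA4OrS4_permOnBlock_iff rfl]
  exact hset.isTwoArcTransitive_quotient_iff.1 htwo B

/-! ### Every 4-valent example occurs in case (e): the graph on 2-paths. -/

section TwoPaths

variable {G W : Type*} [Group G] [MulAction G W] {S : SimpleGraph W}

/-- The action on the 2-paths of a graph. -/
abbrev twoPathAction (S : SimpleGraph W) [ActsByAut G S] : MulAction G (TwoPath S) where
  smul g p := ⟨(g • p.1.1, p.1.2.map (g • ·)), by
    obtain ⟨⟨m, z⟩, h⟩ := p
    induction z using Sym2.inductionOn with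
    | hf a b =>
      simp only [Sym2.mk_isDiag_iff, Sym2.mem_iff, forall_eq_or_imp, forall_eq,
        Sym2.map_mk] at h ⊢
      exact ⟨(MulAction.injective g).ne h.1, (smul_adj_iff S g).2 h.2.1, (smul_adj_iff S g).2 h.2.2⟩⟩
  one_smul p := Subtype.ext (Prod.ext (one_smul G _) (by
    change Sym2.map (fun x => (1 : G) • x) _ = _
    simp))
  mul_smul g h p := Subtype.ext (Prod.ext (mul_smul g h _) (by
    change Sym2.map (fun x => (g * h) • x) _ = Sym2.map _ (Sym2.map _ _)
    simp only [Sym2.map_map, mul_smul]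
    rfl))

/-- The 2-path `a m b`. -/
def twoPathMk {a m b : W} (h : IsTwoArc S a m b) : TwoPath S :=
  ⟨(m, s(a, b)), by simpa using h.2.2, by simpa using ⟨h.1.symm, h.2.1⟩⟩

theorem exists_twoPathMk (p : TwoPath S) : ∃ (a m b : W) (h : IsTwoArc S a m b), p = twoPathMk h := by
  obtain ⟨⟨m, z⟩, h⟩ := p
  induction z using Sym2.inductionOn with
  | hf a b =>
    simp only [Sym2.mk_isDiag_iff, Sym2.mem_iff, forall_eq_or_imp, forall_eq] at h
    exact ⟨a, m, b, ⟨h.2.1.symm, h.2.2, h.1⟩, rfl⟩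

theorem twoPathMk_of_mem {p : TwoPath S} {b : W} (h : b ∈ p.1.2) :
    ∃ (a : W) (h : IsTwoArc S a p.1.1 b), p = twoPathMk h := by
  obtain ⟨a, m, c, hp, rfl⟩ := exists_twoPathMk p
  rcases Sym2.mem_iff.1 h with rfl | rfl
  · exact ⟨c, ⟨hp.2.1.symm, hp.1.symm, hp.2.2.symm⟩, Subtype.ext (Prod.ext rfl Sym2.eq_swap)⟩
  · exact ⟨a, hp, rfl⟩

theorem ncard_twoPath_middle [Finite W] (hval : ∀ x, (S.neighborSet x).ncard = 4) (m : W) :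
    {p : TwoPath S | p.1.1 = m}.ncard = 6 := by
  classical
  have := Fintype.ofFinite (S.neighborSet m)
  have hcard : Nat.card {z : Sym2 (S.neighborSet m) // ¬ z.IsDiag} = 6 := by
    rw [Nat.card_eq_fintype_card, Sym2.card_subtype_not_diag, ← Nat.card_eq_fintype_card]
    change ((S.neighborSet m).ncard).choose 2 = 6
    rw [hval]
    rfl
  rw [← hcard, ← Set.ncard_univ,
    ← Set.InjOn.ncard_image (f := fun p : TwoPath S => p.1.2) (s := {p | p.1.1 = m}),
    ← Set.ncard_image_of_injective (f := fun z : {z : Sym2 (S.neighborSet m) // ¬ z.IsDiag} =>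
      z.1.map Subtype.val)]
  · congr 1
    ext z
    constructor
    · rintro ⟨p, rfl, rfl⟩
      obtain ⟨a, m, b, h, rfl⟩ := exists_twoPathMk p
      refine ⟨⟨s(⟨a, h.1.symm⟩, ⟨b, h.2.1⟩), ?_⟩, trivial, rfl⟩
      exact fun e => h.2.2 (congrArg Subtype.val (Sym2.mk_isDiag_iff.1 e))
    · rintro ⟨⟨z, hz⟩, -, rfl⟩
      induction z using Sym2.inductionOn with
      | hf a b =>
        refine ⟨twoPathMk (a := a) (m := m) (b := b) ⟨a.2.symm, b.2, fun e => hz ?_⟩, rfl, rfl⟩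
        exact Sym2.mk_isDiag_iff.2 (Subtype.ext e)
  · intro z z' h
    exact Subtype.ext (Sym2.map.injective Subtype.val_injective h)
  · rintro p hp q hq h
    exact Subtype.ext (Prod.ext (Eq.trans hp (Eq.symm hq)) h)

end TwoPaths

/-- Blocks consist of the 2-paths with a common middle vertex, six of them in valency four. A 2-path
sees exactly the blocks of its two ends, which yields r = 2, k = 3 and λ = 1. -/
theorem exists_caseE {G : Type w} {W : Type u} [Finite W] [Group G] [MulAction G W]
    [FaithfulSMul G W] (S : SimpleGraph W) (hconn : S.Connected)
    (hval : ∀ x : W, (S.neighborSet x).ncard = 4) (hS : IsTwoArcTransitive G S) :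
    ∃ (V : Type u) (_ : Finite V) (_ : MulAction G V) (Γ : SimpleGraph V)
      (_ : ActsByAut G Γ) (P : InvPartition G V) (v k r b : ℕ),
      Setting Γ P v k r b ∧ CaseE Γ P v b r ∧
      ∃ φ : quotientGraph Γ P ≃g S, ∀ (g : G) (B : P.Block), φ (g • B) = g • φ B := by
  have := hS.acts
  obtain ⟨D, hD, t₀, ht₀⟩ := exists_isSelfPairedOrbit hS hconn hval
  have hDsmul : ∀ (g : G) t, t ∈ D → g • t ∈ D := by
    obtain ⟨t, rfl⟩ := hD.orbit
    rintro g _ ⟨x, rfl⟩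
    exact ⟨g * x, mul_smul g x t⟩
  have hDtrans : ∀ t ∈ D, ∀ t' ∈ D, ∃ g : G, g • t = t' := by
    obtain ⟨t, rfl⟩ := hD.orbit
    rintro _ ⟨g, rfl⟩ _ ⟨g', rfl⟩
    exact ⟨g' * g⁻¹, by simp [mul_smul]⟩
  have hfin : Finite (TwoPath S) := by unfold TwoPath; infer_instance
  let _ : MulAction G (TwoPath S) := twoPathAction S
  have hmk : ∀ (g : G) {a m b : W} (h : IsTwoArc S a m b) (h' : IsTwoArc S (g • a) (g • m) (g • b)),
      g • twoPathMk h = twoPathMk h' := fun g _ _ _ _ _ => rfl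
  set Γ := twoPathGraph S D hD.three_arc hD.self_paired with hΓ
  have hadj : ∀ p q, Γ.Adj p q ↔ ∃ a m m' d, ∃ (h1 : IsTwoArc S a m m') (h2 : IsTwoArc S m m' d),
      p = twoPathMk h1 ∧ q = twoPathMk h2 ∧ (a, m, m', d) ∈ D := by
    intro p q
    constructor
    · rintro ⟨a, d, h1, h2, h⟩
      obtain ⟨e1, e2, e3, e4, e5⟩ := hD.three_arc _ h
      exact ⟨a, p.1.1, q.1.1, d, ⟨e1, e2, e4⟩, ⟨e2, e3, e5⟩, Subtype.ext (Prod.ext rfl h1),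
        Subtype.ext (Prod.ext rfl h2), h⟩
    · rintro ⟨a, m, m', d, h1, h2, rfl, rfl, h⟩
      exact ⟨a, d, rfl, rfl, h⟩
  have hacts : ActsByAut G Γ := by
    refine ⟨fun g p q h => ?_⟩
    rw [hadj] at h ⊢
    obtain ⟨a, m, m', d, h1, h2, rfl, rfl, h⟩ := h
    have harc : ∀ {x y z}, IsTwoArc S x y z → IsTwoArc S (g • x) (g • y) (g • z) := fun h =>
      ⟨(smul_adj_iff S g).2 h.1, (smul_adj_iff S g).2 h.2.1, (MulAction.injective g).ne h.2.2⟩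
    exact ⟨_, _, _, _, harc h1, harc h2, rfl, rfl, hDsmul g _ h⟩
  have htrans : ∀ {a m b a' m' b' : W} (h : IsTwoArc S a m b) (h' : IsTwoArc S a' m' b'),
      ∃ g : G, g • twoPathMk h = twoPathMk h' := by
    intro a m b a' m' b' h h'
    obtain ⟨g, rfl, rfl, rfl⟩ := hS.two_arc_trans h h'
    exact ⟨g, rfl⟩
  have hsym : IsSymmetric G Γ := by
    refine ⟨hacts, ⟨fun p q => ?_⟩, ?_⟩
    · obtain ⟨a, m, b, h, rfl⟩ := exists_twoPathMk p
      obtain ⟨a', m', b', h', rfl⟩ := exists_twoPathMk q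
      exact htrans h h'
    · intro x y x' y' h h'
      rw [hadj] at h h'
      obtain ⟨a, m, m', d, h1, h2, rfl, rfl, h⟩ := h
      obtain ⟨a', n, n', d', h1', h2', rfl, rfl, h'⟩ := h'
      obtain ⟨g, hg⟩ := hDtrans _ h _ h'
      simp only [Prod.smul_mk, Prod.mk.injEq] at hg
      obtain ⟨rfl, rfl, rfl, rfl⟩ := hg
      exact ⟨g, rfl, rfl⟩
  have hnear : ∀ (p : TwoPath S) b, (∃ q : TwoPath S, q.1.1 = b ∧ Γ.Adj p q) ↔ b ∈ p.1.2 := by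
    intro p b
    constructor
    · rintro ⟨q, rfl, h⟩
      rw [hadj] at h
      obtain ⟨a, m, m', d, h1, h2, rfl, rfl, h⟩ := h
      exact Sym2.mem_mk_right _ _
    · intro h
      obtain ⟨a, h, hp⟩ := twoPathMk_of_mem h
      obtain ⟨a₀, m, m', d⟩ := t₀
      obtain ⟨e1, e2, e3, e4, e5⟩ := hD.three_arc _ ht₀
      -- 2-arc transitivity moves the initial 2-arc of a known 3-arc in D onto the given one, so
      -- every 2-path, in either direction, extends to a 3-arc in D.
      obtain ⟨g, hg1, hg2, hg3⟩ := hS.two_arc_trans ⟨e1, e2, e4⟩ h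
      have ht := hDsmul g _ ht₀
      simp only [Prod.smul_mk, hg1, hg2, hg3] at ht
      obtain ⟨f1, f2, f3, f4, f5⟩ := hD.three_arc _ ht
      exact ⟨twoPathMk ⟨f2, f3, f5⟩, rfl, (hadj _ _).2 ⟨_, _, _, _, h, ⟨f2, f3, f5⟩, hp, rfl, ht⟩⟩
  have htoward : ∀ a b, S.Adj a b →
      {p : TwoPath S | p.1.1 = a ∧ ∃ y : TwoPath S, y.1.1 = b ∧ Γ.Adj p y}.ncard = 3 := by
    intro a b hab
    simp only [hnear]
    have h3 := ncard_and_ne (fun x => S.Adj a x) b hab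
    rw [show {x | S.Adj a x} = S.neighborSet a from rfl, hval] at h3
    refine Eq.trans (Eq.symm ?_) h3
    refine Set.ncard_congr (fun x hx => twoPathMk (a := x) (m := a) (b := b)
      ⟨hx.2.symm, hab, hx.1⟩) (fun x hx => ⟨rfl, Sym2.mem_mk_right _ _⟩) ?_ ?_
    · intro x y hx hy h
      have h' : s(x, b) = s(y, b) := congrArg (fun p : TwoPath S => p.1.2) h
      exact Sym2.congr_left.1 h'
    · rintro p ⟨rfl, hp⟩
      obtain ⟨x, h, hp⟩ := twoPathMk_of_mem hp
      exact ⟨x, ⟨h.2.2, h.1.symm⟩, hp.symm⟩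
  have htwo : ∀ p, {b | ∃ y : TwoPath S, y.1.1 = b ∧ Γ.Adj p y}.ncard = 2 := by
    intro p
    simp only [hnear]
    obtain ⟨a, m, b, h, rfl⟩ := exists_twoPathMk p
    rw [Set.ncard_eq_two]
    refine ⟨a, b, h.2.2, ?_⟩
    ext x
    exact Sym2.mem_iff
  have hone : ∀ a b c, S.Adj a b → S.Adj a c → b ≠ c → {p : TwoPath S |
      (p.1.1 = a ∧ ∃ y : TwoPath S, y.1.1 = b ∧ Γ.Adj p y) ∧
      (p.1.1 = a ∧ ∃ y : TwoPath S, y.1.1 = c ∧ Γ.Adj p y)}.ncard = 1 := by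
    intro a b c hab hac hbc
    simp only [hnear]
    rw [Set.ncard_eq_one]
    refine ⟨twoPathMk (a := b) (m := a) (b := c) ⟨hab.symm, hac, hbc⟩, ?_⟩
    ext p
    constructor
    · rintro ⟨⟨h1, h2⟩, -, h3⟩
      exact Subtype.ext (Prod.ext h1 ((Sym2.mem_and_mem_iff hbc).1 ⟨h2, h3⟩))
    · rintro rfl
      exact ⟨⟨rfl, Sym2.mem_mk_left _ _⟩, rfl, Sym2.mem_mk_right _ _⟩
  obtain ⟨P, hset, hlam, h2at, hφ⟩ := exists_setting_of_map (k := 3) (r := 2) (l := 1)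
    (fun p : TwoPath S => p.1.1) (fun _ _ => rfl) hsym (fun {x y} h => by
      rw [hadj] at h
      obtain ⟨a, m, m', d, h1, h2, rfl, rfl, h⟩ := h
      exact h1.2.1)
    hconn hval hS (by norm_num) (ncard_twoPath_middle hval) htoward htwo hone
  refine ⟨TwoPath S, hfin, inferInstance, Γ, hacts, P, 6, 3, 2, 4, hset,
    ⟨rfl, hlam, fun B => ?_⟩, hφ⟩
  rw [hset.isoA4OrS4_permOnNbrs_iff rfl]
  exact hset.isTwoArcTransitive_quotient_iff.1 h2at B

theorem theorem2 :
    (∀ (V : Type u) (G : Type w) [Finite V] [Group G] [MulAction G V] (Γ : SimpleGraph V)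
      [ActsByAut G Γ] (P : InvPartition G V) (v k r b : ℕ), Setting Γ P v k r b →
      -- the characterization
      (IsTwoArcTransitive G (quotientGraph Γ P) ↔
        CaseA Γ P v b r ∨ CaseB Γ P v b r ∨ CaseC Γ P v b r ∨ (∃ a : ℕ, CaseD Γ P v b r a) ∨
          CaseE Γ P v b r) ∧
      -- structure in case (a)
      (CaseA Γ P v b r →
        (∀ B : P.Block, IsoA4OrS4 (permOnNbrs Γ P B)) ∧
        Nonempty (Γ ≃g copies (Nat.card V / 2) (⊤ : SimpleGraph (Fin 2)))) ∧
      -- structure in case (b)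
      (CaseB Γ P v b r →
        (Nonempty (Γ ≃g copies (3 * (Nat.card V / 6)) (⊤ : SimpleGraph (Fin 2))) ∨
          Nonempty (Γ ≃g copies (Nat.card V / 6) (SimpleGraph.cycleGraph 6)) ∨
          Nonempty (Γ ≃g copies (Nat.card V / 6) (completeBipartiteGraph (Fin 3) (Fin 3)))) ∧
        Nonempty (G ⧸ (MulAction.toPermHom G P.Block).ker ≃* DihedralGroup (Nat.card V / 6))) ∧
      -- structure in case (c)
      (CaseC Γ P v b r →
        (∀ B : P.Block, ComplementIsFano Γ P B) ∧
        (∀ B : P.Block, IsoPSL32 (permOnNbrs Γ P B)) ∧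
        FaithfulSMul G P.Block ∧
        (∀ B C : P.Block, (quotientGraph Γ P).Adj B C →
          (Nonempty (between Γ P B C ≃g copies 4 (⊤ : SimpleGraph (Fin 2))) ∨
            Nonempty (between Γ P B C ≃g completeBipartiteGraph (Fin 4) (Fin 4) \ matching 4) ∨
            Nonempty (between Γ P B C ≃g completeBipartiteGraph (Fin 4) (Fin 4))) ∧
          (Nonempty (between Γ P B C ≃g copies 4 (⊤ : SimpleGraph (Fin 2))) →
            IsTwoArcTransitive G Γ) ∧
          (Nonempty (between Γ P B C ≃g completeBipartiteGraph (Fin 4) (Fin 4) \ matching 4) →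
            Γ.Connected ∧ ∀ x : V, (Γ.neighborSet x).ncard = 12) ∧
          (Nonempty (between Γ P B C ≃g completeBipartiteGraph (Fin 4) (Fin 4)) →
            Γ.Connected ∧ ∀ x : V, (Γ.neighborSet x).ncard = 16))) ∧
      -- structure in case (d)
      (∀ a : ℕ, CaseD Γ P v b r a →
        ∃ (R : InvPartition G V) (hR : R.Refines P),
          (∀ A : R.Block, (R.carrier A).ncard = 3) ∧
          (∃ (D : Set (P.Block × P.Block × P.Block × P.Block))
            (hD : IsSelfPairedOrbit G (quotientGraph Γ P) D),
            Nonempty (quotientGraph Γ R ≃g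
              threeArcGraph (quotientGraph Γ P) D hD.three_arc hD.self_paired)) ∧
          Nonempty (quotientGraph (quotientGraph Γ R) (R.hat P hR) ≃g quotientGraph Γ P) ∧
          HasParameters (quotientGraph Γ R) (R.hat P hR) a (a - 1) (a - 1) a) ∧
      -- structure in case (e)
      (CaseE Γ P v b r →
        ∃ (D : Set (P.Block × P.Block × P.Block × P.Block))
          (hD : IsSelfPairedOrbit G (quotientGraph Γ P) D),
          Nonempty (Γ ≃g
            twoPathGraph (quotientGraph Γ P) D hD.three_arc hD.self_paired))) ∧
    -- every connected 4-valent 2-arc transitive graph occurs as the quotient graph in (a) and (e)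
    (∀ (W : Type u) (G : Type w) [Finite W] [Group G] [MulAction G W] [FaithfulSMul G W]
      (S : SimpleGraph W), S.Connected → (∀ x : W, (S.neighborSet x).ncard = 4) →
      IsTwoArcTransitive G S →
      (∃ (V : Type u) (_ : Finite V) (_ : MulAction G V) (Γ : SimpleGraph V)
        (_ : ActsByAut G Γ) (P : InvPartition G V) (v k r b : ℕ),
        Setting Γ P v k r b ∧ CaseA Γ P v b r ∧
        ∃ φ : quotientGraph Γ P ≃g S, ∀ (g : G) (B : P.Block), φ (g • B) = g • φ B) ∧
      (∃ (V : Type u) (_ : Finite V) (_ : MulAction G V) (Γ : SimpleGraph V)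
        (_ : ActsByAut G Γ) (P : InvPartition G V) (v k r b : ℕ),
        Setting Γ P v k r b ∧ CaseE Γ P v b r ∧
        ∃ φ : quotientGraph Γ P ≃g S, ∀ (g : G) (B : P.Block), φ (g • B) = g • φ B)) := by
  refine ⟨fun V G _ _ _ Γ _ P v k r b S => ⟨S.isTwoArcTransitive_iff_cases, S.caseA_structure,
    S.caseB_structure, S.caseC_structure, fun a h => S.caseD_structure h, S.caseE_structure⟩,
    fun W G _ _ _ _ S hconn hval hS => ⟨exists_caseA S hconn hval hS, exists_caseE S hconn hval hS⟩⟩
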